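/- **Theorem (Soundness).** Consider the calculus whose propositions are the pure propositions $\mathbf P ::= \boldsymbol\top \mid \mathbf 1 \mid \mathbf P\multimap\mathbf P \mid \mathbf P\,\&\,\mathbf P \mid \mathbf P\otimes\mathbf P$ and the mixed propositions $A ::= 0 \mid 1 \mid A\multimap A \mid A\oplus A \mid A\otimes A \mid \mathcal B(\mathbf P)$. Its pure terms are $$m ::= x \mid m + m \mid a\cdot m \mid \langle\rangle \mid * \mid \delta_1(m,m) \mid \lambda x.m \mid m\,m \mid \langle m,m\rangle \mid \delta_\&^i(m,x.m) \mid m\otimes m \mid \delta_\otimes(m,xy.m) \qquad (a\in\mathbb C,\ i\in\{1,2\}),$$ and its mixed terms are $$m ::= x \mid m+m \mid p\cdot m \mid \delta_0(m) \mid * \mid \delta_1(m,m) \mid \lambda x.m \mid m\,m \mid \mathrm{inl}(m) \mid \mathrm{inr}(m) \mid \delta_\oplus(m,x.m,y.m) \mid m\otimes m \mid \delta_\otimes(m,xy.m) \mid \mathcal B(\mathbf m) \mid \tau(m) \qquad (p\ge 0,\ \mathbf m \text{ pure}),$$ both up to $\alpha$-equivalence. Judgements $\Gamma\vdash M:T$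 are derived by the natural-deduction rules of intuitionistic multiplicative additive linear logic (with explicit exchange, and with contexts of pairwise distinct variables), the rules that let $M+N$ and $\alpha\cdot M$ prove $T$ whenever $M$ and $N$ prove $T$ in the same context, and $$\frac{\vdash \mathbf m:\mathbf P}{\vdash\mathcal B(\mathbf m):\mathcal B(\mathbf P)}\qquad \frac{\Gamma\vdash m:\mathcal B(\mathbf P\multimap\mathbf Q)\quad \Delta\vdash n:\mathcal B(\mathbf P)}{\Gamma,\Delta\vdash m\,n:\mathcal B(\mathbf Q)}\qquad \frac{\Gamma\vdash m:\mathcal B(\mathbf P)\otimes\mathcal B(\mathbf Q)}{\Gamma\vdash\tau(m):\mathcal B(\mathbf P\otimes\mathbf Q)} .$$ *Reduction.* Values are given by $\mathbf v_b::=*\mid x\mid \mathbf v_n\otimes \mathbf v_n$ and $\mathbf v_n::=\langle\rangle\mid\lambda x.m\mid\langle \mathbf v,\mathbf v\rangle\mid \mathbf v_b$ in the pure fragment, by $v_b::=*\mid x\mid\mathrm{inl}(v_n)\mid\mathrm{inr}(v_n)\mid v_n\otimes v_n\mid\mathcal B(\mathbf v)$ and $v_n::=\lambda x.m\mid v_b$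 in the mixed one; a value $v$ is a $v_n$ or a linear combination of distinct $v_b$'s, with all coefficients $0$ or all nonzero (coefficient $1$ being left out). The relation $\to$ is the closure, under call-by-value evaluation contexts, of the following rules, where $V,W$ are values, $V_n,W_n$ values of the form $v_n$, $V_b$, $V_{bi}$ values of the form $v_b$, and the terms combined in a sum on the left are distinct: * $\delta_1(\alpha\cdot *,M)\to\alpha\cdot M$; $(\lambda x.M)V\to(V/x)M$; $\delta_\&^i(\langle V_1,V_2\rangle,x.t)\to(V_i/x)t$; $\delta_\oplus(\mathrm{inl}(V),x.m,y.n)\to(V/x)m$; $\delta_\oplus(\mathrm{inr}(V),x.m,y.n)\to(V/y)n$; $\delta_\otimes(V_n\otimes W_n,xy.M)\to(V_n/x,W_n/y)M$; * $a\cdot\langle\rangle\to\langle\rangle$; $\sum_i\alpha_i\cdot\lambda x.M_i\to\lambda x.\sum_i\alpha_i\cdot M_i$; $\sum_ia_i\cdot\langle V_i,W_i\rangle\to\langle\sum_ia_i\cdot V_i,\sum_ia_i\cdot W_i\rangle$; $C[\sum_i\alpha_i\cdot V_{bi}]\to\sum_i\alpha_i\cdot C[V_{bi}]$ for $C=\delta_\oplus(\cdot,x.m,y.n),\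 \delta_\otimes(\cdot,xy.M),\ \mathrm{inl}(\cdot),\ \mathrm{inr}(\cdot),\ \tau(\cdot)$; * $\tau(\mathcal B(\mathbf v)\otimes\mathcal B(\mathbf w))\to\mathcal B(\mathbf v\otimes\mathbf w)$; $\mathcal B(a\cdot\mathbf v_b)\to|a|^2\cdot\mathcal B(\mathbf v_b)$ if $a\ne1$; $(\sum_ip_i\cdot\mathcal B(\mathbf v_i))(\sum_jq_j\cdot\mathcal B(\mathbf w_j))\to\sum_{i,j}p_iq_j\cdot\mathcal B(\mathbf v_i\,\mathbf w_j)$. The relation $\leftrightarrows$ is the congruent equivalence, between terms that prove the same judgement, generated by the axioms $1\cdot M\leftrightarrows M$; commutativity and associativity of $+$; $\alpha\cdot M+\beta\cdot M\leftrightarrows(\alpha+\beta)\cdot M$; $\alpha\cdot(\beta\cdot M)\leftrightarrows\alpha\beta\cdot M$; $\alpha\cdot(M_1+M_2)\leftrightarrows\alpha\cdot M_1+\alpha\cdot M_2$; $M+0\cdot N\leftrightarrows M$ if $M$ is not of the form $0\cdot M'$; and bilinearity of $\otimes$. An algebraic form is a linear combination of distinct base forms, with all coefficients $0$ or all nonzero;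 a base form is a term whose outermost constructor is neither $+$ nor a scalar product and whose immediate subterms are algebraic forms (base forms, if that constructor is $\otimes$). Finally, $M\hookrightarrow N$ if $M\to N$, or $M\leftrightarrows N$ with $N$ a value, or $M$ has no $\to$-reduct and $M\leftrightarrows A\to N$ for an algebraic form $A$ of $M$. *Denotation.* Pure propositions are interpreted as finite-dimensional Hilbert spaces, mixed propositions as finite-dimensional C*-algebras: $\boldsymbol\top$ and $0$ as the zero object, $\mathbf 1$ and $1$ as $\mathbb C$, $\otimes$ as the tensor product, $\&$ and $\oplus$ as the direct sum, $S\multimap T$ as the internal hom $S^*\otimes T$ of the compact closed category $\mathbf{FHilb}$ (linear maps), respectively $\mathbf{FC}^*$ (completely positive maps), and $\mathcal B(\mathbf P)$ as the algebra of linear operators on the space of $\mathbf P$. Contexts are interpreted as tensor products, and a judgement $\Gamma\vdash M:T$ as a morphism $[\![\Gamma\vdash M:T]\!]:[\![\Gamma]\!]\to[\![T]\!]$, by recursion on a derivation in the standard way; $\mathcal B$ is interpreted through $\mathcal B(f)=f(\cdot)f^\dagger$ and the isomorphisms $\tau_{H,K}:\mathcal B(H)\otimes\mathcal B(K)\cong\mathcal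 B(H\otimes K)$ and $\mathbb C\cong\mathcal B(\mathbb C)$. Then: 1. In both fragments: if $\Gamma\vdash M:T$ and $M\hookrightarrow^*N$, then $\Gamma\vdash N:T$ and $[\![\Gamma\vdash M:T]\!]=[\![\Gamma\vdash N:T]\!]$, whichever derivations of the two judgements are used. 2. The denotation of every mixed judgement is completely positive. 3. $\mathcal B(f)=f(\cdot)f^\dagger$, with the isomorphisms $\tau_{H,K}$ and $\mathbb C\cong\mathcal B(\mathbb C)$, is a strong monoidal functor $\mathbf{FHilb}\to\mathbf{FC}^*$. -/

import Mathlib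

open scoped TensorProduct NNReal

noncomputable section

/-! ## Propositions -/

/-- Pure propositions. -/
inductive PTy : Type
  | top
  | one
  | lolli (P Q : PTy)
  | amp (P Q : PTy)
  | tens (P Q : PTy)

/-- Mixed propositions; `MTy.B P` is the modality applied to a pure proposition. -/
inductive MTy : Type
  | zero
  | one
  | lolli (A B : MTy)
  | oplus (A B : MTy)
  | tens (A B : MTy)
  | B (P : PTy)

/-! ## Terms

Terms modulo alpha-equivalence are given in locally nameless form: free variables are names
(natural numbers), bound variables are de Bruijn indices (`bvar`).  `lam m`, the second argument of
`elimWith1`, `elimWith2`, and the second and third arguments of `elimPlus` bind one variable; the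
second argument of `elimTens` binds two, `x.y.m` having `y` at index `0` and `x` at index `1`. -/

/-- Pure terms. -/
inductive PTm : Type
  | bvar (k : ℕ)
  | fvar (x : ℕ)
  | add (m n : PTm)
  | smul (a : ℂ) (m : PTm)
  | topI
  | star
  | elimOne (m n : PTm)
  | lam (m : PTm)
  | app (m n : PTm)
  | pair (m n : PTm)
  | elimWith1 (m n : PTm)
  | elimWith2 (m n : PTm)
  | tens (m n : PTm)
  | elimTens (m n : PTm)

/-- Mixed terms. -/
inductive MTm : Type
  | bvar (k : ℕ)
  | fvar (x : ℕ)
  | add (m n : MTm)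
  | smul (p : ℝ≥0) (m : MTm)
  | elimZero (m : MTm)
  | star
  | elimOne (m n : MTm)
  | lam (m : MTm)
  | app (m n : MTm)
  | inl (m : MTm)
  | inr (m : MTm)
  | elimPlus (m n o : MTm)
  | tens (m n : MTm)
  | elimTens (m n : MTm)
  | B (m : PTm)
  | tau (m : MTm)

/-- Free variables of a pure term. -/
def PTm.fv : PTm → Set ℕ
  | bvar _ => ∅
  | fvar x => {x}
  | add m n => m.fv ∪ n.fv
  | smul _ m => m.fv
  | topI => ∅
  | star => ∅
  | elimOne m n => m.fv ∪ n.fv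
  | lam m => m.fv
  | app m n => m.fv ∪ n.fv
  | pair m n => m.fv ∪ n.fv
  | elimWith1 m n => m.fv ∪ n.fv
  | elimWith2 m n => m.fv ∪ n.fv
  | tens m n => m.fv ∪ n.fv
  | elimTens m n => m.fv ∪ n.fv

/-- Free (mixed) variables of a mixed term. -/
def MTm.fv : MTm → Set ℕ
  | bvar _ => ∅
  | fvar x => {x}
  | add m n => m.fv ∪ n.fv
  | smul _ m => m.fv
  | elimZero m => m.fv
  | star => ∅
  | elimOne m n => m.fv ∪ n.fv
  | lam m => m.fv
  | app m n => m.fv ∪ n.fv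
  | inl m => m.fv
  | inr m => m.fv
  | elimPlus m n o => m.fv ∪ n.fv ∪ o.fv
  | tens m n => m.fv ∪ n.fv
  | elimTens m n => m.fv ∪ n.fv
  | B _ => ∅
  | tau m => m.fv

/-- `m.inst k u` replaces the bound variable that has index `k` at the root of `m` by `u`; for
locally closed `u` this is the (capture-avoiding) substitution `(u/x)m` under the binder `x.m`. -/
def PTm.inst : PTm → ℕ → PTm → PTm
  | bvar j, k, u => if j = k then u else bvar j
  | fvar x, _, _ => fvar x
  | add m n, k, u => add (m.inst k u) (n.inst k u)
  | smul a m, k, u => smul a (m.inst k u)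
  | topI, _, _ => topI
  | star, _, _ => star
  | elimOne m n, k, u => elimOne (m.inst k u) (n.inst k u)
  | lam m, k, u => lam (m.inst (k + 1) u)
  | app m n, k, u => app (m.inst k u) (n.inst k u)
  | pair m n, k, u => pair (m.inst k u) (n.inst k u)
  | elimWith1 m n, k, u => elimWith1 (m.inst k u) (n.inst (k + 1) u)
  | elimWith2 m n, k, u => elimWith2 (m.inst k u) (n.inst (k + 1) u)
  | tens m n, k, u => tens (m.inst k u) (n.inst k u)
  | elimTens m n, k, u => elimTens (m.inst k u) (n.inst (k + 2) u)

/-- See `PTm.inst`. -/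
def MTm.inst : MTm → ℕ → MTm → MTm
  | bvar j, k, u => if j = k then u else bvar j
  | fvar x, _, _ => fvar x
  | add m n, k, u => add (m.inst k u) (n.inst k u)
  | smul p m, k, u => smul p (m.inst k u)
  | elimZero m, k, u => elimZero (m.inst k u)
  | star, _, _ => star
  | elimOne m n, k, u => elimOne (m.inst k u) (n.inst k u)
  | lam m, k, u => lam (m.inst (k + 1) u)
  | app m n, k, u => app (m.inst k u) (n.inst k u)
  | inl m, k, u => inl (m.inst k u)
  | inr m, k, u => inr (m.inst k u)
  | elimPlus m n o, k, u => elimPlus (m.inst k u) (n.inst (k + 1) u) (o.inst (k + 1) u)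
  | tens m n, k, u => tens (m.inst k u) (n.inst k u)
  | elimTens m n, k, u => elimTens (m.inst k u) (n.inst (k + 2) u)
  | B m, _, _ => B m
  | tau m, k, u => tau (m.inst k u)

/-- `(u/x, v/y)n` for the two-variable binder `x.y.n`. -/
def PTm.inst2 (n u v : PTm) : PTm := (n.inst 1 u).inst 0 v

/-- See `PTm.inst2`. -/
def MTm.inst2 (n u v : MTm) : MTm := (n.inst 1 u).inst 0 v

/-! ## Derivations

A context is a list of declarations of pairwise distinct variables.  Derivations are data, since the
interpretation is defined by recursion on them.  Variables that a rule binds are chosen fresh. -/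

abbrev PCtx := List (ℕ × PTy)
abbrev MCtx := List (ℕ × MTy)

/-- The variables that a context declares. -/
abbrev domC {T : Type} (Γ : List (ℕ × T)) : List ℕ := Γ.map Prod.fst

/-- Derivations of pure judgements `Γ ⊢ m : P`. -/
inductive PDer : PCtx → PTm → PTy → Type
  | ax (x : ℕ) (P : PTy) : PDer [(x, P)] (.fvar x) P
  | sum {Γ m n P} : PDer Γ m P → PDer Γ n P → PDer Γ (.add m n) P
  | prod {Γ m P} (a : ℂ) : PDer Γ m P → PDer Γ (.smul a m) P
  | topI (Γ : PCtx) (h : (domC Γ).Nodup) : PDer Γ .topI .top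
  | oneI : PDer [] .star .one
  | oneE {Γ Δ m n P} (h : (domC Γ).Disjoint (domC Δ)) :
      PDer Γ m .one → PDer Δ n P → PDer (Γ ++ Δ) (.elimOne m n) P
  | lolliI {Γ m P Q} (x : ℕ) (hx : x ∉ m.fv) :
      PDer (Γ ++ [(x, P)]) (m.inst 0 (.fvar x)) Q → PDer Γ (.lam m) (.lolli P Q)
  | lolliE {Γ Δ m n P Q} (h : (domC Γ).Disjoint (domC Δ)) :
      PDer Γ m (.lolli P Q) → PDer Δ n P → PDer (Γ ++ Δ) (.app m n) Q
  | withI {Γ m n P Q} : PDer Γ m P → PDer Γ n Q → PDer Γ (.pair m n) (.amp P Q)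
  | withE1 {Γ Δ m n P Q R} (x : ℕ) (h : (domC Γ).Disjoint (domC Δ)) (hx : x ∉ n.fv) :
      PDer Γ m (.amp P Q) → PDer (Δ ++ [(x, P)]) (n.inst 0 (.fvar x)) R →
      PDer (Γ ++ Δ) (.elimWith1 m n) R
  | withE2 {Γ Δ m n P Q R} (x : ℕ) (h : (domC Γ).Disjoint (domC Δ)) (hx : x ∉ n.fv) :
      PDer Γ m (.amp P Q) → PDer (Δ ++ [(x, Q)]) (n.inst 0 (.fvar x)) R →
      PDer (Γ ++ Δ) (.elimWith2 m n) R
  | tensI {Δ Γ m n P Q} (h : (domC Δ).Disjoint (domC Γ)) :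
      PDer Δ m P → PDer Γ n Q → PDer (Δ ++ Γ) (.tens m n) (.tens P Q)
  | tensE {Δ Γ m n P Q R} (x y : ℕ) (h : (domC Δ).Disjoint (domC Γ)) (hx : x ∉ n.fv)
      (hy : y ∉ n.fv) :
      PDer Δ m (.tens P Q) → PDer (Γ ++ [(x, P), (y, Q)]) (n.inst2 (.fvar x) (.fvar y)) R →
      PDer (Δ ++ Γ) (.elimTens m n) R
  | ex {Δ Γ m P Q R} {x y : ℕ} :
      PDer (Δ ++ (y, P) :: (x, Q) :: Γ) m R → PDer (Δ ++ (x, Q) :: (y, P) :: Γ) m R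

/-- Derivations of mixed judgements `Γ ⊢ m : A`. -/
inductive MDer : MCtx → MTm → MTy → Type
  | ax (x : ℕ) (A : MTy) : MDer [(x, A)] (.fvar x) A
  | sum {Γ m n A} : MDer Γ m A → MDer Γ n A → MDer Γ (.add m n) A
  | prod {Γ m A} (p : ℝ≥0) : MDer Γ m A → MDer Γ (.smul p m) A
  | zeroE {Γ m} (Δ : MCtx) (A : MTy) (hΔ : (domC Δ).Nodup) (h : (domC Γ).Disjoint (domC Δ)) :
      MDer Γ m .zero → MDer (Γ ++ Δ) (.elimZero m) A
  | oneI : MDer [] .star .one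
  | oneE {Γ Δ m n A} (h : (domC Γ).Disjoint (domC Δ)) :
      MDer Γ m .one → MDer Δ n A → MDer (Γ ++ Δ) (.elimOne m n) A
  | lolliI {Γ m A B} (x : ℕ) (hx : x ∉ m.fv) :
      MDer (Γ ++ [(x, A)]) (m.inst 0 (.fvar x)) B → MDer Γ (.lam m) (.lolli A B)
  | lolliE {Γ Δ m n A B} (h : (domC Γ).Disjoint (domC Δ)) :
      MDer Γ m (.lolli A B) → MDer Δ n A → MDer (Γ ++ Δ) (.app m n) B
  | oplusI1 {Δ m A} (B : MTy) : MDer Δ m A → MDer Δ (.inl m) (.oplus A B)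
  | oplusI2 {Δ n B} (A : MTy) : MDer Δ n B → MDer Δ (.inr n) (.oplus A B)
  | oplusE {Δ Γ m n o A B C} (x y : ℕ) (h : (domC Δ).Disjoint (domC Γ)) (hx : x ∉ n.fv)
      (hy : y ∉ o.fv) :
      MDer Δ m (.oplus A B) → MDer (Γ ++ [(x, A)]) (n.inst 0 (.fvar x)) C →
      MDer (Γ ++ [(y, B)]) (o.inst 0 (.fvar y)) C → MDer (Δ ++ Γ) (.elimPlus m n o) C
  | tensI {Δ Γ m n A B} (h : (domC Δ).Disjoint (domC Γ)) :
      MDer Δ m A → MDer Γ n B → MDer (Δ ++ Γ) (.tens m n) (.tens A B)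
  | tensE {Δ Γ m n A B C} (x y : ℕ) (h : (domC Δ).Disjoint (domC Γ)) (hx : x ∉ n.fv)
      (hy : y ∉ n.fv) :
      MDer Δ m (.tens A B) → MDer (Γ ++ [(x, A), (y, B)]) (n.inst2 (.fvar x) (.fvar y)) C →
      MDer (Δ ++ Γ) (.elimTens m n) C
  | boxI {m P} : PDer [] m P → MDer [] (.B m) (.B P)
  | boxE {Γ Δ m n P Q} (h : (domC Γ).Disjoint (domC Δ)) :
      MDer Γ m (.B (.lolli P Q)) → MDer Δ n (.B P) → MDer (Γ ++ Δ) (.app m n) (.B Q)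
  | tau {Γ m P Q} : MDer Γ m (.tens (.B P) (.B Q)) → MDer Γ (.tau m) (.B (.tens P Q))
  | ex {Δ Γ m A B C} {x y : ℕ} :
      MDer (Δ ++ (y, A) :: (x, B) :: Γ) m C → MDer (Δ ++ (x, B) :: (y, A) :: Γ) m C

/-! ## Sums, values and algebraic forms -/

/-- `SumOf add s t`: the term `t` is the sum of the (nonempty) multiset `s` of summands, in some
order and bracketing. -/
inductive SumOf {T : Type} (add : T → T → T) : Multiset T → T → Prop
  | single (t : T) : SumOf add {t} t
  | add {s s' t t'} : SumOf add s t → SumOf add s' t' → SumOf add (s + s') (add t t')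

/-- `PLin l t`: `t` is `∑ aᵢ • mᵢ`, where `l` is the multiset of the pairs `(aᵢ, mᵢ)`. -/
def PLin (l : Multiset (ℂ × PTm)) (t : PTm) : Prop :=
  SumOf PTm.add (l.map fun q => PTm.smul q.1 q.2) t

/-- `MLin l t`: `t` is `∑ pᵢ • mᵢ`, where `l` is the multiset of the pairs `(pᵢ, mᵢ)`. -/
def MLin (l : Multiset (ℝ≥0 × MTm)) (t : MTm) : Prop :=
  SumOf MTm.add (l.map fun q => MTm.smul q.1 q.2) t

mutual
/-- The pure values `v_b`. -/
inductive PVb : PTm → Prop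
  | star : PVb .star
  | fvar (x : ℕ) : PVb (.fvar x)
  | tens {v w} : PVn v → PVn w → PVb (.tens v w)
/-- The pure values `v_n`. -/
inductive PVn : PTm → Prop
  | topI : PVn .topI
  | lam (m : PTm) : PVn (.lam m)
  | pair {v w} : PV v → PV w → PVn (.pair v w)
  | base {v} : PVb v → PVn v
/-- Pure values. -/
inductive PV : PTm → Prop
  | norm {v} : PVn v → PV v
  | lin {v} (l : Multiset (ℂ × PTm)) (l' : Multiset PTm) (h0 : ∀ q ∈ l, q.1 ≠ 0)
      (h1 : ∀ q ∈ l, q.1 ≠ 1) (hv : ∀ t, t ∈ l.map Prod.snd + l' → PVb t)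
      (hd : (l.map Prod.snd + l').Nodup)
      (hs : SumOf PTm.add ((l.map fun q => PTm.smul q.1 q.2) + l') v) : PV v
  | zero {v} (l : Multiset PTm) (hv : ∀ t, t ∈ l → PVb t) (hd : l.Nodup)
      (hs : SumOf PTm.add (l.map fun t => PTm.smul 0 t) v) : PV v
end

mutual
/-- The mixed values `v_b`. -/
inductive MVb : MTm → Prop
  | star : MVb .star
  | fvar (x : ℕ) : MVb (.fvar x)
  | inl {v} : MVn v → MVb (.inl v)
  | inr {v} : MVn v → MVb (.inr v)
  | tens {v w} : MVn v → MVn w → MVb (.tens v w)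
  | B {v} : PV v → MVb (.B v)
/-- The mixed values `v_n`. -/
inductive MVn : MTm → Prop
  | lam (m : MTm) : MVn (.lam m)
  | base {v} : MVb v → MVn v
end

/-- Mixed values. -/
inductive MV : MTm → Prop
  | norm {v} : MVn v → MV v
  | lin {v} (l : Multiset (ℝ≥0 × MTm)) (l' : Multiset MTm) (h0 : ∀ q ∈ l, q.1 ≠ 0)
      (h1 : ∀ q ∈ l, q.1 ≠ 1) (hv : ∀ t, t ∈ l.map Prod.snd + l' → MVb t)
      (hd : (l.map Prod.snd + l').Nodup)
      (hs : SumOf MTm.add ((l.map fun q => MTm.smul q.1 q.2) + l') v) : MV v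
  | zero {v} (l : Multiset MTm) (hv : ∀ t, t ∈ l → MVb t) (hd : l.Nodup)
      (hs : SumOf MTm.add (l.map fun t => MTm.smul 0 t) v) : MV v

mutual
/-- Pure base forms. -/
inductive PBase : PTm → Prop
  | bvar (k : ℕ) : PBase (.bvar k)
  | fvar (x : ℕ) : PBase (.fvar x)
  | topI : PBase .topI
  | star : PBase .star
  | elimOne {a b} : PAlg a → PAlg b → PBase (.elimOne a b)
  | lam {a} : PAlg a → PBase (.lam a)
  | app {a b} : PAlg a → PAlg b → PBase (.app a b)
  | pair {a b} : PAlg a → PAlg b → PBase (.pair a b)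
  | elimWith1 {a b} : PAlg a → PAlg b → PBase (.elimWith1 a b)
  | elimWith2 {a b} : PAlg a → PAlg b → PBase (.elimWith2 a b)
  | tens {a b} : PBase a → PBase b → PBase (.tens a b)
  | elimTens {a b} : PAlg a → PAlg b → PBase (.elimTens a b)
/-- Pure algebraic forms: linear combinations of distinct base forms whose coefficients are all zero
or all nonzero; a coefficient `1` may be left out. -/
inductive PAlg : PTm → Prop
  | zero {a} (l : Multiset PTm) (hb : ∀ t, t ∈ l → PBase t) (hd : l.Nodup)
      (hs : SumOf PTm.add (l.map fun t => PTm.smul 0 t) a) : PAlg a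
  | lin {a} (l : Multiset (ℂ × PTm)) (l' : Multiset PTm) (h0 : ∀ q ∈ l, q.1 ≠ 0)
      (hb : ∀ t, t ∈ l.map Prod.snd + l' → PBase t) (hd : (l.map Prod.snd + l').Nodup)
      (hs : SumOf PTm.add ((l.map fun q => PTm.smul q.1 q.2) + l') a) : PAlg a
end

mutual
/-- Mixed base forms. -/
inductive MBase : MTm → Prop
  | bvar (k : ℕ) : MBase (.bvar k)
  | fvar (x : ℕ) : MBase (.fvar x)
  | elimZero {a} : MAlg a → MBase (.elimZero a)
  | star : MBase .star
  | elimOne {a b} : MAlg a → MAlg b → MBase (.elimOne a b)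
  | lam {a} : MAlg a → MBase (.lam a)
  | app {a b} : MAlg a → MAlg b → MBase (.app a b)
  | inl {a} : MAlg a → MBase (.inl a)
  | inr {a} : MAlg a → MBase (.inr a)
  | elimPlus {a b c} : MAlg a → MAlg b → MAlg c → MBase (.elimPlus a b c)
  | tens {a b} : MBase a → MBase b → MBase (.tens a b)
  | elimTens {a b} : MAlg a → MAlg b → MBase (.elimTens a b)
  | B {a} : PAlg a → MBase (.B a)
  | tau {a} : MAlg a → MBase (.tau a)
/-- Mixed algebraic forms. -/
inductive MAlg : MTm → Prop
  | zero {a} (l : Multiset MTm) (hb : ∀ t, t ∈ l → MBase t) (hd : l.Nodup)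
      (hs : SumOf MTm.add (l.map fun t => MTm.smul 0 t) a) : MAlg a
  | lin {a} (l : Multiset (ℝ≥0 × MTm)) (l' : Multiset MTm) (h0 : ∀ q ∈ l, q.1 ≠ 0)
      (hb : ∀ t, t ∈ l.map Prod.snd + l' → MBase t) (hd : (l.map Prod.snd + l').Nodup)
      (hs : SumOf MTm.add ((l.map fun q => MTm.smul q.1 q.2) + l') a) : MAlg a
end

/-! ## The cut-reduction relation `→` -/

/-- The relation `→` on pure terms: the rules, then their closure under the contexts `K`. -/
inductive PStep : PTm → PTm → Prop
  | one (a : ℂ) (m : PTm) : PStep (.elimOne (.smul a .star) m) (.smul a m)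
  | beta (m : PTm) {v} : PV v → PStep (.app (.lam m) v) (m.inst 0 v)
  | with1 {v w} (t : PTm) : PV v → PV w → PStep (.elimWith1 (.pair v w) t) (t.inst 0 v)
  | with2 {v w} (t : PTm) : PV v → PV w → PStep (.elimWith2 (.pair v w) t) (t.inst 0 w)
  | tens {v w} (m : PTm) : PVn v → PVn w → PStep (.elimTens (.tens v w) m) (m.inst2 v w)
  | commTop (a : ℂ) : PStep (.smul a .topI) .topI
  | commLam (l : Multiset (ℂ × PTm)) {s t} (hd : (l.map Prod.snd).Nodup)
      (hs : PLin (l.map fun q => (q.1, .lam q.2)) s) (ht : PLin l t) : PStep s (.lam t)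
  | commPair (l : Multiset (ℂ × PTm × PTm)) {s t u} (hd : (l.map Prod.snd).Nodup)
      (hv : ∀ q ∈ l, PV q.2.1 ∧ PV q.2.2)
      (hs : PLin (l.map fun q => (q.1, .pair q.2.1 q.2.2)) s)
      (ht : PLin (l.map fun q => (q.1, q.2.1)) t) (hu : PLin (l.map fun q => (q.1, q.2.2)) u) :
      PStep s (.pair t u)
  | commTens (l : Multiset (ℂ × PTm)) (m : PTm) {s t} (hd : (l.map Prod.snd).Nodup)
      (hv : ∀ q ∈ l, PVb q.2) (hs : PLin l s)
      (ht : PLin (l.map fun q => (q.1, .elimTens q.2 m)) t) : PStep (.elimTens s m) t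
  | addL {m m'} (n : PTm) : PStep m m' → PStep (.add m n) (.add m' n)
  | smul (a : ℂ) {m m'} : PStep m m' → PStep (.smul a m) (.smul a m')
  | elimOne {m m'} (n : PTm) : PStep m m' → PStep (.elimOne m n) (.elimOne m' n)
  | appL {m m'} (n : PTm) : PStep m m' → PStep (.app m n) (.app m' n)
  | appR {v n n'} : PV v → PStep n n' → PStep (.app v n) (.app v n')
  | pairL {m m'} (n : PTm) : PStep m m' → PStep (.pair m n) (.pair m' n)
  | pairR {v n n'} : PV v → PStep n n' → PStep (.pair v n) (.pair v n')
  | elimWith1 {m m'} (n : PTm) : PStep m m' → PStep (.elimWith1 m n) (.elimWith1 m' n)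
  | elimWith2 {m m'} (n : PTm) : PStep m m' → PStep (.elimWith2 m n) (.elimWith2 m' n)
  | tensL {m m'} (n : PTm) : PStep m m' → PStep (.tens m n) (.tens m' n)
  | tensR {v n n'} : PV v → PStep n n' → PStep (.tens v n) (.tens v n')
  | elimTens {m m'} (n : PTm) : PStep m m' → PStep (.elimTens m n) (.elimTens m' n)

/-- The relation `→` on mixed terms: the rules, then their closure under the contexts `K`. -/
inductive MStep : MTm → MTm → Prop
  | one (p : ℝ≥0) (m : MTm) : MStep (.elimOne (.smul p .star) m) (.smul p m)
  | beta (m : MTm) {v} : MV v → MStep (.app (.lam m) v) (m.inst 0 v)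
  | plus1 {v} (m n : MTm) : MV v → MStep (.elimPlus (.inl v) m n) (m.inst 0 v)
  | plus2 {v} (m n : MTm) : MV v → MStep (.elimPlus (.inr v) m n) (n.inst 0 v)
  | tens {v w} (m : MTm) : MVn v → MVn w → MStep (.elimTens (.tens v w) m) (m.inst2 v w)
  | commLam (l : Multiset (ℝ≥0 × MTm)) {s t} (hd : (l.map Prod.snd).Nodup)
      (hs : MLin (l.map fun q => (q.1, .lam q.2)) s) (ht : MLin l t) : MStep s (.lam t)
  | commPlus (l : Multiset (ℝ≥0 × MTm)) (n o : MTm) {s t} (hd : (l.map Prod.snd).Nodup)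
      (hv : ∀ q ∈ l, MVb q.2) (hs : MLin l s)
      (ht : MLin (l.map fun q => (q.1, .elimPlus q.2 n o)) t) : MStep (.elimPlus s n o) t
  | commTens (l : Multiset (ℝ≥0 × MTm)) (m : MTm) {s t} (hd : (l.map Prod.snd).Nodup)
      (hv : ∀ q ∈ l, MVb q.2) (hs : MLin l s)
      (ht : MLin (l.map fun q => (q.1, .elimTens q.2 m)) t) : MStep (.elimTens s m) t
  | commInl (l : Multiset (ℝ≥0 × MTm)) {s t} (hd : (l.map Prod.snd).Nodup)
      (hv : ∀ q ∈ l, MVb q.2) (hs : MLin l s) (ht : MLin (l.map fun q => (q.1, .inl q.2)) t) :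
      MStep (.inl s) t
  | commInr (l : Multiset (ℝ≥0 × MTm)) {s t} (hd : (l.map Prod.snd).Nodup)
      (hv : ∀ q ∈ l, MVb q.2) (hs : MLin l s) (ht : MLin (l.map fun q => (q.1, .inr q.2)) t) :
      MStep (.inr s) t
  | cast {v w} : PV v → PV w → MStep (.tau (.tens (.B v) (.B w))) (.B (.tens v w))
  | commTau (l : Multiset (ℝ≥0 × MTm)) {s t} (hd : (l.map Prod.snd).Nodup)
      (hv : ∀ q ∈ l, MVb q.2) (hs : MLin l s) (ht : MLin (l.map fun q => (q.1, .tau q.2)) t) :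
      MStep (.tau s) t
  | commB (a : ℂ) (ha : a ≠ 1) {v} : PVb v → MStep (.B (.smul a v)) (.smul (‖a‖₊ ^ 2) (.B v))
  | commApp (l k : Multiset (ℝ≥0 × PTm)) {s t u} (hdl : (l.map Prod.snd).Nodup)
      (hdk : (k.map Prod.snd).Nodup) (hl : ∀ q ∈ l, PV q.2) (hk : ∀ r ∈ k, PV r.2)
      (hs : MLin (l.map fun q => (q.1, .B q.2)) s) (ht : MLin (k.map fun r => (r.1, .B r.2)) t)
      (hu : MLin ((l ×ˢ k).map fun z => (z.1.1 * z.2.1, .B (.app z.1.2 z.2.2))) u) :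
      MStep (.app s t) u
  | addL {m m'} (n : MTm) : MStep m m' → MStep (.add m n) (.add m' n)
  | smul (p : ℝ≥0) {m m'} : MStep m m' → MStep (.smul p m) (.smul p m')
  | elimZero {m m'} : MStep m m' → MStep (.elimZero m) (.elimZero m')
  | elimOne {m m'} (n : MTm) : MStep m m' → MStep (.elimOne m n) (.elimOne m' n)
  | appL {m m'} (n : MTm) : MStep m m' → MStep (.app m n) (.app m' n)
  | appR {v n n'} : MV v → MStep n n' → MStep (.app v n) (.app v n')
  | inl {m m'} : MStep m m' → MStep (.inl m) (.inl m')
  | inr {m m'} : MStep m m' → MStep (.inr m) (.inr m')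
  | elimPlus {m m'} (n o : MTm) : MStep m m' → MStep (.elimPlus m n o) (.elimPlus m' n o)
  | tensL {m m'} (n : MTm) : MStep m m' → MStep (.tens m n) (.tens m' n)
  | tensR {v n n'} : MV v → MStep n n' → MStep (.tens v n) (.tens v n')
  | elimTens {m m'} (n : MTm) : MStep m m' → MStep (.elimTens m n) (.elimTens m' n)
  | B {m m'} : PStep m m' → MStep (.B m) (.B m')
  | tau {m m'} : MStep m m' → MStep (.tau m) (.tau m')

/-! ## The algebraic equivalence `⇄`

One application of an algebraic rule may take place anywhere in a term: in every context `K`, and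
also under binders and in the other arguments, so that every term can be brought to algebraic form.
The relation links terms that prove the same judgement; without this, `0 • m` and `0 • n` would be
equivalent for all `m` and `n`, and reduction would not preserve propositions. -/

/-- One left-to-right application of an algebraic rule, anywhere in a pure term. -/
inductive PRw : PTm → PTm → Prop
  | oneSmul (m : PTm) : PRw (.smul 1 m) m
  | comm (m n : PTm) : PRw (.add m n) (.add n m)
  | assoc (m n o : PTm) : PRw (.add m (.add n o)) (.add (.add m n) o)
  | addSmul (a b : ℂ) (m : PTm) : PRw (.add (.smul a m) (.smul b m)) (.smul (a + b) m)
  | smulSmul (a b : ℂ) (m : PTm) : PRw (.smul a (.smul b m)) (.smul (a * b) m)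
  | smulAdd (a : ℂ) (m n : PTm) : PRw (.smul a (.add m n)) (.add (.smul a m) (.smul a n))
  | addZero (m n : PTm) (h : ∀ m', m ≠ .smul 0 m') : PRw (.add m (.smul 0 n)) m
  | tensSmul (a : ℂ) (m n : PTm) : PRw (.tens m (.smul a n)) (.smul a (.tens m n))
  | smulTens (a : ℂ) (m n : PTm) : PRw (.tens (.smul a m) n) (.smul a (.tens m n))
  | addTens (m m' n : PTm) : PRw (.tens (.add m m') n) (.add (.tens m n) (.tens m' n))
  | tensAdd (m n n' : PTm) : PRw (.tens m (.add n n')) (.add (.tens m n) (.tens m n'))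
  | addL {m m'} (n : PTm) : PRw m m' → PRw (.add m n) (.add m' n)
  | addR (m : PTm) {n n'} : PRw n n' → PRw (.add m n) (.add m n')
  | smul (a : ℂ) {m m'} : PRw m m' → PRw (.smul a m) (.smul a m')
  | elimOneL {m m'} (n : PTm) : PRw m m' → PRw (.elimOne m n) (.elimOne m' n)
  | elimOneR (m : PTm) {n n'} : PRw n n' → PRw (.elimOne m n) (.elimOne m n')
  | lam {m m'} : PRw m m' → PRw (.lam m) (.lam m')
  | appL {m m'} (n : PTm) : PRw m m' → PRw (.app m n) (.app m' n)
  | appR (m : PTm) {n n'} : PRw n n' → PRw (.app m n) (.app m n')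
  | pairL {m m'} (n : PTm) : PRw m m' → PRw (.pair m n) (.pair m' n)
  | pairR (m : PTm) {n n'} : PRw n n' → PRw (.pair m n) (.pair m n')
  | elimWith1L {m m'} (n : PTm) : PRw m m' → PRw (.elimWith1 m n) (.elimWith1 m' n)
  | elimWith1R (m : PTm) {n n'} : PRw n n' → PRw (.elimWith1 m n) (.elimWith1 m n')
  | elimWith2L {m m'} (n : PTm) : PRw m m' → PRw (.elimWith2 m n) (.elimWith2 m' n)
  | elimWith2R (m : PTm) {n n'} : PRw n n' → PRw (.elimWith2 m n) (.elimWith2 m n')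
  | tensL {m m'} (n : PTm) : PRw m m' → PRw (.tens m n) (.tens m' n)
  | tensR (m : PTm) {n n'} : PRw n n' → PRw (.tens m n) (.tens m n')
  | elimTensL {m m'} (n : PTm) : PRw m m' → PRw (.elimTens m n) (.elimTens m' n)
  | elimTensR (m : PTm) {n n'} : PRw n n' → PRw (.elimTens m n) (.elimTens m n')

/-- One left-to-right application of an algebraic rule, anywhere in a mixed term. -/
inductive MRw : MTm → MTm → Prop
  | oneSmul (m : MTm) : MRw (.smul 1 m) m
  | comm (m n : MTm) : MRw (.add m n) (.add n m)
  | assoc (m n o : MTm) : MRw (.add m (.add n o)) (.add (.add m n) o)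
  | addSmul (p q : ℝ≥0) (m : MTm) : MRw (.add (.smul p m) (.smul q m)) (.smul (p + q) m)
  | smulSmul (p q : ℝ≥0) (m : MTm) : MRw (.smul p (.smul q m)) (.smul (p * q) m)
  | smulAdd (p : ℝ≥0) (m n : MTm) : MRw (.smul p (.add m n)) (.add (.smul p m) (.smul p n))
  | addZero (m n : MTm) (h : ∀ m', m ≠ .smul 0 m') : MRw (.add m (.smul 0 n)) m
  | tensSmul (p : ℝ≥0) (m n : MTm) : MRw (.tens m (.smul p n)) (.smul p (.tens m n))
  | smulTens (p : ℝ≥0) (m n : MTm) : MRw (.tens (.smul p m) n) (.smul p (.tens m n))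
  | addTens (m m' n : MTm) : MRw (.tens (.add m m') n) (.add (.tens m n) (.tens m' n))
  | tensAdd (m n n' : MTm) : MRw (.tens m (.add n n')) (.add (.tens m n) (.tens m n'))
  | addL {m m'} (n : MTm) : MRw m m' → MRw (.add m n) (.add m' n)
  | addR (m : MTm) {n n'} : MRw n n' → MRw (.add m n) (.add m n')
  | smul (p : ℝ≥0) {m m'} : MRw m m' → MRw (.smul p m) (.smul p m')
  | elimZero {m m'} : MRw m m' → MRw (.elimZero m) (.elimZero m')
  | elimOneL {m m'} (n : MTm) : MRw m m' → MRw (.elimOne m n) (.elimOne m' n)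
  | elimOneR (m : MTm) {n n'} : MRw n n' → MRw (.elimOne m n) (.elimOne m n')
  | lam {m m'} : MRw m m' → MRw (.lam m) (.lam m')
  | appL {m m'} (n : MTm) : MRw m m' → MRw (.app m n) (.app m' n)
  | appR (m : MTm) {n n'} : MRw n n' → MRw (.app m n) (.app m n')
  | inl {m m'} : MRw m m' → MRw (.inl m) (.inl m')
  | inr {m m'} : MRw m m' → MRw (.inr m) (.inr m')
  | elimPlus1 {m m'} (n o : MTm) : MRw m m' → MRw (.elimPlus m n o) (.elimPlus m' n o)
  | elimPlus2 (m : MTm) {n n'} (o : MTm) : MRw n n' → MRw (.elimPlus m n o) (.elimPlus m n' o)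
  | elimPlus3 (m n : MTm) {o o'} : MRw o o' → MRw (.elimPlus m n o) (.elimPlus m n o')
  | tensL {m m'} (n : MTm) : MRw m m' → MRw (.tens m n) (.tens m' n)
  | tensR (m : MTm) {n n'} : MRw n n' → MRw (.tens m n) (.tens m n')
  | elimTensL {m m'} (n : MTm) : MRw m m' → MRw (.elimTens m n) (.elimTens m' n)
  | elimTensR (m : MTm) {n n'} : MRw n n' → MRw (.elimTens m n) (.elimTens m n')
  | B {m m'} : PRw m m' → MRw (.B m) (.B m')
  | tau {m m'} : MRw m m' → MRw (.tau m) (.tau m')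

/-- The equivalence `⇄` on pure proof terms: the equivalence relation generated by the algebraic
rules, between terms that prove the same judgement `Γ ⊢ · : P`. -/
def PConv (Γ : PCtx) (P : PTy) : PTm → PTm → Prop :=
  Relation.EqvGen fun m n => PRw m n ∧ Nonempty (PDer Γ m P) ∧ Nonempty (PDer Γ n P)

/-- The equivalence `⇄` on mixed proof terms of `Γ ⊢ · : A`. -/
def MConv (Γ : MCtx) (A : MTy) : MTm → MTm → Prop :=
  Relation.EqvGen fun m n => MRw m n ∧ Nonempty (MDer Γ m A) ∧ Nonempty (MDer Γ n A)

/-- The reduction relation `↪` on pure proof terms of `Γ ⊢ · : P`. -/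
inductive PHook (Γ : PCtx) (P : PTy) : PTm → PTm → Prop
  | step {m n} : PStep m n → PHook Γ P m n
  | val {m v} : PConv Γ P m v → PV v → PHook Γ P m v
  | alg {m a n} : (¬ ∃ m', PStep m m') → PConv Γ P m a → PAlg a → PStep a n → PHook Γ P m n

/-- The reduction relation `↪` on mixed proof terms of `Γ ⊢ · : A`. -/
inductive MHook (Γ : MCtx) (A : MTy) : MTm → MTm → Prop
  | step {m n} : MStep m n → MHook Γ A m n
  | val {m v} : MConv Γ A m v → MV v → MHook Γ A m v
  | alg {m a n} : (¬ ∃ m', MStep m m') → MConv Γ A m a → MAlg a → MStep a n → MHook Γ A m n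

/-! ## Finite-dimensional Hilbert spaces -/

/-- Objects of `FHilb`; the morphisms are the linear maps. -/
structure FHilb : Type 1 where
  carrier : Type
  [normed : NormedAddCommGroup carrier]
  [inner : InnerProductSpace ℂ carrier]
  [finite : FiniteDimensional ℂ carrier]

namespace FHilb

instance : CoeSort FHilb Type := ⟨carrier⟩
attribute [instance] normed inner finite

/-- The tensor unit. -/
abbrev unit : FHilb := ⟨ℂ⟩

/-- The zero-dimensional space. -/
abbrev zero : FHilb := ⟨PUnit⟩

/-- The Hilbert space tensor product. -/
abbrev tensor (X Y : FHilb) : FHilb := ⟨X ⊗[ℂ] Y⟩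

/-- The Hilbert space direct sum. -/
abbrev sum (X Y : FHilb) : FHilb := ⟨WithLp 2 (X × Y)⟩

/-- The vector that represents a functional by the Riesz representation theorem. -/
def riesz {X : FHilb} (φ : Module.Dual ℂ X) : X :=
  (InnerProductSpace.toDual ℂ X).symm (LinearMap.toContinuousLinearMap φ)

theorem inner_riesz {X : FHilb} (φ : Module.Dual ℂ X) (x : X) :
    Inner.inner ℂ (riesz φ) x = φ x := by
  simp [riesz]

theorem riesz_add {X : FHilb} (φ ψ : Module.Dual ℂ X) : riesz (φ + ψ) = riesz φ + riesz ψ := by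
  simp [riesz]

theorem riesz_smul {X : FHilb} (r : ℂ) (φ : Module.Dual ℂ X) :
    riesz (r • φ) = (starRingEnd ℂ) r • riesz φ := by
  rw [riesz, map_smul, LinearIsometryEquiv.map_smulₛₗ]
  rfl

/-- The inner product on the dual space: `⟨φ, ψ⟩` is the inner product of the representing vectors,
in the reverse order. -/
@[reducible] def dualCore (X : FHilb) : InnerProductSpace.Core ℂ (Module.Dual ℂ X) where
  inner φ ψ := Inner.inner ℂ (riesz ψ) (riesz φ)
  conj_inner_symm φ ψ := inner_conj_symm _ _
  re_inner_nonneg φ := inner_self_nonneg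
  add_left φ ψ χ := by simp [riesz_add]
  smul_left φ ψ r := by simp [riesz_smul]
  definite φ h := by
    have h0 : riesz φ = 0 := inner_self_eq_zero.1 h
    ext x
    rw [← inner_riesz φ x, h0]
    simp

/-- The dual Hilbert space `X*`. -/
abbrev dual (X : FHilb) : FHilb :=
  letI : NormedAddCommGroup (Module.Dual ℂ X) := (dualCore X).toNormedAddCommGroup
  letI : InnerProductSpace ℂ (Module.Dual ℂ X) := .ofCore (dualCore X).toCore
  ⟨Module.Dual ℂ X⟩

/-- The internal hom `[X, Y] = X* ⊗ Y`. -/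
abbrev ihom (X Y : FHilb) : FHilb := tensor (dual X) Y

/-- The canonical identification of `X* ⊗ Y` with the space of linear maps. -/
def ihomEquiv (X Y : FHilb) : ihom X Y ≃ₗ[ℂ] (X →ₗ[ℂ] Y) := dualTensorHomEquiv ℂ X Y

/-- The currying isomorphism `Φ`. -/
def curry {Z X Y : FHilb} (f : tensor Z X →ₗ[ℂ] Y) : Z →ₗ[ℂ] ihom X Y :=
  (ihomEquiv X Y).symm.toLinearMap ∘ₗ TensorProduct.curry f

/-- The evaluation `[X, Y] ⊗ X → Y`. -/
def eval (X Y : FHilb) : tensor (ihom X Y) X →ₗ[ℂ] Y :=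
  TensorProduct.lift (ihomEquiv X Y).toLinearMap

/-- The underlying vector space of the direct sum. -/
def sumEquiv (X Y : FHilb) : sum X Y ≃ₗ[ℂ] X × Y := WithLp.linearEquiv 2 ℂ (X × Y)

def fst (X Y : FHilb) : sum X Y →ₗ[ℂ] X := LinearMap.fst ℂ X Y ∘ₗ (sumEquiv X Y).toLinearMap
def snd (X Y : FHilb) : sum X Y →ₗ[ℂ] Y := LinearMap.snd ℂ X Y ∘ₗ (sumEquiv X Y).toLinearMap
def pair {Z X Y : FHilb} (f : Z →ₗ[ℂ] X) (g : Z →ₗ[ℂ] Y) : Z →ₗ[ℂ] sum X Y :=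
  (sumEquiv X Y).symm.toLinearMap ∘ₗ f.prod g

end FHilb

/-! ## Finite-dimensional C*-algebras -/

/-- `N` is a C*-norm on the complex *-algebra `A`. -/
structure IsCStarNorm {A : Type} [Ring A] [Algebra ℂ A] [StarRing A] (N : A → ℝ) : Prop where
  add_le : ∀ a b, N (a + b) ≤ N a + N b
  smul : ∀ (c : ℂ) a, N (c • a) = ‖c‖ * N a
  eq_zero : ∀ a, N a = 0 → a = 0
  mul_le : ∀ a b, N (a * b) ≤ N a * N b
  star_mul : ∀ a, N (star a * a) = N a ^ 2

/-- A positive faithful trace. -/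
structure IsFaithfulTrace {A : Type} [Ring A] [Algebra ℂ A] [StarRing A] (t : A →ₗ[ℂ] ℂ) :
    Prop where
  comm : ∀ a b, t (a * b) = t (b * a)
  map_star : ∀ a, t (star a) = (starRingEnd ℂ) (t a)
  pos : ∀ a, a ≠ 0 → 0 < (t (star a * a)).re

/-- Objects of `FC*`: finite-dimensional C*-algebras.  Every finite-dimensional C*-algebra has a
positive faithful trace; a choice of one is recorded, since it fixes the unit and the counit of the
compact closed structure.  It plays no role in the morphisms, which are the completely positive
maps. -/
structure FCstar : Type 1 where
  carrier : Type
  [ring : Ring carrier]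
  [algebra : Algebra ℂ carrier]
  [starRing : StarRing carrier]
  [starModule : StarModule ℂ carrier]
  [finite : FiniteDimensional ℂ carrier]
  exists_norm : ∃ N : carrier → ℝ, IsCStarNorm N
  tr : carrier →ₗ[ℂ] ℂ
  faithful : IsFaithfulTrace tr

theorem IsFaithfulTrace.unop {A : Type} [Ring A] [Algebra ℂ A] [StarRing A] {t : A →ₗ[ℂ] ℂ}
    (ht : IsFaithfulTrace t) :
    IsFaithfulTrace (t ∘ₗ (MulOpposite.opLinearEquiv ℂ).symm.toLinearMap : Aᵐᵒᵖ →ₗ[ℂ] ℂ) where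
  comm a b := by simpa using ht.comm _ _
  map_star a := by simpa using ht.map_star _
  pos a h := by
    have := ht.pos a.unop (by simpa using h)
    simpa [ht.comm] using this

section
variable {A : Type} [Ring A] [Algebra ℂ A] [StarRing A] [StarModule ℂ A]

/-- The inner product `⟨a, b⟩ = t (a* b)` of a positive faithful trace. -/
@[reducible] def IsFaithfulTrace.core {t : A →ₗ[ℂ] ℂ} (ht : IsFaithfulTrace t) : InnerProductSpace.Core ℂ A where
  inner a b := t (star a * b)
  conj_inner_symm a b := by rw [← ht.map_star]; simp
  re_inner_nonneg a := by
    by_cases h : a = 0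
    · simp [h]
    · exact (ht.pos a h).le
  add_left a b c := by simp [add_mul]
  smul_left a b r := by simp [star_smul]
  definite a h := by
    by_contra h0
    have := ht.pos a h0
    rw [h] at this
    simp at this

/-- The operator norm of left multiplication is a C*-norm. -/
theorem IsFaithfulTrace.exists_norm [FiniteDimensional ℂ A] {t : A →ₗ[ℂ] ℂ}
    (ht : IsFaithfulTrace t) : ∃ N : A → ℝ, IsCStarNorm N := by
  let : NormedAddCommGroup A := ht.core.toNormedAddCommGroup
  let : InnerProductSpace ℂ A := .ofCore ht.core.toCore
  have hin : ∀ a b : A, Inner.inner ℂ a b = t (star a * b) := fun _ _ => rfl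
  let L : A → A →L[ℂ] A := fun a => LinearMap.toContinuousLinearMap (LinearMap.mulLeft ℂ a)
  have hL : ∀ a b, L a b = a * b := fun _ _ => rfl
  have hadj : ∀ a, L (star a) = star (L a) := fun a => by
    rw [ContinuousLinearMap.star_eq_adjoint, ContinuousLinearMap.eq_adjoint_iff]
    intro x y
    rw [hin, hin, hL, hL]
    simp [mul_assoc]
  have hmul : ∀ a b, L (a * b) = L a * L b := fun a b => by
    ext x; simp [hL, mul_assoc]
  refine ⟨fun a => ‖L a‖, ?_, ?_, ?_, ?_, ?_⟩
  · intro a b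
    have : L (a + b) = L a + L b := by ext x; simp [hL, add_mul]
    rw [this]; exact norm_add_le _ _
  · intro c a
    have : L (c • a) = c • L a := by ext x; simp [hL]
    rw [this]; exact norm_smul _ _
  · intro a h
    have h1 : L a 1 = 0 := by rw [norm_eq_zero.1 h]; rfl
    simpa [hL] using h1
  · intro a b
    rw [hmul]; exact norm_mul_le _ _
  · intro a
    rw [hmul, hadj, sq]
    exact ContinuousLinearMap.norm_adjoint_comp_self (L a)

variable {B : Type} [Ring B] [Algebra ℂ B] [StarRing B] [StarModule ℂ B]

theorem IsFaithfulTrace.prod {t : A →ₗ[ℂ] ℂ} {u : B →ₗ[ℂ] ℂ} (ht : IsFaithfulTrace t)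
    (hu : IsFaithfulTrace u) : IsFaithfulTrace (t.coprod u) where
  comm a b := by simp [ht.comm a.1, hu.comm a.2]
  map_star a := by simp [ht.map_star, hu.map_star]
  pos a h := by
    have h1 := ht.core.re_inner_nonneg a.1
    have h2 := hu.core.re_inner_nonneg a.2
    change 0 ≤ (t (star a.1 * a.1)).re at h1
    change 0 ≤ (u (star a.2 * a.2)).re at h2
    simp only [LinearMap.coprod_apply, Prod.fst_mul, Prod.snd_mul, Prod.fst_star, Prod.snd_star,
      Complex.add_re]
    by_cases ha : a.1 = 0
    · have hb : a.2 ≠ 0 := fun hb => h (Prod.ext ha hb)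
      linarith [hu.pos _ hb]
    · linarith [ht.pos _ ha]

/-- The product trace on `A ⊗ B`. -/
def traceTensor (t : A →ₗ[ℂ] ℂ) (u : B →ₗ[ℂ] ℂ) : A ⊗[ℂ] B →ₗ[ℂ] ℂ :=
  LinearMap.mul' ℂ ℂ ∘ₗ TensorProduct.map t u

theorem IsFaithfulTrace.tensor {t : A →ₗ[ℂ] ℂ} {u : B →ₗ[ℂ] ℂ} (ht : IsFaithfulTrace t)
    (hu : IsFaithfulTrace u) : IsFaithfulTrace (traceTensor t u) where
  comm a b := by
    induction a with
    | zero => simp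
    | add a a' h h' => simp [add_mul, mul_add, h, h']
    | tmul a a' =>
      induction b with
      | zero => simp
      | add b b' h h' => simp [add_mul, mul_add, h, h']
      | tmul b b' => simp [traceTensor, ht.comm a, hu.comm a']
  map_star a := by
    induction a with
    | zero => simp
    | add a a' h h' => simp [h, h']
    | tmul a a' => simp [traceTensor, ht.map_star, hu.map_star, TensorProduct.star_tmul]
  pos a h := by
    let : NormedAddCommGroup A := ht.core.toNormedAddCommGroup
    let : InnerProductSpace ℂ A := .ofCore ht.core.toCore
    let : NormedAddCommGroup B := hu.core.toNormedAddCommGroup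
    let : InnerProductSpace ℂ B := .ofCore hu.core.toCore
    have key : ∀ x y : A ⊗[ℂ] B, (Inner.inner ℂ x y : ℂ) = traceTensor t u (star x * y) := by
      intro x y
      induction x with
      | zero => simp
      | add x x' h h' => rw [inner_add_left, h, h', star_add, add_mul, map_add]
      | tmul x x' =>
        induction y with
        | zero => simp
        | add y y' h h' => rw [inner_add_right, h, h', mul_add, map_add]
        | tmul y y' =>
          rw [TensorProduct.inner_tmul]
          simp only [traceTensor, TensorProduct.star_tmul, Algebra.TensorProduct.tmul_mul_tmul,
            LinearMap.comp_apply, TensorProduct.map_tmul, LinearMap.mul'_apply]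
          rfl
    rw [← key]
    have h0 : (0 : ℝ) < ‖a‖ ^ 2 := by have := norm_pos_iff.2 h; positivity
    rwa [← inner_self_eq_norm_sq (𝕜 := ℂ)] at h0
end

theorem isFaithfulTrace_end (X : FHilb) :
    IsFaithfulTrace (LinearMap.trace ℂ X : Module.End ℂ X →ₗ[ℂ] ℂ) where
  comm a b := LinearMap.trace_mul_comm ℂ a b
  map_star a := by
    let b := stdOrthonormalBasis ℂ X
    rw [LinearMap.trace_eq_sum_inner _ b, LinearMap.trace_eq_sum_inner _ b, map_sum]
    refine Finset.sum_congr rfl fun i _ => ?_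
    rw [LinearMap.star_eq_adjoint, LinearMap.adjoint_inner_right, inner_conj_symm]
  pos a h := by
    let b := stdOrthonormalBasis ℂ X
    have e : LinearMap.trace ℂ X (star a * a) = ((∑ i, ‖a (b i)‖ ^ 2 : ℝ) : ℂ) := by
      rw [LinearMap.trace_eq_sum_inner _ b, Complex.ofReal_sum]
      refine Finset.sum_congr rfl fun i _ => ?_
      rw [LinearMap.star_eq_adjoint, Module.End.mul_apply, LinearMap.adjoint_inner_right,
        inner_self_eq_norm_sq_to_K]
      simp
    rw [e, Complex.ofReal_re]
    refine lt_of_le_of_ne (Finset.sum_nonneg fun i _ => by positivity) fun h0 => h ?_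
    have hz := (Finset.sum_eq_zero_iff_of_nonneg fun i _ => by positivity).1 h0.symm
    refine b.toBasis.ext fun i => ?_
    simpa using hz i (Finset.mem_univ i)

namespace FCstar

instance : CoeSort FCstar Type := ⟨carrier⟩
attribute [instance] ring algebra starRing starModule finite

/-- A finite-dimensional *-algebra with a positive faithful trace, as a C*-algebra. -/
abbrev ofTrace (A : Type) [Ring A] [Algebra ℂ A] [StarRing A] [StarModule ℂ A]
    [FiniteDimensional ℂ A] (t : A →ₗ[ℂ] ℂ) (ht : IsFaithfulTrace t) : FCstar :=
  ⟨A, ht.exists_norm, t, ht⟩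

/-- The tensor unit `ℂ`. -/
abbrev unit : FCstar :=
  ofTrace ℂ LinearMap.id
    { comm := mul_comm
      map_star := fun _ => rfl
      pos := fun a h => by
        have : 0 < Complex.normSq a := Complex.normSq_pos.2 h
        simpa [Complex.normSq_apply] using this }

/-- The zero algebra. -/
abbrev zero : FCstar :=
  ofTrace (Matrix (Fin 0) (Fin 0) ℂ) 0
    ⟨fun _ _ => rfl, fun _ => by simp, fun _ h => absurd (Subsingleton.elim _ _) h⟩

/-- The C*-algebra tensor product. -/
abbrev tensor (X Y : FCstar) : FCstar :=
  ofTrace (X ⊗[ℂ] Y) (traceTensor X.tr Y.tr) (X.faithful.tensor Y.faithful)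

/-- The direct sum, with pointwise operations. -/
abbrev sum (X Y : FCstar) : FCstar :=
  ofTrace (X × Y) (X.tr.coprod Y.tr) (X.faithful.prod Y.faithful)

/-- The dual `X*` in the sense of compact closure: the opposite algebra, in duality with `X` by the
counit `op a ⊗ b ↦ tr (a b)`. -/
abbrev dual (X : FCstar) : FCstar :=
  haveI : FiniteDimensional ℂ (X.carrier)ᵐᵒᵖ :=
    Module.Finite.equiv (MulOpposite.opLinearEquiv ℂ (M := X.carrier))
  ofTrace (X.carrier)ᵐᵒᵖ _ X.faithful.unop

/-- The C*-algebra `B(H)` of linear operators on a Hilbert space. -/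
abbrev ofHilb (H : FHilb) : FCstar :=
  ofTrace (Module.End ℂ H) (LinearMap.trace ℂ H) (isFaithfulTrace_end H)

/-- The functional `b ↦ tr (a b)`. -/
def trForm (X : FCstar) : X →ₗ[ℂ] Module.Dual ℂ X := (LinearMap.mul ℂ X).compr₂ X.tr

theorem trForm_injective (X : FCstar) : Function.Injective X.trForm := by
  rw [← LinearMap.ker_eq_bot, LinearMap.ker_eq_bot']
  intro a h
  by_contra h0
  have h1 : X.trForm a (star a) = 0 := by rw [h]; rfl
  have h2 : X.tr (star a * a) = 0 := by rw [X.faithful.comm]; exact h1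
  have := X.faithful.pos a h0
  rw [h2] at this
  simp at this

/-- The identification of `X*` with the space of functionals on `X` that the counit induces. -/
def dualEquiv (X : FCstar) : dual X ≃ₗ[ℂ] Module.Dual ℂ X :=
  (MulOpposite.opLinearEquiv ℂ (M := X.carrier)).symm ≪≫ₗ
    LinearEquiv.ofInjectiveOfFinrankEq X.trForm X.trForm_injective Subspace.dual_finrank_eq.symm

/-- The internal hom `[X, Y] = X* ⊗ Y`. -/
abbrev ihom (X Y : FCstar) : FCstar := tensor (dual X) Y

/-- The identification of `X* ⊗ Y` with the space of linear maps that the counit induces: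
`op a ⊗ y` is the map `x ↦ tr (a x) y`. -/
def ihomEquiv (X Y : FCstar) : ihom X Y ≃ₗ[ℂ] (X →ₗ[ℂ] Y) :=
  TensorProduct.congr (dualEquiv X) (LinearEquiv.refl ℂ Y) ≪≫ₗ dualTensorHomEquiv ℂ X Y

/-- The currying isomorphism `Φ`. -/
def curry {Z X Y : FCstar} (f : tensor Z X →ₗ[ℂ] Y) : Z →ₗ[ℂ] ihom X Y :=
  (ihomEquiv X Y).symm.toLinearMap ∘ₗ TensorProduct.curry f

/-- The evaluation `[X, Y] ⊗ X → Y`. -/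
def eval (X Y : FCstar) : tensor (ihom X Y) X →ₗ[ℂ] Y :=
  TensorProduct.lift (ihomEquiv X Y).toLinearMap

def inl (X Y : FCstar) : X →ₗ[ℂ] sum X Y := LinearMap.inl ℂ X Y
def inr (X Y : FCstar) : Y →ₗ[ℂ] sum X Y := LinearMap.inr ℂ X Y
/-- The copairing `[f, g]`. -/
def copair {X Y Z : FCstar} (f : X →ₗ[ℂ] Z) (g : Y →ₗ[ℂ] Z) : sum X Y →ₗ[ℂ] Z := f.coprod g
/-- The distributivity isomorphism. -/
def distr (X Y Z : FCstar) : tensor X (sum Y Z) ≃ₗ[ℂ] sum (tensor X Y) (tensor X Z) :=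
  TensorProduct.prodRight ℂ ℂ X Y Z

end FCstar

/-- An element of the form `b b*`. -/
def IsPos {A : Type} [Mul A] [Star A] (a : A) : Prop := ∃ b : A, a = b * star b

/-- Complete positivity: `id ⊗ f : M_n ⊗ X → M_n ⊗ Y` preserves positive elements for every `n`. -/
def IsCP {X Y : FCstar} (f : X →ₗ[ℂ] Y) : Prop :=
  ∀ (n : ℕ) (z : Matrix (Fin n) (Fin n) ℂ ⊗[ℂ] X),
    IsPos z → IsPos (LinearMap.lTensor (Matrix (Fin n) (Fin n) ℂ) f z)

/-! ## The functor `B` -/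

/-- The linear map `a ↦ f a f†`. -/
def sandwich {H K : FHilb} (f : H →ₗ[ℂ] K) : (H →ₗ[ℂ] H) →ₗ[ℂ] (K →ₗ[ℂ] K) where
  toFun a := f ∘ₗ a ∘ₗ LinearMap.adjoint f
  map_add' a b := by rw [LinearMap.add_comp, LinearMap.comp_add]
  map_smul' c a := by rw [RingHom.id_apply, LinearMap.smul_comp, LinearMap.comp_smul]

/-- The action `B(f) = f (·) f†` on morphisms. -/
def BMap {H K : FHilb} (f : H →ₗ[ℂ] K) : FCstar.ofHilb H →ₗ[ℂ] FCstar.ofHilb K := sandwich f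

/-- The isomorphism `τ : B(H) ⊗ B(K) ≅ B(H ⊗ K)`. -/
def tauIso (H K : FHilb) : FCstar.tensor (.ofHilb H) (.ofHilb K) ≃ₗ[ℂ] FCstar.ofHilb (.tensor H K) :=
  homTensorHomEquiv ℂ H K H K

/-- The isomorphism `τ : ℂ ≅ B(ℂ)`. -/
def tauUnit : FCstar.unit ≃ₗ[ℂ] FCstar.ofHilb .unit :=
  (LinearMap.ringLmapEquivSelf ℂ ℂ ℂ).symm

/-! ## Interpretation of the pure fragment in `FHilb` -/

/-- The Hilbert space that interprets a pure proposition. -/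
def PTy.den : PTy → FHilb
  | top => .zero
  | one => .unit
  | lolli P Q => .ihom P.den Q.den
  | amp P Q => .sum P.den Q.den
  | tens P Q => .tensor P.den Q.den

/-- The space that interprets a pure context: the tensor product of its members. -/
def PDer.ctx : PCtx → FHilb
  | [] => .unit
  | (_, S) :: Γ => .tensor S.den (PDer.ctx Γ)

/-- The coherence isomorphism for the concatenation of contexts. -/
def PDer.split : (Γ Δ : PCtx) → PDer.ctx (Γ ++ Δ) ≃ₗ[ℂ] FHilb.tensor (PDer.ctx Γ) (PDer.ctx Δ)
  | [], Δ => (TensorProduct.lid ℂ (PDer.ctx Δ)).symm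
  | (_, S) :: Γ, Δ =>
      TensorProduct.congr (LinearEquiv.refl ℂ S.den) (PDer.split Γ Δ) ≪≫ₗ
        (TensorProduct.assoc ℂ S.den (PDer.ctx Γ) (PDer.ctx Δ)).symm

/-- The coherence isomorphism for `Γ, x : S`. -/
def PDer.snoc (Γ : PCtx) (x : ℕ) (S : PTy) :
    FHilb.tensor (PDer.ctx Γ) S.den ≃ₗ[ℂ] PDer.ctx (Γ ++ [(x, S)]) :=
  TensorProduct.congr (LinearEquiv.refl ℂ (PDer.ctx Γ)) (TensorProduct.rid ℂ S.den).symm ≪≫ₗ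
    (PDer.split Γ [(x, S)]).symm

/-- The coherence isomorphism for `Γ, x : S, y : T`. -/
def PDer.snoc2 (Γ : PCtx) (x y : ℕ) (S T : PTy) :
    FHilb.tensor (PDer.ctx Γ) (.tensor S.den T.den) ≃ₗ[ℂ] PDer.ctx (Γ ++ [(x, S), (y, T)]) :=
  TensorProduct.congr (LinearEquiv.refl ℂ (PDer.ctx Γ))
      (TensorProduct.congr (LinearEquiv.refl ℂ S.den) (TensorProduct.rid ℂ T.den).symm) ≪≫ₗ
    (PDer.split Γ [(x, S), (y, T)]).symm

/-- The exchange isomorphism `id ⊗ σ ⊗ id`. -/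
def PDer.swap (x y : ℕ) (S T : PTy) (Γ : PCtx) : (Δ : PCtx) →
    PDer.ctx (Δ ++ (x, S) :: (y, T) :: Γ) ≃ₗ[ℂ] PDer.ctx (Δ ++ (y, T) :: (x, S) :: Γ)
  | [] => TensorProduct.leftComm ℂ S.den T.den (PDer.ctx Γ)
  | (_, R) :: Δ => TensorProduct.congr (LinearEquiv.refl ℂ R.den) (PDer.swap x y S T Γ Δ)

/-- The symmetry. -/
def FHilb.symm (X Y : FHilb) : FHilb.tensor X Y ≃ₗ[ℂ] FHilb.tensor Y X := TensorProduct.comm ℂ X Y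

/-- The tensor product of morphisms. -/
def FHilb.map {X Y Z W : FHilb} (f : X →ₗ[ℂ] Y) (g : Z →ₗ[ℂ] W) :
    FHilb.tensor X Z →ₗ[ℂ] FHilb.tensor Y W := TensorProduct.map f g

/-- The interpretation of a pure judgement, by recursion on its derivation. -/
def PDer.den {Γ : PCtx} {m : PTm} {P : PTy} : PDer Γ m P → (PDer.ctx Γ →ₗ[ℂ] P.den)
  | .ax _ P => (TensorProduct.rid ℂ P.den).toLinearMap
  | .sum D E => D.den + E.den
  | .prod a D => a • D.den
  | .topI _ _ => 0
  | .oneI => LinearMap.id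
  | .oneE (Γ := Γ) (Δ := Δ) (P := P) _ D E =>
      (TensorProduct.lid ℂ P.den).toLinearMap ∘ₗ FHilb.map D.den E.den ∘ₗ
        (PDer.split Γ Δ).toLinearMap
  | .lolliI (Γ := Γ) (P := P) x _ D => FHilb.curry (D.den ∘ₗ (PDer.snoc Γ x P).toLinearMap)
  | .lolliE (Γ := Γ) (Δ := Δ) (P := P) (Q := Q) _ D E =>
      FHilb.eval P.den Q.den ∘ₗ FHilb.map D.den E.den ∘ₗ (PDer.split Γ Δ).toLinearMap
  | .withI D E => FHilb.pair D.den E.den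
  | .withE1 (Γ := Γ) (Δ := Δ) (P := P) (Q := Q) x _ _ D E =>
      E.den ∘ₗ (PDer.snoc Δ x P).toLinearMap ∘ₗ (FHilb.symm P.den (PDer.ctx Δ)).toLinearMap ∘ₗ
        FHilb.map (FHilb.fst P.den Q.den ∘ₗ D.den) LinearMap.id ∘ₗ (PDer.split Γ Δ).toLinearMap
  | .withE2 (Γ := Γ) (Δ := Δ) (P := P) (Q := Q) x _ _ D E =>
      E.den ∘ₗ (PDer.snoc Δ x Q).toLinearMap ∘ₗ (FHilb.symm Q.den (PDer.ctx Δ)).toLinearMap ∘ₗ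
        FHilb.map (FHilb.snd P.den Q.den ∘ₗ D.den) LinearMap.id ∘ₗ (PDer.split Γ Δ).toLinearMap
  | .tensI (Δ := Δ) (Γ := Γ) _ D E => FHilb.map D.den E.den ∘ₗ (PDer.split Δ Γ).toLinearMap
  | .tensE (Δ := Δ) (Γ := Γ) (P := P) (Q := Q) x y _ _ _ D E =>
      E.den ∘ₗ (PDer.snoc2 Γ x y P Q).toLinearMap ∘ₗ
        (FHilb.symm (.tensor P.den Q.den) (PDer.ctx Γ)).toLinearMap ∘ₗ
        FHilb.map D.den LinearMap.id ∘ₗ (PDer.split Δ Γ).toLinearMap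
  | .ex (Δ := Δ) (Γ := Γ) (P := P) (Q := Q) (x := x) (y := y) D =>
      D.den ∘ₗ (PDer.swap x y Q P Γ Δ).toLinearMap

/-! ## Interpretation of the mixed fragment in `FC*` -/

/-- The C*-algebra that interprets a mixed proposition. -/
def MTy.den : MTy → FCstar
  | .zero => .zero
  | .one => .unit
  | .lolli A C => .ihom A.den C.den
  | .oplus A C => .sum A.den C.den
  | .tens A C => .tensor A.den C.den
  | .B P => .ofHilb P.den

/-- The C*-algebra that interprets a mixed context: the tensor product of its members. -/
def MDer.ctx : MCtx → FCstar
  | [] => .unit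
  | (_, S) :: Γ => .tensor S.den (MDer.ctx Γ)

/-- The coherence isomorphism for the concatenation of contexts. -/
def MDer.split : (Γ Δ : MCtx) → MDer.ctx (Γ ++ Δ) ≃ₗ[ℂ] FCstar.tensor (MDer.ctx Γ) (MDer.ctx Δ)
  | [], Δ => (TensorProduct.lid ℂ (MDer.ctx Δ)).symm
  | (_, S) :: Γ, Δ =>
      TensorProduct.congr (LinearEquiv.refl ℂ S.den) (MDer.split Γ Δ) ≪≫ₗ
        (TensorProduct.assoc ℂ S.den (MDer.ctx Γ) (MDer.ctx Δ)).symm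

/-- The coherence isomorphism for `Γ, x : S`. -/
def MDer.snoc (Γ : MCtx) (x : ℕ) (S : MTy) :
    FCstar.tensor (MDer.ctx Γ) S.den ≃ₗ[ℂ] MDer.ctx (Γ ++ [(x, S)]) :=
  TensorProduct.congr (LinearEquiv.refl ℂ (MDer.ctx Γ)) (TensorProduct.rid ℂ S.den).symm ≪≫ₗ
    (MDer.split Γ [(x, S)]).symm

/-- The coherence isomorphism for `Γ, x : S, y : T`. -/
def MDer.snoc2 (Γ : MCtx) (x y : ℕ) (S T : MTy) :
    FCstar.tensor (MDer.ctx Γ) (.tensor S.den T.den) ≃ₗ[ℂ] MDer.ctx (Γ ++ [(x, S), (y, T)]) :=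
  TensorProduct.congr (LinearEquiv.refl ℂ (MDer.ctx Γ))
      (TensorProduct.congr (LinearEquiv.refl ℂ S.den) (TensorProduct.rid ℂ T.den).symm) ≪≫ₗ
    (MDer.split Γ [(x, S), (y, T)]).symm

/-- The exchange isomorphism `id ⊗ σ ⊗ id`. -/
def MDer.swap (x y : ℕ) (S T : MTy) (Γ : MCtx) : (Δ : MCtx) →
    MDer.ctx (Δ ++ (x, S) :: (y, T) :: Γ) ≃ₗ[ℂ] MDer.ctx (Δ ++ (y, T) :: (x, S) :: Γ)
  | [] => TensorProduct.leftComm ℂ S.den T.den (MDer.ctx Γ)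
  | (_, R) :: Δ => TensorProduct.congr (LinearEquiv.refl ℂ R.den) (MDer.swap x y S T Γ Δ)

/-- The symmetry. -/
def FCstar.symm (X Y : FCstar) : FCstar.tensor X Y ≃ₗ[ℂ] FCstar.tensor Y X := TensorProduct.comm ℂ X Y

/-- The tensor product of morphisms. -/
def FCstar.map {X Y Z W : FCstar} (f : X →ₗ[ℂ] Y) (g : Z →ₗ[ℂ] W) :
    FCstar.tensor X Z →ₗ[ℂ] FCstar.tensor Y W := TensorProduct.map f g

/-- The interpretation of a mixed judgement, by recursion on its derivation. -/
def MDer.den {Γ : MCtx} {m : MTm} {A : MTy} : MDer Γ m A → (MDer.ctx Γ →ₗ[ℂ] A.den)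
  | .ax _ A => (TensorProduct.rid ℂ A.den).toLinearMap
  | .sum D E => D.den + E.den
  | .prod p D => ((p : ℝ) : ℂ) • D.den
  | .zeroE (Γ := Γ) Δ A _ _ D =>
      (0 : FCstar.tensor .zero (MDer.ctx Δ) →ₗ[ℂ] A.den) ∘ₗ FCstar.map D.den LinearMap.id ∘ₗ
        (MDer.split Γ Δ).toLinearMap
  | .oneI => LinearMap.id
  | .oneE (Γ := Γ) (Δ := Δ) (A := A) _ D E =>
      (TensorProduct.lid ℂ A.den).toLinearMap ∘ₗ FCstar.map D.den E.den ∘ₗ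
        (MDer.split Γ Δ).toLinearMap
  | .lolliI (Γ := Γ) (A := A) x _ D => FCstar.curry (D.den ∘ₗ (MDer.snoc Γ x A).toLinearMap)
  | .lolliE (Γ := Γ) (Δ := Δ) (A := A) (B := B) _ D E =>
      FCstar.eval A.den B.den ∘ₗ FCstar.map D.den E.den ∘ₗ (MDer.split Γ Δ).toLinearMap
  | .oplusI1 (A := A) B D => FCstar.inl A.den B.den ∘ₗ D.den
  | .oplusI2 (B := B) A D => FCstar.inr A.den B.den ∘ₗ D.den
  | .oplusE (Δ := Δ) (Γ := Γ) (A := A) (B := B) x y _ _ _ D E F =>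
      FCstar.copair (E.den ∘ₗ (MDer.snoc Γ x A).toLinearMap)
          (F.den ∘ₗ (MDer.snoc Γ y B).toLinearMap) ∘ₗ
        (FCstar.distr (MDer.ctx Γ) A.den B.den).toLinearMap ∘ₗ
        (FCstar.symm (.sum A.den B.den) (MDer.ctx Γ)).toLinearMap ∘ₗ
        FCstar.map D.den LinearMap.id ∘ₗ (MDer.split Δ Γ).toLinearMap
  | .tensI (Δ := Δ) (Γ := Γ) _ D E => FCstar.map D.den E.den ∘ₗ (MDer.split Δ Γ).toLinearMap
  | .tensE (Δ := Δ) (Γ := Γ) (A := A) (B := B) x y _ _ _ D E =>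
      E.den ∘ₗ (MDer.snoc2 Γ x y A B).toLinearMap ∘ₗ
        (FCstar.symm (.tensor A.den B.den) (MDer.ctx Γ)).toLinearMap ∘ₗ
        FCstar.map D.den LinearMap.id ∘ₗ (MDer.split Δ Γ).toLinearMap
  | .boxI D => BMap (H := .unit) D.den ∘ₗ tauUnit.toLinearMap
  | .boxE (Γ := Γ) (Δ := Δ) (P := P) (Q := Q) _ D E =>
      BMap (FHilb.eval P.den Q.den) ∘ₗ (tauIso (.ihom P.den Q.den) P.den).toLinearMap ∘ₗ
        FCstar.map D.den E.den ∘ₗ (MDer.split Γ Δ).toLinearMap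
  | .tau (P := P) (Q := Q) D => (tauIso P.den Q.den).toLinearMap ∘ₗ D.den
  | .ex (Δ := Δ) (Γ := Γ) (A := A) (B := B) (x := x) (y := y) D =>
      D.den ∘ₗ (MDer.swap x y B A Γ Δ).toLinearMap

/-- `H ↦ B(H)`, `f ↦ f (·) f†`, with the isomorphisms `tauIso` and `tauUnit`, is a strong monoidal
functor from `FHilb` to `FC*`. -/
structure BIsStrongMonoidal : Prop where
  cp : ∀ {H K : FHilb} (f : H →ₗ[ℂ] K), IsCP (BMap f)
  map_id : ∀ H : FHilb, BMap (LinearMap.id : H →ₗ[ℂ] H) = LinearMap.id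
  map_comp : ∀ {H K L : FHilb} (f : H →ₗ[ℂ] K) (g : K →ₗ[ℂ] L), BMap (g ∘ₗ f) = BMap g ∘ₗ BMap f
  tau_cp : ∀ H K : FHilb, IsCP (tauIso H K).toLinearMap
  tau_symm_cp : ∀ H K : FHilb, IsCP (tauIso H K).symm.toLinearMap
  unit_cp : IsCP tauUnit.toLinearMap
  unit_symm_cp : IsCP tauUnit.symm.toLinearMap
  natural : ∀ {H H' K K' : FHilb} (f : H →ₗ[ℂ] H') (g : K →ₗ[ℂ] K'),
    BMap (FHilb.map f g) ∘ₗ (tauIso H K).toLinearMap =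
      (tauIso H' K').toLinearMap ∘ₗ FCstar.map (BMap f) (BMap g)
  assoc : ∀ H K L : FHilb,
    BMap (H := .tensor (.tensor H K) L) (K := .tensor H (.tensor K L))
        (TensorProduct.assoc ℂ H K L).toLinearMap ∘ₗ (tauIso (.tensor H K) L).toLinearMap ∘ₗ
        FCstar.map (tauIso H K).toLinearMap LinearMap.id =
      (tauIso H (.tensor K L)).toLinearMap ∘ₗ FCstar.map LinearMap.id (tauIso K L).toLinearMap ∘ₗ
        (TensorProduct.assoc ℂ (FCstar.ofHilb H) (FCstar.ofHilb K) (FCstar.ofHilb L)).toLinearMap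
  left_unit : ∀ H : FHilb,
    BMap (H := .tensor .unit H) (K := H) (TensorProduct.lid ℂ H).toLinearMap ∘ₗ
        (tauIso .unit H).toLinearMap ∘ₗ FCstar.map tauUnit.toLinearMap LinearMap.id =
      (TensorProduct.lid ℂ (FCstar.ofHilb H)).toLinearMap
  right_unit : ∀ H : FHilb,
    BMap (H := .tensor H .unit) (K := H) (TensorProduct.rid ℂ H).toLinearMap ∘ₗ
        (tauIso H .unit).toLinearMap ∘ₗ FCstar.map LinearMap.id tauUnit.toLinearMap =
      (TensorProduct.rid ℂ (FCstar.ofHilb H)).toLinearMap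
end

/-!
Exchange and the choice of bound names make derivations far from unique, and a term does not
determine the propositions of its cuts, so `PDer.den` and `MDer.den` are inconvenient for induction
on terms. The proof replaces them by one relation. Pure and mixed terms are embedded in a common
syntax `Tm`, and `Sem s Γ m A f` says that `m` proves `A` in `Γ` with interpretation `f`, where `f`
is a function of environments, which give a vector to every variable. Exchange is built into the
rules of `Sem`, and bodies of binders are typed for cofinitely many names, so that a term determines
the last rule. A derivation yields a `Sem` by evaluating its denotation at pure tensors
(`PDer.sem`, `MDer.sem`); since pure tensors span, nothing is lost (`PDer.ext_pt`, `MDer.ext_pt`).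
Conversely, a `Sem` of an embedded term comes from a derivation (`Sem.pder`, `Sem.mder`). Both parts
of soundness thus reduce to this: if `M ↪ N`, each interpretation of `M` is one of `N`.

Two facts about `Sem` carry the argument.

* Substitution (`Sem.subst`): substituting a typed term for a variable updates the environment by
  the interpretation of that term. This takes care of the rules that substitute values.
* Coherence (`Sem.coherent`): the interpretation depends only on the judgement. It is proved by a
  logical relation `rel A A'` between the interpretations of any two propositions, which is equality
  for `A = A'` and relates only zero to zero if the outermost connectives differ. Two propositions
  are needed because two derivations may cut on different ones. They may also split the context
  differently, but only by placing an unused variable on either side; such a variable has been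
  absorbed by a rule for `⊤` or `0`, so that both interpretations vanish (`Sem.eq_zero`).

Commuting reductions and algebraic rules then express linearity of the interpretation
(`Sem.lin_map`), where coherence shows that equal summands have equal interpretations; the rules for
the modality are computations with the operators `|v⟩⟨v|` that interpret boxed terms.

Complete positivity is proved in the stronger form `IsTensorPos`: positive elements are preserved
after tensoring with the identity of any finite-dimensional C*-algebra, not only of a matrix
algebra. This form is visibly stable under composition and tensor products. *-homomorphisms have
it, which covers all structural isomorphisms, and so do the trace and the counit of the duality, by
the criterion that an element is positive if and only if its products with positive elements have
nonnegative trace. For `B(f)`, an arbitrary `f : H → K` is turned into an operator on `H ⊕ K`, where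
`B(f)` becomes a conjugation by an element of the algebra.
-/

noncomputable section

/-! ### Positive elements -/

section Positivity
open scoped ComplexOrder
variable {A : Type} [Ring A] [Algebra ℂ A] [StarRing A]

theorem IsFaithfulTrace.nonneg {t : A →ₗ[ℂ] ℂ} (ht : IsFaithfulTrace t) (a : A) :
    0 ≤ t (star a * a) := by
  have him : (t (star a * a)).im = 0 := by
    have := ht.map_star (star a * a)
    simp only [star_mul, star_star] at this
    exact Complex.conj_eq_iff_im.1 this.symm
  refine Complex.nonneg_iff.2 ⟨?_, him.symm⟩
  by_cases h : a = 0
  · simp [h]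
  · exact (ht.pos a h).le

theorem IsFaithfulTrace.eq_zero {t : A →ₗ[ℂ] ℂ} (ht : IsFaithfulTrace t) {a : A}
    (h : t (star a * a) = 0) : a = 0 := by
  by_contra h0
  have := ht.pos a h0
  rw [h] at this
  simp at this

theorem IsPos.trace_nonneg {t : A →ₗ[ℂ] ℂ} (ht : IsFaithfulTrace t) {a : A} (ha : IsPos a) (c : A) :
    0 ≤ t (a * (c * star c)) := by
  obtain ⟨b, rfl⟩ := ha
  have h := ht.nonneg (star b * c)
  rw [ht.comm] at h
  rw [ht.comm]
  simp only [star_mul, star_star] at h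
  have e : t (c * star c * (b * star b)) = t (star b * c * (star c * b)) := by
    rw [show c * star c * (b * star b) = (c * star c * b) * star b by simp only [mul_assoc],
      ht.comm]
    simp only [mul_assoc]
  rw [e]; exact h

/-- An element whose products with all positive elements have nonnegative trace is positive: its
negative part `q` satisfies `t (a q²) = - t (q³)`, so it vanishes. -/
theorem isPos_of_trace_nonneg [StarModule ℂ A] [FiniteDimensional ℂ A] {t : A →ₗ[ℂ] ℂ}
    (ht : IsFaithfulTrace t) {a : A} (h : ∀ c, 0 ≤ t (a * (c * star c))) : IsPos a := by
  obtain ⟨N, hN⟩ := ht.exists_norm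
  let rn : RingNorm A :=
    { toFun := N
      map_zero' := by simpa using hN.smul 0 0
      add_le' := hN.add_le
      neg' := fun x => by simpa using hN.smul (-1) x
      mul_le' := hN.mul_le
      eq_zero_of_map_eq_zero' := hN.eq_zero }
  let : NormedRing A := rn.toNormedRing
  let : NormedAlgebra ℂ A := { ‹Algebra ℂ A› with norm_smul_le := fun c x => (hN.smul c x).le }
  have : CStarRing A := ⟨fun x => by
    change N x * N x ≤ N (star x * x)
    rw [hN.star_mul, sq]⟩
  have : CompleteSpace A := FiniteDimensional.complete ℂ A
  let : CStarAlgebra A := {}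
  let := CStarAlgebra.spectralOrder A
  have := CStarAlgebra.spectralOrderedRing A
  have hsa : star a = a := by
    have h1 : ∀ x : A, t ((a - star a) * x) = 0 := by
      have hl : t ∘ₗ LinearMap.mulLeft ℂ (a - star a) = 0 := by
        refine LinearMap.ext_on (CStarAlgebra.span_nonneg (A := A)) fun x hx => ?_
        obtain ⟨c, rfl⟩ := CStarAlgebra.nonneg_iff_eq_mul_star_self.1 (show 0 ≤ x from hx)
        have h2 := ht.map_star (a * (c * star c))
        rw [Complex.conj_eq_iff_im.2 (Complex.nonneg_iff.1 (h c)).2.symm] at h2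
        simp only [star_mul, star_star] at h2
        rw [ht.comm] at h2
        simp [sub_mul, h2]
      exact fun x => LinearMap.congr_fun hl x
    have h3 := h1 (star (a - star a))
    rw [ht.comm] at h3
    exact (sub_eq_zero.1 (ht.eq_zero h3)).symm
  have hq0 := CFC.negPart_nonneg a
  have hqs : star (a⁻) = a⁻ := (IsSelfAdjoint.of_nonneg hq0).star_eq
  obtain ⟨s, hs, hs2⟩ := CStarAlgebra.nonneg_iff_exists_nonneg_and_eq_mul_self.1 hq0
  have hss : star s = s := (IsSelfAdjoint.of_nonneg hs).star_eq
  have h1 := h (a⁻)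
  have h2 : a * (a⁻ * star (a⁻)) = -(star (s * a⁻) * (s * a⁻)) := by
    nth_rewrite 1 [← CFC.posPart_sub_negPart a hsa]
    rw [hqs, sub_mul, ← mul_assoc, CFC.posPart_mul_negPart, zero_mul, zero_sub, star_mul, hqs, hss]
    congr 1
    nth_rewrite 2 [hs2]
    simp only [mul_assoc]
  rw [h2, map_neg] at h1
  have h4 : s * a⁻ = 0 := ht.eq_zero (le_antisymm (neg_nonneg.1 h1) (ht.nonneg _))
  have h5 : a⁻ = 0 := ht.eq_zero (by
    rw [hqs]; nth_rewrite 1 [hs2]; rw [mul_assoc, h4]; simp)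
  have h6 : 0 ≤ a := by
    rw [← CFC.posPart_sub_negPart a hsa, h5, sub_zero]
    exact CFC.posPart_nonneg a
  exact CStarAlgebra.nonneg_iff_eq_mul_star_self.1 h6

/-- A linear map that preserves products and the involution; it need not preserve the unit. -/
def IsStarHom {A B : Type} [Ring A] [Algebra ℂ A] [StarRing A] [Ring B] [Algebra ℂ B] [StarRing B]
    (φ : A →ₗ[ℂ] B) : Prop :=
  (∀ a b, φ (a * b) = φ a * φ b) ∧ ∀ a, φ (star a) = star (φ a)

variable {B : Type} [Ring B] [Algebra ℂ B] [StarRing B]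

theorem IsStarHom.isPos {φ : A →ₗ[ℂ] B} (hφ : IsStarHom φ) {a : A} (ha : IsPos a) :
    IsPos (φ a) := by
  obtain ⟨b, rfl⟩ := ha
  exact ⟨φ b, by rw [hφ.1, hφ.2]⟩

theorem IsStarHom.comap_trace {φ : A →ₗ[ℂ] B} (hφ : IsStarHom φ) (hi : Function.Injective φ)
    {t : B →ₗ[ℂ] ℂ} (ht : IsFaithfulTrace t) : IsFaithfulTrace (t ∘ₗ φ) where
  comm a b := by simp [hφ.1, ht.comm (φ a)]
  map_star a := by simp [hφ.2, ht.map_star]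
  pos a h := by
    simpa [hφ.1, hφ.2] using ht.pos (φ a) (by simpa using hi.ne h)

/-- An injective homomorphism reflects positivity, since it pulls faithful traces back. -/
theorem IsStarHom.isPos_of_isPos [StarModule ℂ A] [FiniteDimensional ℂ A] {φ : A →ₗ[ℂ] B}
    (hφ : IsStarHom φ) (hi : Function.Injective φ) {t : B →ₗ[ℂ] ℂ} (ht : IsFaithfulTrace t) {a : A}
    (ha : IsPos (φ a)) : IsPos a :=
  isPos_of_trace_nonneg (hφ.comap_trace hi ht) fun c => by
    simpa [hφ.1, hφ.2] using ha.trace_nonneg ht (φ c)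

theorem IsPos.add [StarModule ℂ A] [FiniteDimensional ℂ A] {t : A →ₗ[ℂ] ℂ}
    (ht : IsFaithfulTrace t) {a b : A} (ha : IsPos a) (hb : IsPos b) : IsPos (a + b) :=
  isPos_of_trace_nonneg ht fun c => by
    rw [add_mul, map_add]
    exact add_nonneg (ha.trace_nonneg ht c) (hb.trace_nonneg ht c)

theorem IsPos.smul [StarModule ℂ A] {a : A} (ha : IsPos a) (p : ℝ≥0) :
    IsPos (((p : ℝ) : ℂ) • a) := by
  obtain ⟨b, rfl⟩ := ha
  refine ⟨((Real.sqrt p : ℝ) : ℂ) • b, ?_⟩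
  rw [star_smul, smul_mul_smul_comm]
  congr 1
  rw [Complex.star_def, Complex.conj_ofReal, ← Complex.ofReal_mul]
  exact congrArg _ (Real.mul_self_sqrt p.2).symm

theorem isPos_zero {R : Type} [Ring R] [StarRing R] : IsPos (0 : R) := ⟨0, by simp⟩

theorem IsPos.conj {R : Type} [Ring R] [StarRing R] {a : R} (ha : IsPos a) (u : R) :
    IsPos (u * a * star u) := by
  obtain ⟨b, rfl⟩ := ha
  exact ⟨u * b, by simp [mul_assoc]⟩

theorem IsPos.tmul [StarModule ℂ A] [StarModule ℂ B] {a : A} {b : B} (ha : IsPos a)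
    (hb : IsPos b) : IsPos (a ⊗ₜ[ℂ] b) := by
  obtain ⟨c, rfl⟩ := ha
  obtain ⟨d, rfl⟩ := hb
  exact ⟨c ⊗ₜ d, by simp [TensorProduct.star_tmul]⟩
end Positivity

namespace IsStarHom
variable {A B C D : Type} [Ring A] [Algebra ℂ A] [StarRing A] [Ring B] [Algebra ℂ B] [StarRing B]
  [Ring C] [Algebra ℂ C] [StarRing C] [Ring D] [Algebra ℂ D] [StarRing D]

theorem id : IsStarHom (LinearMap.id : A →ₗ[ℂ] A) := ⟨fun _ _ => rfl, fun _ => rfl⟩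

theorem symm {φ : A ≃ₗ[ℂ] B} (h : IsStarHom φ.toLinearMap) : IsStarHom φ.symm.toLinearMap :=
  ⟨fun a b => φ.injective (by
      have := h.1 (φ.symm a) (φ.symm b)
      simp only [LinearEquiv.coe_coe, LinearEquiv.apply_symm_apply] at this ⊢
      exact this.symm),
    fun a => φ.injective (by
      have := h.2 (φ.symm a)
      simp only [LinearEquiv.coe_coe, LinearEquiv.apply_symm_apply] at this ⊢
      exact this.symm)⟩

theorem comp {φ : A →ₗ[ℂ] B} {ψ : B →ₗ[ℂ] C} (h : IsStarHom φ) (k : IsStarHom ψ) :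
    IsStarHom (ψ ∘ₗ φ) :=
  ⟨fun a b => by simp [h.1, k.1], fun a => by simp [h.2, k.2]⟩

variable [StarModule ℂ A] [StarModule ℂ B]

/-- It is enough to test a linear map out of a tensor product on pure tensors. -/
theorem of_tmul {φ : A ⊗[ℂ] B →ₗ[ℂ] C}
    (h1 : ∀ a b a' b', φ ((a * a') ⊗ₜ (b * b')) = φ (a ⊗ₜ b) * φ (a' ⊗ₜ b'))
    (h2 : ∀ a b, φ (star a ⊗ₜ star b) = star (φ (a ⊗ₜ b))) : IsStarHom φ := by
  constructor
  · intro x y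
    induction x with
    | zero => simp
    | add x x' h h' => simp [add_mul, h, h']
    | tmul a b =>
      induction y with
      | zero => simp
      | add y y' h h' => simp [mul_add, h, h']
      | tmul a' b' => simpa using h1 a b a' b'
  · intro x
    induction x with
    | zero => simp
    | add x x' h h' => simp [h, h']
    | tmul a b => simpa [TensorProduct.star_tmul] using h2 a b

theorem map [StarModule ℂ C] [StarModule ℂ D] {φ : A →ₗ[ℂ] B} {ψ : C →ₗ[ℂ] D} (h : IsStarHom φ)
    (k : IsStarHom ψ) :
    IsStarHom (TensorProduct.map φ ψ) :=
  of_tmul (fun a b a' b' => by simp [h.1, k.1]) fun a b => by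
    simp [h.2, k.2, TensorProduct.star_tmul]

theorem comm : IsStarHom (TensorProduct.comm ℂ A B).toLinearMap :=
  of_tmul (fun a b a' b' => by simp) fun a b => by simp [TensorProduct.star_tmul]

theorem lid : IsStarHom (TensorProduct.lid ℂ A).toLinearMap :=
  of_tmul (fun a b a' b' => by simp [smul_smul, mul_comm]) fun a b => by simp [star_smul]

theorem rid : IsStarHom (TensorProduct.rid ℂ A).toLinearMap :=
  of_tmul (fun a b a' b' => by simp [smul_smul, mul_comm]) fun a b => by simp [star_smul]

variable [StarModule ℂ C]

theorem assoc : IsStarHom (TensorProduct.assoc ℂ A B C).toLinearMap := by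
  constructor
  · intro x y
    induction x with
    | zero => simp
    | add x x' h h' => simp only [add_mul, h, h', map_add]
    | tmul x c =>
      induction x with
      | zero => simp
      | add x x' h h' => simp only [add_mul, h, h', map_add, TensorProduct.add_tmul]
      | tmul a b =>
        induction y with
        | zero => simp
        | add y y' h h' => simp only [mul_add, h, h', map_add]
        | tmul y c' =>
          induction y with
          | zero => simp
          | add y y' h h' => simp only [mul_add, h, h', map_add, TensorProduct.add_tmul]
          | tmul a' b' => simp
  · intro x
    induction x with
    | zero => simp
    | add x x' h h' => simp only [star_add, h, h', map_add]
    | tmul x c =>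
      induction x with
      | zero => simp
      | add x x' h h' => simp only [TensorProduct.add_tmul, star_add, h, h', map_add]
      | tmul a b => simp [TensorProduct.star_tmul]

theorem leftComm : IsStarHom (TensorProduct.leftComm ℂ A B C).toLinearMap := by
  have : (TensorProduct.leftComm ℂ A B C).toLinearMap =
      (TensorProduct.assoc ℂ B A C).toLinearMap ∘ₗ
        TensorProduct.map (TensorProduct.comm ℂ A B).toLinearMap LinearMap.id ∘ₗ
          (TensorProduct.assoc ℂ A B C).symm.toLinearMap := by
    ext; simp
  rw [this]
  exact ((assoc (A := A) (B := B) (C := C)).symm.comp (comm.map id)).comp assoc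

theorem prodRight : IsStarHom (TensorProduct.prodRight ℂ ℂ A B C).toLinearMap :=
  of_tmul (fun a b a' b' => by simp) fun a b => by
    simp [TensorProduct.star_tmul, Prod.ext_iff]

end IsStarHom

/-! ### Completely positive maps -/

/-- The matrix algebra `M_n`, with the usual trace. -/
abbrev FCstar.mat (n : ℕ) : FCstar :=
  ofTrace (Matrix (Fin n) (Fin n) ℂ) (Matrix.traceLinearMap (Fin n) ℂ ℂ)
    { comm := Matrix.trace_mul_comm
      map_star := Matrix.trace_conjTranspose
      pos := fun a h => by
        open scoped ComplexOrder in
        have h1 : 0 ≤ Matrix.trace (a.conjTranspose * a) :=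
          (Matrix.posSemidef_conjTranspose_mul_self a).trace_nonneg
        have h2 : Matrix.trace (a.conjTranspose * a) ≠ 0 :=
          Matrix.trace_conjTranspose_mul_self_eq_zero_iff.not.2 h
        exact (Complex.pos_iff.1 (lt_of_le_of_ne h1 h2.symm)).1 }

/-- Complete positivity in the form that is stable under tensor products: `id ⊗ f` preserves
positive elements on `W ⊗ X` for every finite-dimensional C*-algebra `W`, not just for the matrix
algebras. -/
def IsTensorPos {X Y : FCstar} (f : X →ₗ[ℂ] Y) : Prop :=
  ∀ (W : FCstar) (z : W ⊗[ℂ] X), IsPos z → IsPos (LinearMap.lTensor W f z)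

theorem IsPos.lTensor_lTensor {W X Y Z : Type} [Ring W] [Algebra ℂ W] [StarRing W]
    [StarModule ℂ W] [Ring X] [Algebra ℂ X] [StarRing X] [StarModule ℂ X] [Ring Y] [Algebra ℂ Y]
    [StarRing Y] [StarModule ℂ Y] [Ring Z] [Algebra ℂ Z] [StarRing Z] [StarModule ℂ Z]
    {f : X →ₗ[ℂ] Y} {z : W ⊗[ℂ] (Z ⊗[ℂ] X)} (hz : IsPos z)
    (h : ∀ z : (W ⊗[ℂ] Z) ⊗[ℂ] X, IsPos z → IsPos (LinearMap.lTensor (W ⊗[ℂ] Z) f z)) :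
    IsPos (LinearMap.lTensor W (LinearMap.lTensor Z f) z) := by
  have e : LinearMap.lTensor W (LinearMap.lTensor Z f) =
      (TensorProduct.assoc ℂ W Z Y).toLinearMap ∘ₗ LinearMap.lTensor (W ⊗[ℂ] Z) f ∘ₗ
        (TensorProduct.assoc ℂ W Z X).symm.toLinearMap := by
    refine TensorProduct.ext_threefold' fun w z x => ?_
    simp
  rw [e]
  exact IsStarHom.assoc.isPos (h _ ((IsStarHom.assoc (A := W) (B := Z) (C := X)).symm.isPos hz))

namespace IsTensorPos
variable {X Y Z X' Y' : FCstar}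

theorem isCP {f : X →ₗ[ℂ] Y} (hf : IsTensorPos f) : IsCP f := fun n => hf (.mat n)

theorem of_isStarHom {f : X →ₗ[ℂ] Y} (hf : IsStarHom f) : IsTensorPos f := fun _ _ hz =>
  (IsStarHom.id.map hf).isPos hz

theorem comp {f : X →ₗ[ℂ] Y} {g : Y →ₗ[ℂ] Z} (hf : IsTensorPos f) (hg : IsTensorPos g) :
    IsTensorPos (g ∘ₗ f) := fun W z hz => by
  rw [LinearMap.lTensor_comp]
  exact hg W _ (hf W z hz)

theorem add {f g : X →ₗ[ℂ] Y} (hf : IsTensorPos f) (hg : IsTensorPos g) : IsTensorPos (f + g) :=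
  fun W z hz => by
    rw [LinearMap.lTensor_add]
    exact (hf W z hz).add (FCstar.tensor W Y).faithful (hg W z hz)

theorem smul {f : X →ₗ[ℂ] Y} (hf : IsTensorPos f) (p : ℝ≥0) :
    IsTensorPos (((p : ℝ) : ℂ) • f) := fun W z hz => by
  rw [LinearMap.lTensor_smul]
  exact (hf W z hz).smul p

theorem zero : IsTensorPos (0 : X →ₗ[ℂ] Y) := fun W z _ => by
  rw [LinearMap.lTensor_zero]
  exact isPos_zero

theorem id : IsTensorPos (LinearMap.id : X →ₗ[ℂ] X) := of_isStarHom .id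

theorem lTensor {f : X →ₗ[ℂ] Y} (hf : IsTensorPos f) :
    IsTensorPos (FCstar.map (LinearMap.id : Z →ₗ[ℂ] Z) f) := fun W _ hz =>
  hz.lTensor_lTensor fun z hz => hf (.tensor W Z) z hz

theorem map {f : X →ₗ[ℂ] Y} {g : X' →ₗ[ℂ] Y'} (hf : IsTensorPos f) (hg : IsTensorPos g) :
    IsTensorPos (FCstar.map f g) := by
  have e : FCstar.map f g = (TensorProduct.comm ℂ Y' Y).toLinearMap ∘ₗ
      FCstar.map LinearMap.id f ∘ₗ (TensorProduct.comm ℂ X Y').toLinearMap ∘ₗ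
        FCstar.map LinearMap.id g := by
    refine TensorProduct.ext' fun x y => ?_
    simp [FCstar.map]
  rw [e]
  have h1 := of_isStarHom (X := .tensor X Y') (Y := .tensor Y' X) (.comm (A := X) (B := Y'))
  have h2 := of_isStarHom (X := .tensor Y' Y) (Y := .tensor Y Y') (.comm (A := Y') (B := Y))
  exact ((hg.lTensor.comp h1).comp hf.lTensor).comp h2

end IsTensorPos

namespace FCstar

/-- The trace is completely positive: `id ⊗ tr` turns the trace form on `W ⊗ X` into that on `W`. -/
theorem isTensorPos_tr (X : FCstar) : IsTensorPos (Y := .unit) X.tr := fun W z hz => by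
  refine isPos_of_trace_nonneg (FCstar.tensor W .unit).faithful fun c => ?_
  have h := hz.trace_nonneg (FCstar.tensor W X).faithful ((TensorProduct.rid ℂ W c) ⊗ₜ 1)
  convert h using 1
  obtain ⟨w, rfl⟩ := (TensorProduct.rid ℂ W).symm.surjective c
  clear h hz
  induction z with
  | zero => simp
  | add z z' h h' => simp only [map_add, add_mul, h, h']
  | tmul a x => simp [traceTensor, TensorProduct.star_tmul]

/-- The counit `op a ⊗ b ↦ tr (a b)` of the duality between `X*` and `X`. -/
def counit (X : FCstar) : tensor (dual X) X →ₗ[ℂ] unit :=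
  TensorProduct.lift (dualEquiv X).toLinearMap

theorem counit_tmul (X : FCstar) (a : X.carrierᵐᵒᵖ) (x : X) :
    counit X (a ⊗ₜ x) = X.tr (a.unop * x) := rfl

/-- The multiplication `op a ⊗ b ↦ a b`. -/
def mulOp (X : FCstar) : tensor (dual X) X →ₗ[ℂ] X :=
  TensorProduct.lift (LinearMap.mul ℂ X ∘ₗ (MulOpposite.opLinearEquiv ℂ).symm.toLinearMap)

/-- By cyclicity of the trace, the counit sends `c d*` to `tr (m c (m d)*)`, where `m` is the
multiplication. -/
theorem counit_mul_star (X : FCstar) (W : FCstar) (c d : W ⊗[ℂ] (tensor (dual X) X)) :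
    LinearMap.lTensor W (counit X) (c * star d) =
      LinearMap.lTensor W X.tr
        (LinearMap.lTensor W (mulOp X) c * star (LinearMap.lTensor W (mulOp X) d)) := by
  induction c using TensorProduct.induction_on with
  | zero => simp
  | add c c' h h' => simp only [map_add, add_mul, h, h']
  | tmul w c =>
    induction c using TensorProduct.induction_on with
    | zero => simp
    | add c c' h h' => simp only [TensorProduct.tmul_add, map_add, add_mul, h, h']
    | tmul a x =>
      induction d using TensorProduct.induction_on with
      | zero => simp
      | add d d' h h' => simp only [map_add, star_add, mul_add, h, h']
      | tmul w' d =>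
        induction d using TensorProduct.induction_on with
        | zero => simp
        | add d d' h h' =>
          simp only [TensorProduct.tmul_add, map_add, star_add, mul_add, h, h']
        | tmul b y =>
          simp only [TensorProduct.star_tmul, Algebra.TensorProduct.tmul_mul_tmul,
            LinearMap.lTensor_tmul]
          congr 1
          change X.tr (star b.unop * a.unop * (x * star y)) =
            X.tr (a.unop * x * star (b.unop * y))
          rw [mul_assoc, X.faithful.comm, star_mul]
          simp only [mul_assoc]

theorem isTensorPos_counit (X : FCstar) : IsTensorPos (counit X) := fun W z hz => by
  obtain ⟨c, rfl⟩ := hz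
  rw [counit_mul_star]
  exact isTensorPos_tr X W _ ⟨_, rfl⟩

/-- The unit of the duality: the element of `X* ⊗ X` that corresponds to the identity map. -/
def coev (X : FCstar) : tensor (dual X) X := (ihomEquiv X X).symm LinearMap.id

theorem ihomEquiv_tmul (X Y : FCstar) (a : X.carrierᵐᵒᵖ) (y : Y) (x : X) :
    ihomEquiv X Y (a ⊗ₜ y) x = X.tr (a.unop * x) • y := by
  have h : dualTensorHomEquiv ℂ X Y (dualEquiv X a ⊗ₜ y) x = dualEquiv X a x • y := by simp
  exact h

/-- Multiplying by the unit element and tracing gives the counit. -/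
theorem tr_mul_coev (X : FCstar) (c : tensor (dual X) X) :
    (tensor (dual X) X).tr (coev X * c) = counit X c := by
  have h : ∀ (e : tensor (dual X) X) (a : X.carrierᵐᵒᵖ) (x : X),
      (tensor (dual X) X).tr (e * (a ⊗ₜ x)) = X.tr (ihomEquiv X X e a.unop * x) := by
    intro e a x
    induction e using TensorProduct.induction_on with
    | zero => simp
    | add e e' h h' => simp only [add_mul, map_add, h, h', LinearMap.add_apply]
    | tmul b y =>
      rw [ihomEquiv_tmul, Algebra.TensorProduct.tmul_mul_tmul]
      simp [traceTensor, X.faithful.comm a.unop]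
  induction c using TensorProduct.induction_on with
  | zero => simp
  | add c c' h h' => simp only [mul_add, map_add, h, h']
  | tmul a x => rw [h, counit_tmul, coev, LinearEquiv.apply_symm_apply, LinearMap.id_apply]

open scoped ComplexOrder in
theorem isPos_coev (X : FCstar) : IsPos (coev X) :=
  isPos_of_trace_nonneg (tensor (dual X) X).faithful fun c => by
    rw [tr_mul_coev]
    have h := counit_mul_star X .unit (1 ⊗ₜ c) (1 ⊗ₜ c)
    have h2 := congrArg (TensorProduct.lid ℂ ℂ) h
    simp only [TensorProduct.star_tmul, Algebra.TensorProduct.tmul_mul_tmul,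
      LinearMap.lTensor_tmul, TensorProduct.lid_tmul, star_one, mul_one, one_smul] at h2
    rw [h2, X.faithful.comm]
    exact X.faithful.nonneg _

theorem isTensorPos_tmul_left {X Z : FCstar} {e : X} (he : IsPos e) :
    IsTensorPos (X := Z) (Y := tensor X Z) (TensorProduct.mk ℂ X Z e) := fun W z hz => by
  have h := IsPos.tmul he hz
  have e1 : LinearMap.lTensor W (TensorProduct.mk ℂ X Z e) z =
      TensorProduct.leftComm ℂ X W Z (e ⊗ₜ z) := by
    clear h hz
    induction z with
    | zero => simp
    | add z z' h h' => simp only [map_add, TensorProduct.tmul_add, *]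
    | tmul w z => simp
  rw [e1]
  exact IsStarHom.leftComm.isPos h

/-- Currying is tensoring with the unit of the duality, followed by `id ⊗ f`. -/
theorem curry_eq {Z X Y : FCstar} (f : tensor Z X →ₗ[ℂ] Y) :
    curry f = FCstar.map LinearMap.id f ∘ₗ (TensorProduct.leftComm ℂ Z (dual X) X).toLinearMap ∘ₗ
      (TensorProduct.comm ℂ (tensor (dual X) X) Z).toLinearMap ∘ₗ
        TensorProduct.mk ℂ (tensor (dual X) X) Z (coev X) := by
  ext z
  refine (ihomEquiv X Y).injective (LinearMap.ext fun x => ?_)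
  have h : ∀ e : tensor (dual X) X,
      ihomEquiv X Y (FCstar.map LinearMap.id f (TensorProduct.leftComm ℂ Z (dual X) X (z ⊗ₜ e))) x =
        f (z ⊗ₜ ihomEquiv X X e x) := by
    intro e
    induction e using TensorProduct.induction_on with
    | zero => simp
    | add e e' h h' => simp only [TensorProduct.tmul_add, map_add, LinearMap.add_apply, h, h']
    | tmul b y =>
      rw [TensorProduct.leftComm_tmul, FCstar.map, TensorProduct.map_tmul, LinearMap.id_apply,
        ihomEquiv_tmul, ihomEquiv_tmul, TensorProduct.tmul_smul, map_smul]
  simp only [curry, LinearMap.comp_apply, LinearEquiv.coe_coe, LinearEquiv.apply_symm_apply,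
    TensorProduct.mk_apply, TensorProduct.comm_tmul, TensorProduct.curry_apply]
  rw [h, coev, LinearEquiv.apply_symm_apply, LinearMap.id_apply]

theorem isTensorPos_curry {Z X Y : FCstar} {f : tensor Z X →ₗ[ℂ] Y} (hf : IsTensorPos f) :
    IsTensorPos (curry f) := by
  rw [curry_eq]
  exact (((isTensorPos_tmul_left (isPos_coev X)).comp
    (.of_isStarHom (Y := .tensor Z (.tensor (dual X) X)) .comm)).comp
      (.of_isStarHom (Y := .tensor (dual X) (.tensor Z X)) .leftComm)).comp hf.lTensor

theorem isTensorPos_eval (X Y : FCstar) : IsTensorPos (eval X Y) := by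
  have e : eval X Y = (TensorProduct.rid ℂ Y).toLinearMap ∘ₗ FCstar.map LinearMap.id (counit X) ∘ₗ
      (TensorProduct.leftComm ℂ (dual X) Y X).toLinearMap ∘ₗ
        (TensorProduct.assoc ℂ (dual X) Y X).toLinearMap := by
    refine TensorProduct.ext_threefold fun a y x => ?_
    simp only [eval, FCstar.map, LinearMap.comp_apply, LinearEquiv.coe_coe,
      TensorProduct.assoc_tmul,
      TensorProduct.leftComm_tmul, TensorProduct.map_tmul, TensorProduct.lift.tmul,
      TensorProduct.rid_tmul, LinearMap.id_apply]
    rw [ihomEquiv_tmul, counit_tmul]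
  rw [e]
  have h1 := IsTensorPos.of_isStarHom (X := .tensor (.tensor (dual X) Y) X)
    (Y := .tensor (dual X) (.tensor Y X)) (IsStarHom.assoc (A := dual X) (B := Y) (C := X))
  have h2 := IsTensorPos.of_isStarHom (X := .tensor (dual X) (.tensor Y X))
    (Y := .tensor Y (.tensor (dual X) X)) (IsStarHom.leftComm (A := dual X) (B := Y) (C := X))
  have h3 := IsTensorPos.of_isStarHom (X := .tensor Y .unit) (IsStarHom.rid (A := Y))
  exact ((h1.comp h2).comp (isTensorPos_counit X).lTensor).comp h3

theorem isTensorPos_inl (X Y : FCstar) : IsTensorPos (inl X Y) :=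
  .of_isStarHom ⟨fun a b => by simp [inl], fun a => by simp [inl, Prod.ext_iff]⟩

theorem isTensorPos_inr (X Y : FCstar) : IsTensorPos (inr X Y) :=
  .of_isStarHom ⟨fun a b => by simp [inr], fun a => by simp [inr, Prod.ext_iff]⟩

theorem isTensorPos_copair {X Y Z : FCstar} {f : X →ₗ[ℂ] Z} {g : Y →ₗ[ℂ] Z} (hf : IsTensorPos f)
    (hg : IsTensorPos g) : IsTensorPos (copair f g) := by
  have h1 : IsTensorPos (X := .sum X Y) (LinearMap.fst ℂ X Y) :=
    .of_isStarHom ⟨fun _ _ => rfl, fun _ => rfl⟩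
  have h2 : IsTensorPos (X := .sum X Y) (LinearMap.snd ℂ X Y) :=
    .of_isStarHom ⟨fun _ _ => rfl, fun _ => rfl⟩
  exact (h1.comp hf).add (h2.comp hg)

end FCstar

/-! ### The functor `B` -/

theorem BMap_apply {H K : FHilb} (f : H →ₗ[ℂ] K) (a : H →ₗ[ℂ] H) :
    BMap f a = f ∘ₗ a ∘ₗ LinearMap.adjoint f := rfl

theorem BMap_comp {H K L : FHilb} (f : H →ₗ[ℂ] K) (g : K →ₗ[ℂ] L) :
    BMap (g ∘ₗ f) = BMap g ∘ₗ BMap f := by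
  refine LinearMap.ext fun (a : H →ₗ[ℂ] H) => ?_
  change (g ∘ₗ f) ∘ₗ a ∘ₗ LinearMap.adjoint (g ∘ₗ f) = _
  rw [LinearMap.adjoint_comp]
  rfl

theorem BMap_id (H : FHilb) : BMap (LinearMap.id : H →ₗ[ℂ] H) = LinearMap.id := by
  refine LinearMap.ext fun (a : H →ₗ[ℂ] H) => ?_
  change LinearMap.id ∘ₗ a ∘ₗ LinearMap.adjoint LinearMap.id = _
  rw [LinearMap.adjoint_id]
  rfl

theorem isStarHom_BMap {H K : FHilb} {f : H →ₗ[ℂ] K}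
    (hf : LinearMap.adjoint f ∘ₗ f = LinearMap.id) : IsStarHom (BMap f) := by
  constructor
  · intro a b
    have h : ∀ x, LinearMap.adjoint f (f x) = x := LinearMap.congr_fun hf
    refine LinearMap.ext fun x => ?_
    change f (a (b (LinearMap.adjoint f x))) =
      f (a (LinearMap.adjoint f (f (b (LinearMap.adjoint f x)))))
    rw [h]
  · intro (a : H →ₗ[ℂ] H)
    change f ∘ₗ LinearMap.adjoint a ∘ₗ LinearMap.adjoint f =
      LinearMap.adjoint (f ∘ₗ a ∘ₗ LinearMap.adjoint f)
    rw [LinearMap.adjoint_comp, LinearMap.adjoint_comp, LinearMap.adjoint_adjoint]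
    rfl

theorem BMap_injective {H K : FHilb} {f : H →ₗ[ℂ] K}
    (hf : LinearMap.adjoint f ∘ₗ f = LinearMap.id) : Function.Injective (BMap f) := by
  refine Function.LeftInverse.injective (g := BMap (LinearMap.adjoint f)) fun a => ?_
  rw [← LinearMap.comp_apply, ← BMap_comp, hf, BMap_id, LinearMap.id_apply]

/-- The inclusions of the summands of `H ⊕ K` are isometries. -/
theorem FHilb.adjoint_pair_id_zero (H K : FHilb) :
    LinearMap.adjoint (FHilb.pair (LinearMap.id : H →ₗ[ℂ] H) (0 : H →ₗ[ℂ] K)) = FHilb.fst H K := by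
  symm
  rw [LinearMap.eq_adjoint_iff]
  intro x y
  simp [FHilb.pair, FHilb.fst, FHilb.sumEquiv, WithLp.prod_inner_apply]

theorem FHilb.adjoint_pair_zero_id (H K : FHilb) :
    LinearMap.adjoint (FHilb.pair (0 : K →ₗ[ℂ] H) (LinearMap.id : K →ₗ[ℂ] K)) = FHilb.snd H K := by
  symm
  rw [LinearMap.eq_adjoint_iff]
  intro x y
  simp [FHilb.pair, FHilb.snd, FHilb.sumEquiv, WithLp.prod_inner_apply]

theorem FCstar.isTensorPos_conj {X : FCstar} (u : X) :
    IsTensorPos (LinearMap.mulRight ℂ (star u) ∘ₗ LinearMap.mulLeft ℂ u) := fun W z hz => by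
  have h := hz.conj (1 ⊗ₜ[ℂ] u)
  have e : LinearMap.lTensor W (LinearMap.mulRight ℂ (star u) ∘ₗ LinearMap.mulLeft ℂ u) z =
      1 ⊗ₜ[ℂ] u * z * star (1 ⊗ₜ[ℂ] u) := by
    clear h hz
    induction z with
    | zero => simp
    | add z z' h h' => simp only [map_add, mul_add, add_mul, h, h']
    | tmul w x => simp [TensorProduct.star_tmul]
  rw [e]
  exact h

/-- The inclusion of `B(K)` into `B(H ⊕ K)` reflects positivity and turns `B(f)` into conjugation by
an element of `B(H ⊕ K)`. -/
theorem isTensorPos_BMap {H K : FHilb} (f : H →ₗ[ℂ] K) : IsTensorPos (BMap f) := fun W z hz => by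
  let i := FHilb.pair (LinearMap.id : H →ₗ[ℂ] H) (0 : H →ₗ[ℂ] K)
  let j := FHilb.pair (0 : K →ₗ[ℂ] H) (LinearMap.id : K →ₗ[ℂ] K)
  have hi : LinearMap.adjoint i ∘ₗ i = LinearMap.id := by
    rw [FHilb.adjoint_pair_id_zero]; rfl
  have hj : LinearMap.adjoint j ∘ₗ j = LinearMap.id := by
    rw [FHilb.adjoint_pair_zero_id]; rfl
  let F : FCstar.ofHilb (.sum H K) := j ∘ₗ f ∘ₗ LinearMap.adjoint i
  have e : BMap j ∘ₗ BMap f =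
      (LinearMap.mulRight ℂ (star F) ∘ₗ LinearMap.mulLeft ℂ F) ∘ₗ BMap i := by
    have e1 : (LinearMap.mulRight ℂ (star F) ∘ₗ LinearMap.mulLeft ℂ F) = BMap F := by
      ext a : 1
      exact mul_assoc F a (star F)
    rw [e1, ← BMap_comp, ← BMap_comp]
    congr 1
    change j ∘ₗ f = (j ∘ₗ f ∘ₗ LinearMap.adjoint i) ∘ₗ i
    rw [LinearMap.comp_assoc, LinearMap.comp_assoc, hi, LinearMap.comp_id]
  have h1 := (IsTensorPos.of_isStarHom (isStarHom_BMap hi)).comp (FCstar.isTensorPos_conj F)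
  rw [← e] at h1
  have h2 := h1 W z hz
  rw [LinearMap.lTensor_comp, LinearMap.comp_apply] at h2
  exact (IsStarHom.id.map (isStarHom_BMap hj)).isPos_of_isPos
    (Module.Flat.lTensor_preserves_injective_linearMap _ (BMap_injective hj))
    (FCstar.tensor W (.ofHilb (.sum H K))).faithful h2

theorem tauIso_tmul (H K : FHilb) (a : H →ₗ[ℂ] H) (b : K →ₗ[ℂ] K) :
    tauIso H K (a ⊗ₜ b) = FHilb.map a b := by
  have h : homTensorHomEquiv ℂ H K H K (a ⊗ₜ b) = TensorProduct.map a b := by simp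
  exact h

theorem isStarHom_tauIso (H K : FHilb) : IsStarHom (tauIso H K).toLinearMap :=
  IsStarHom.of_tmul (A := FCstar.ofHilb H) (B := FCstar.ofHilb K)
    (fun a b a' b' => (tauIso_tmul H K (a * a') (b * b')).trans <|
      (TensorProduct.map_comp _ _ _ _).trans
        (congrArg₂ (· * ·) (tauIso_tmul H K a b).symm (tauIso_tmul H K a' b').symm :))
    fun a b => (tauIso_tmul H K (star a) (star b)).trans <|
      (TensorProduct.adjoint_map _ _).symm.trans
        (congrArg LinearMap.adjoint (tauIso_tmul H K a b).symm :)

theorem tauUnit_apply (c : ℂ) : tauUnit c = c • (LinearMap.id : ℂ →ₗ[ℂ] ℂ) := by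
  refine LinearMap.ext fun x => ?_
  simp [tauUnit, mul_comm]

theorem isStarHom_tauUnit : IsStarHom tauUnit.toLinearMap := by
  constructor
  · intro a b
    refine LinearMap.ext fun (x : ℂ) => ?_
    change x * (a * b) = x * b * a
    ring
  · intro a
    change tauUnit (star a) = LinearMap.adjoint (show ℂ →ₗ[ℂ] ℂ from tauUnit a)
    rw [tauUnit_apply, tauUnit_apply, map_smulₛₗ, LinearMap.adjoint_id]
    rfl

/-- A unitary map of Hilbert spaces acts on operators by conjugation with its inverse. -/
theorem BMap_isometry {H K : FHilb} (e : H ≃ₗᵢ[ℂ] K) (a : H →ₗ[ℂ] H) :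
    BMap e.toLinearEquiv.toLinearMap a =
      e.toLinearEquiv.toLinearMap ∘ₗ a ∘ₗ e.symm.toLinearEquiv.toLinearMap := by
  rw [BMap_apply, LinearIsometryEquiv.adjoint_toLinearMap_eq_symm]

theorem BMap_map_tauIso {H H' K K' : FHilb} (f : H →ₗ[ℂ] H') (g : K →ₗ[ℂ] K') :
    BMap (FHilb.map f g) ∘ₗ (tauIso H K).toLinearMap =
      (tauIso H' K').toLinearMap ∘ₗ FCstar.map (BMap f) (BMap g) := by
  refine TensorProduct.ext' fun a b => ?_
  refine (congrArg (BMap (FHilb.map f g)) (tauIso_tmul H K a b)).trans ?_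
  refine Eq.trans ?_ (tauIso_tmul H' K' (BMap f a) (BMap g b)).symm
  change FHilb.map f g ∘ₗ FHilb.map a b ∘ₗ LinearMap.adjoint (TensorProduct.map f g) =
    TensorProduct.map (f ∘ₗ a ∘ₗ LinearMap.adjoint f) (g ∘ₗ b ∘ₗ LinearMap.adjoint g)
  rw [TensorProduct.adjoint_map, TensorProduct.map_comp, TensorProduct.map_comp]
  rfl

theorem BMap_assoc_tauIso (H K L : FHilb) :
    BMap (H := .tensor (.tensor H K) L) (K := .tensor H (.tensor K L))
        (TensorProduct.assoc ℂ H K L).toLinearMap ∘ₗ (tauIso (.tensor H K) L).toLinearMap ∘ₗ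
        FCstar.map (tauIso H K).toLinearMap LinearMap.id =
      (tauIso H (.tensor K L)).toLinearMap ∘ₗ FCstar.map LinearMap.id (tauIso K L).toLinearMap ∘ₗ
        (TensorProduct.assoc ℂ (FCstar.ofHilb H) (FCstar.ofHilb K)
          (FCstar.ofHilb L)).toLinearMap := by
  refine TensorProduct.ext_threefold fun a b c => ?_
  have h1 : tauIso (.tensor H K) L (tauIso H K (a ⊗ₜ b) ⊗ₜ c) = FHilb.map (FHilb.map a b) c :=
    (tauIso_tmul _ _ (tauIso H K (a ⊗ₜ b)) c).trans
      (congrArg (fun u => FHilb.map u c) (tauIso_tmul H K a b))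
  have h2 : tauIso H (.tensor K L) (a ⊗ₜ tauIso K L (b ⊗ₜ c)) = FHilb.map a (FHilb.map b c) :=
    (tauIso_tmul _ _ a (tauIso K L (b ⊗ₜ c))).trans
      (congrArg (fun u => FHilb.map a u) (tauIso_tmul K L b c))
  refine (congrArg (BMap (H := .tensor (.tensor H K) L) (K := .tensor H (.tensor K L))
    (TensorProduct.assoc ℂ H K L).toLinearMap) h1).trans (Eq.trans ?_ h2.symm)
  refine (BMap_isometry (H := .tensor (.tensor H K) L) (K := .tensor H (.tensor K L))
    (TensorProduct.assocIsometry ℂ H K L) _).trans ?_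
  exact TensorProduct.ext_threefold' fun x y z => rfl

theorem BMap_lid_tauIso (H : FHilb) :
    BMap (H := .tensor .unit H) (K := H) (TensorProduct.lid ℂ H).toLinearMap ∘ₗ
        (tauIso .unit H).toLinearMap ∘ₗ FCstar.map tauUnit.toLinearMap LinearMap.id =
      (TensorProduct.lid ℂ (FCstar.ofHilb H)).toLinearMap := by
  refine TensorProduct.ext' fun c a => ?_
  refine (congrArg (BMap (H := .tensor .unit H) (K := H) (TensorProduct.lid ℂ H).toLinearMap)
    (tauIso_tmul .unit H (tauUnit c) a)).trans ?_
  refine (BMap_isometry (H := .tensor .unit H) (K := H)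
    (TensorProduct.lidIsometry ℂ H) _).trans ?_
  refine LinearMap.ext fun x => ?_
  change TensorProduct.lid ℂ H (TensorProduct.map (tauUnit c) a (1 ⊗ₜ x)) = c • a x
  rw [TensorProduct.map_tmul, TensorProduct.lid_tmul, tauUnit_apply]
  simp

theorem BMap_rid_tauIso (H : FHilb) :
    BMap (H := .tensor H .unit) (K := H) (TensorProduct.rid ℂ H).toLinearMap ∘ₗ
        (tauIso H .unit).toLinearMap ∘ₗ FCstar.map LinearMap.id tauUnit.toLinearMap =
      (TensorProduct.rid ℂ (FCstar.ofHilb H)).toLinearMap := by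
  refine TensorProduct.ext' fun a c => ?_
  refine (congrArg (BMap (H := .tensor H .unit) (K := H) (TensorProduct.rid ℂ H).toLinearMap)
    (tauIso_tmul H .unit a (tauUnit c))).trans ?_
  refine (BMap_isometry (H := .tensor H .unit) (K := H)
    (TensorProduct.ridIsometry ℂ H) _).trans ?_
  refine LinearMap.ext fun x => ?_
  change TensorProduct.rid ℂ H (TensorProduct.map a (tauUnit c) (x ⊗ₜ 1)) = c • a x
  rw [TensorProduct.map_tmul, TensorProduct.rid_tmul, tauUnit_apply]
  simp

theorem bIsStrongMonoidal : BIsStrongMonoidal where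
  cp f := (isTensorPos_BMap f).isCP
  map_id := BMap_id
  map_comp := BMap_comp
  tau_cp H K := (IsTensorPos.of_isStarHom (isStarHom_tauIso H K)).isCP
  tau_symm_cp H K := (IsTensorPos.of_isStarHom (isStarHom_tauIso H K).symm).isCP
  unit_cp := (IsTensorPos.of_isStarHom isStarHom_tauUnit).isCP
  unit_symm_cp := (IsTensorPos.of_isStarHom isStarHom_tauUnit.symm).isCP
  natural := BMap_map_tauIso
  assoc := BMap_assoc_tauIso
  left_unit := BMap_lid_tauIso
  right_unit := BMap_rid_tauIso

/-! ### Complete positivity of the interpretation -/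

namespace MDer

theorem isStarHom_split : ∀ Γ Δ : MCtx, IsStarHom (split Γ Δ).toLinearMap
  | [], Δ => (IsStarHom.lid (A := ctx Δ)).symm
  | (_, S) :: Γ, Δ =>
    (IsStarHom.id.map (isStarHom_split Γ Δ)).comp
      (IsStarHom.assoc (A := S.den) (B := ctx Γ) (C := ctx Δ)).symm

theorem isStarHom_swap (x y : ℕ) (S T : MTy) (Γ : MCtx) :
    ∀ Δ : MCtx, IsStarHom (swap x y S T Γ Δ).toLinearMap
  | [] => IsStarHom.leftComm (A := S.den) (B := T.den) (C := ctx Γ)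
  | (_, _) :: Δ => IsStarHom.id.map (isStarHom_swap x y S T Γ Δ)

theorem isStarHom_snoc (Γ : MCtx) (x : ℕ) (S : MTy) : IsStarHom (snoc Γ x S).toLinearMap :=
  (IsStarHom.id.map (IsStarHom.rid (A := S.den)).symm).comp (isStarHom_split Γ [(x, S)]).symm

theorem isStarHom_snoc2 (Γ : MCtx) (x y : ℕ) (S T : MTy) :
    IsStarHom (snoc2 Γ x y S T).toLinearMap :=
  (IsStarHom.id.map (IsStarHom.id.map (IsStarHom.rid (A := T.den)).symm)).comp
    (isStarHom_split Γ [(x, S), (y, T)]).symm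

theorem isTensorPos_den {Γ : MCtx} {m : MTm} {A : MTy} (D : MDer Γ m A) : IsTensorPos D.den := by
  have hsplit := fun Γ Δ => IsTensorPos.of_isStarHom (isStarHom_split Γ Δ)
  have hsymm : ∀ X Y : FCstar, IsTensorPos (FCstar.symm X Y).toLinearMap := fun X Y =>
    .of_isStarHom (IsStarHom.comm (A := X) (B := Y))
  have hsnoc := fun Γ x S => IsTensorPos.of_isStarHom (isStarHom_snoc Γ x S)
  have hlid : ∀ X : FCstar, IsTensorPos (X := .tensor .unit X)
    (TensorProduct.lid ℂ X).toLinearMap :=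
    fun X => .of_isStarHom (IsStarHom.lid (A := X))
  induction D with
  | ax x A => exact .of_isStarHom (X := .tensor A.den .unit) (IsStarHom.rid (A := A.den))
  | sum D E hD hE => exact hD.add hE
  | prod p D hD => exact hD.smul p
  | zeroE Δ A h1 h2 D hD => exact (hsplit _ _).comp (hD.map .id) |>.comp .zero
  | oneI => exact .id
  | oneE h D E hD hE => exact ((hsplit _ _).comp (hD.map hE)).comp (hlid _)
  | lolliI x hx D hD => exact FCstar.isTensorPos_curry ((hsnoc _ _ _).comp hD)
  | lolliE h D E hD hE =>
    exact ((hsplit _ _).comp (hD.map hE)).comp (FCstar.isTensorPos_eval _ _)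
  | oplusI1 B D hD => exact hD.comp (FCstar.isTensorPos_inl _ _)
  | oplusI2 A D hD => exact hD.comp (FCstar.isTensorPos_inr _ _)
  | @oplusE Δ Γ m n o A B C x y h hx hy D E F hD hE hF =>
    have hd : IsTensorPos (FCstar.distr (ctx Γ) A.den B.den).toLinearMap :=
      .of_isStarHom (IsStarHom.prodRight (A := ctx Γ) (B := A.den) (C := B.den))
    exact ((((hsplit _ _).comp (hD.map .id)).comp (hsymm _ _)).comp hd).comp
      (FCstar.isTensorPos_copair ((hsnoc _ _ _).comp hE) ((hsnoc _ _ _).comp hF))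
  | tensI h D E hD hE => exact (hsplit _ _).comp (hD.map hE)
  | tensE x y h hx hy D E hD hE =>
    exact ((((hsplit _ _).comp (hD.map .id)).comp (hsymm _ _)).comp
      (.of_isStarHom (isStarHom_snoc2 _ x y _ _))).comp hE
  | boxI D => exact (IsTensorPos.of_isStarHom isStarHom_tauUnit).comp (isTensorPos_BMap D.den)
  | boxE h D E hD hE =>
    exact (((hsplit _ _).comp (hD.map hE)).comp
      (.of_isStarHom (isStarHom_tauIso _ _))).comp (isTensorPos_BMap _)
  | tau D hD => exact hD.comp (.of_isStarHom (isStarHom_tauIso _ _))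
  | ex D hD => exact (IsTensorPos.of_isStarHom (isStarHom_swap _ _ _ _ _ _)).comp hD

end MDer

/-! ### A common syntax for both fragments -/

/-- Unary operations that bind nothing. -/
inductive UnOp : Type
  | smul (a : ℂ)
  | inl
  | inr
  | tau

/-- Binary operations whose arguments share one context. -/
inductive ParOp : Type
  | add
  | pair

/-- Binary operations whose arguments split the context. -/
inductive BinOp : Type
  | elimOne
  | app
  | tens

/-- Terms that comprise the pure and the mixed ones, with the operations grouped by the way in which
they use the context.  `elimWith` has the index of the projection as its first argument. -/
inductive Tm : Type
  | bvar (k : ℕ)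
  | fvar (x : ℕ)
  | topI
  | star
  | un (o : UnOp) (m : Tm)
  | par (o : ParOp) (m n : Tm)
  | bin (o : BinOp) (m n : Tm)
  | lam (m : Tm)
  | elimZero (m : Tm)
  | elimWith (i : Bool) (m n : Tm)
  | elimPlus (m n o : Tm)
  | elimTens (m n : Tm)
  | box (m : Tm)

namespace Tm

/-- Free variables; those of a boxed term do not count, since boxed terms are closed. -/
def fv : Tm → Finset ℕ
  | bvar _ => ∅
  | fvar x => {x}
  | topI => ∅
  | star => ∅
  | un _ m => m.fv
  | par _ m n => m.fv ∪ n.fv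
  | bin _ m n => m.fv ∪ n.fv
  | lam m => m.fv
  | elimZero m => m.fv
  | elimWith _ m n => m.fv ∪ n.fv
  | elimPlus m n o => m.fv ∪ n.fv ∪ o.fv
  | elimTens m n => m.fv ∪ n.fv
  | box _ => ∅

/-- Replacement of a bound variable, as in `PTm.inst` and `MTm.inst`. -/
def inst : Tm → ℕ → Tm → Tm
  | bvar j, k, u => if j = k then u else bvar j
  | fvar x, _, _ => fvar x
  | topI, _, _ => topI
  | star, _, _ => star
  | un o m, k, u => un o (m.inst k u)
  | par o m n, k, u => par o (m.inst k u) (n.inst k u)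
  | bin o m n, k, u => bin o (m.inst k u) (n.inst k u)
  | lam m, k, u => lam (m.inst (k + 1) u)
  | elimZero m, k, u => elimZero (m.inst k u)
  | elimWith i m n, k, u => elimWith i (m.inst k u) (n.inst (k + 1) u)
  | elimPlus m n o, k, u => elimPlus (m.inst k u) (n.inst (k + 1) u) (o.inst (k + 1) u)
  | elimTens m n, k, u => elimTens (m.inst k u) (n.inst (k + 2) u)
  | box m, _, _ => box m

/-- Replacement of the two variables of a two-variable binder. -/
def inst2 (n u v : Tm) : Tm := (n.inst 1 u).inst 0 v

/-- Substitution of `u` for the free variable `x`. -/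
def sub : Tm → ℕ → Tm → Tm
  | bvar j, _, _ => bvar j
  | fvar y, x, u => if y = x then u else fvar y
  | topI, _, _ => topI
  | star, _, _ => star
  | un o m, x, u => un o (m.sub x u)
  | par o m n, x, u => par o (m.sub x u) (n.sub x u)
  | bin o m n, x, u => bin o (m.sub x u) (n.sub x u)
  | lam m, x, u => lam (m.sub x u)
  | elimZero m, x, u => elimZero (m.sub x u)
  | elimWith i m n, x, u => elimWith i (m.sub x u) (n.sub x u)
  | elimPlus m n o, x, u => elimPlus (m.sub x u) (n.sub x u) (o.sub x u)
  | elimTens m n, x, u => elimTens (m.sub x u) (n.sub x u)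
  | box m, _, _ => box m

/-- A term without dangling bound variables. -/
def LC (m : Tm) : Prop := ∀ k u, m.inst k u = m

theorem sub_of_notMem {x : ℕ} {u m : Tm} (h : x ∉ m.fv) : m.sub x u = m := by
  induction m with
  | fvar y => simp only [fv, Finset.mem_singleton] at h; simp [sub, Ne.symm h]
  | _ => simp_all [sub, fv]

theorem inst_sub {x : ℕ} {u : Tm} (hu : u.LC) (m v : Tm) (k : ℕ) :
    (m.inst k v).sub x u = (m.sub x u).inst k (v.sub x u) := by
  induction m generalizing k with
  | bvar j => simp only [inst, sub]; split <;> simp [sub]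
  | fvar y =>
    simp only [inst, sub]; split
    · exact (hu _ _).symm
    · rfl
  | _ => simp_all [inst, sub]

theorem inst_fvar_sub {x : ℕ} {m : Tm} (h : x ∉ m.fv) (u : Tm) (k : ℕ) :
    (m.inst k (fvar x)).sub x u = m.inst k u := by
  induction m generalizing k with
  | bvar j => simp only [inst]; split <;> simp [sub]
  | fvar y => simp only [fv, Finset.mem_singleton] at h; simp [inst, sub, Ne.symm h]
  | _ => simp_all [inst, sub, fv]

theorem fv_inst (m u : Tm) (k : ℕ) : (m.inst k u).fv ⊆ m.fv ∪ u.fv := by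
  induction m generalizing k with
  | bvar j => simp only [inst]; split <;> simp [fv]
  | fvar y => simp [inst, fv]
  | topI => simp [inst, fv]
  | star => simp [inst, fv]
  | box m => simp [inst, fv]
  | un o m ih => exact ih k
  | lam m ih => exact ih _
  | elimZero m ih => exact ih k
  | par o m n ihm ihn =>
    intro y; have := @ihm k y; have := @ihn k y; simp [inst, fv] at *; tauto
  | bin o m n ihm ihn =>
    intro y; have := @ihm k y; have := @ihn k y; simp [inst, fv] at *; tauto
  | elimWith i m n ihm ihn =>
    intro y; have := @ihm k y; have := @ihn (k + 1) y; simp [inst, fv] at *; tauto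
  | elimTens m n ihm ihn =>
    intro y; have := @ihm k y; have := @ihn (k + 2) y; simp [inst, fv] at *; tauto
  | elimPlus m n o ihm ihn iho =>
    intro y; have := @ihm k y; have := @ihn (k + 1) y; have := @iho (k + 1) y
    simp [inst, fv] at *; tauto

theorem subset_fv_inst (m u : Tm) (k : ℕ) : m.fv ⊆ (m.inst k u).fv := by
  induction m generalizing k with
  | bvar j => simp [fv]
  | fvar y => simp [inst, fv]
  | topI => simp [fv]
  | star => simp [fv]
  | box m => simp [fv]
  | un o m ih => exact ih k
  | lam m ih => exact ih _
  | elimZero m ih => exact ih k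
  | par o m n ihm ihn => exact Finset.union_subset_union (ihm _) (ihn _)
  | bin o m n ihm ihn => exact Finset.union_subset_union (ihm _) (ihn _)
  | elimWith i m n ihm ihn => exact Finset.union_subset_union (ihm _) (ihn _)
  | elimTens m n ihm ihn => exact Finset.union_subset_union (ihm _) (ihn _)
  | elimPlus m n o ihm ihn iho =>
    exact Finset.union_subset_union (Finset.union_subset_union (ihm _) (ihn _)) (iho _)

theorem inst_of_inst {m u v : Tm} {i j : ℕ} (hij : i ≠ j)
    (h : (m.inst i u).inst j v = m.inst i u) : m.inst j v = m := by
  induction m generalizing i j with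
  | bvar l =>
    simp only [inst] at h ⊢
    split
    · next hl => simp [hl, Ne.symm hij, inst] at h; simp [h, hl]
    · rfl
  | un o m ih => simp only [inst, un.injEq, true_and] at h ⊢; exact ih hij h
  | lam m ih => simp only [inst, lam.injEq] at h ⊢; exact ih (by omega) h
  | elimZero m ih => simp only [inst, elimZero.injEq] at h ⊢; exact ih hij h
  | par o m n ihm ihn =>
    simp only [inst, par.injEq, true_and] at h ⊢; exact ⟨ihm hij h.1, ihn hij h.2⟩
  | bin o m n ihm ihn =>
    simp only [inst, bin.injEq, true_and] at h ⊢; exact ⟨ihm hij h.1, ihn hij h.2⟩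
  | elimWith i m n ihm ihn =>
    simp only [inst, elimWith.injEq, true_and] at h ⊢
    exact ⟨ihm hij h.1, ihn (by omega) h.2⟩
  | elimTens m n ihm ihn =>
    simp only [inst, elimTens.injEq] at h ⊢; exact ⟨ihm hij h.1, ihn (by omega) h.2⟩
  | elimPlus m n o ihm ihn iho =>
    simp only [inst, elimPlus.injEq] at h ⊢
    exact ⟨ihm hij h.1, ihn (by omega) h.2.1, iho (by omega) h.2.2⟩
  | _ => rfl

end Tm

/-! ### Typing and interpretation on environments -/

/-- A pure proposition read as a mixed one.  The linear structure of the interpretation does not see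
the difference between `⊤` and `0`, or between `&` and `⊕`. -/
def PTy.emb : PTy → MTy
  | top => .zero
  | one => .one
  | lolli P Q => .lolli P.emb Q.emb
  | amp P Q => .oplus P.emb Q.emb
  | tens P Q => .tens P.emb Q.emb

/-- The two interpretations of a pure proposition are isomorphic as vector spaces. -/
def PTy.iso : (P : PTy) → (P.den ≃ₗ[ℂ] P.emb.den)
  | top => (0 : PUnit ≃ₗ[ℂ] Matrix (Fin 0) (Fin 0) ℂ)
  | one => LinearEquiv.refl ℂ ℂ
  | lolli P Q => FHilb.ihomEquiv P.den Q.den ≪≫ₗ LinearEquiv.arrowCongr P.iso Q.iso ≪≫ₗ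
      (FCstar.ihomEquiv P.emb.den Q.emb.den).symm
  | amp P Q => FHilb.sumEquiv P.den Q.den ≪≫ₗ LinearEquiv.prodCongr P.iso Q.iso
  | tens P Q => TensorProduct.congr P.iso Q.iso

theorem PTy.emb_injective : Function.Injective PTy.emb := by
  intro P
  induction P with
  | top => intro Q h; cases Q <;> simp_all [PTy.emb]
  | one => intro Q h; cases Q <;> simp_all [PTy.emb]
  | lolli P P' ih ih' =>
    intro Q h
    cases Q with
    | lolli Q Q' => simp only [PTy.emb, MTy.lolli.injEq] at h; rw [ih h.1, ih' h.2]
    | _ => simp [PTy.emb] at h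
  | amp P P' ih ih' =>
    intro Q h
    cases Q with
    | amp Q Q' => simp only [PTy.emb, MTy.oplus.injEq] at h; rw [ih h.1, ih' h.2]
    | _ => simp [PTy.emb] at h
  | tens P P' ih ih' =>
    intro Q h
    cases Q with
    | tens Q Q' => simp only [PTy.emb, MTy.tens.injEq] at h; rw [ih h.1, ih' h.2]
    | _ => simp [PTy.emb] at h

/-- An environment assigns a vector to each variable at each proposition. -/
abbrev Env : Type := (x : ℕ) → (A : MTy) → A.den

open Classical in
/-- The environment `ρ` with the value of `x` at `A` set to `v`. -/
def Env.upd (ρ : Env) (x : ℕ) (A : MTy) (v : A.den) : Env :=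
  Function.update ρ x (Function.update (ρ x) A v)

theorem Env.upd_self (ρ : Env) (x : ℕ) (A : MTy) (v : A.den) : ρ.upd x A v x A = v := by
  simp [Env.upd]

theorem Env.upd_of_ne (ρ : Env) {x y : ℕ} (h : y ≠ x) (A B : MTy) (v : A.den) :
    ρ.upd x A v y B = ρ y B := by
  simp [Env.upd, h]

/-- Two environments agree on the declarations of `Γ`. -/
def Agree (Γ : MCtx) (ρ ρ' : Env) : Prop := ∀ p ∈ Γ, ρ p.1 p.2 = ρ' p.1 p.2

/-- A function of the environment that depends only on the declarations of `Γ`. -/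
def Supp {α : Type*} (Γ : MCtx) (k : Env → α) : Prop := ∀ ρ ρ', Agree Γ ρ ρ' → k ρ = k ρ'

/-- The two fragments. -/
inductive Mode : Type
  | pure
  | mixed

/-- The propositions that may occur in a fragment. -/
def Mode.Ok : Mode → MTy → Prop
  | pure, A => ∃ P : PTy, P.emb = A
  | mixed, _ => True

/-- The rank-one operator `|v⟩⟨w|`. -/
def ketbra {H : FHilb} (v w : H) : FCstar.ofHilb H :=
  (LinearMap.toSpanSingleton ℂ H v) ∘ₗ (innerSL ℂ w).toLinearMap

/-- `UnTy o A B φ`: the operation `o` leads from `A` to `B` and acts as `φ`. -/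
inductive UnTy : UnOp → (A B : MTy) → (A.den →ₗ[ℂ] B.den) → Prop
  | smul (a : ℂ) (A : MTy) : UnTy (.smul a) A A (a • LinearMap.id)
  | inl (A B : MTy) : UnTy .inl A (.oplus A B) (FCstar.inl A.den B.den)
  | inr (A B : MTy) : UnTy .inr B (.oplus A B) (FCstar.inr A.den B.den)
  | tau (P Q : PTy) : UnTy .tau (.tens (.B P) (.B Q)) (.B (.tens P Q))
      (tauIso P.den Q.den).toLinearMap

/-- `ParTy o A B C φ`: the operation `o` leads from `A` and `B` to `C` and acts as `φ`. -/
inductive ParTy : ParOp → (A B C : MTy) → (FCstar.sum A.den B.den →ₗ[ℂ] C.den) → Prop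
  | add (A : MTy) : ParTy .add A A A (LinearMap.fst ℂ A.den A.den + LinearMap.snd ℂ A.den A.den)
  | pair (A B : MTy) : ParTy .pair A B (.oplus A B) LinearMap.id

/-- `BinTy o A B C φ`: the operation `o` leads from `A` and `B` to `C` and acts as the bilinear map
that `φ` represents. -/
inductive BinTy : BinOp → (A B C : MTy) → (FCstar.tensor A.den B.den →ₗ[ℂ] C.den) → Prop
  | elimOne (A : MTy) : BinTy .elimOne .one A A (TensorProduct.lid ℂ A.den).toLinearMap
  | app (A B : MTy) : BinTy .app (.lolli A B) A B (FCstar.eval A.den B.den)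
  | boxApp (P Q : PTy) : BinTy .app (.B (.lolli P Q)) (.B P) (.B Q)
      (BMap (FHilb.eval P.den Q.den) ∘ₗ (tauIso (.ihom P.den Q.den) P.den).toLinearMap)
  | tens (A B : MTy) : BinTy .tens A B (.tens A B) LinearMap.id

/-- `WithTy i A C φ`: the projection `φ` with index `i` leads from `A` to `C`. -/
inductive WithTy : Bool → (A C : MTy) → (A.den →ₗ[ℂ] C.den) → Prop
  | fst (A B : MTy) : WithTy false (.oplus A B) A (LinearMap.fst ℂ A.den B.den)
  | snd (A B : MTy) : WithTy true (.oplus A B) B (LinearMap.snd ℂ A.den B.den)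

/-- `Sem s Γ m A f`: the term `m` proves `A` in the context `Γ`, and `f` is its interpretation as a
function of environments.  The rules are syntax-directed: exchange is built into the rules that
split the context, and the premises of binding rules are asked for all but finitely many variables.
In such a rule `k ρ` is the interpretation of the body as a function of the bound variable.  The mode
`s` restricts only the propositions of principal premises: the conclusion does not determine them,
and in the pure fragment they have to be pure for a derivation to exist. -/
inductive Sem : Mode → MCtx → Tm → (A : MTy) → (Env → A.den) → Prop
  | ax (s : Mode) (x : ℕ) (A : MTy) : Sem s [(x, A)] (.fvar x) A (fun ρ => ρ x A)
  | topI (s : Mode) (Γ : MCtx) (hd : (domC Γ).Nodup) : Sem s Γ .topI .zero (fun _ => 0)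
  | star (s : Mode) : Sem s [] .star .one (fun _ => (1 : ℂ))
  | un {s Γ m A B f o φ} (ho : UnTy o A B φ) : Sem s Γ m A f →
      Sem s Γ (.un o m) B (fun ρ => φ (f ρ))
  | par {s Γ m n A B C f g o φ} (ho : ParTy o A B C φ) : Sem s Γ m A f → Sem s Γ n B g →
      Sem s Γ (.par o m n) C (fun ρ => φ (f ρ, g ρ))
  | bin {s Γ Δ Ω m n A B C f g o φ} (ho : BinTy o A B C φ) (hA : s.Ok A) (hp : Ω.Perm (Γ ++ Δ))
      (hd : (domC Ω).Nodup) : Sem s Γ m A f → Sem s Δ n B g →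
      Sem s Ω (.bin o m n) C (fun ρ => φ (f ρ ⊗ₜ g ρ))
  | lam {s Γ m A B} (L : Finset ℕ) (k : Env → (A.den →ₗ[ℂ] B.den)) (hk : Supp Γ k)
      (hm : ∀ x ∉ L, Sem s ((x, A) :: Γ) (m.inst 0 (.fvar x)) B (fun ρ => k ρ (ρ x A))) :
      Sem s Γ (.lam m) (.lolli A B) (fun ρ => (FCstar.ihomEquiv A.den B.den).symm (k ρ))
  | elimZero {s Γ Δ Ω m f} (A : MTy) (hp : Ω.Perm (Γ ++ Δ)) (hd : (domC Ω).Nodup) :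
      Sem s Γ m .zero f → Sem s Ω (.elimZero m) A (fun _ => 0)
  | elimWith {s Γ Δ Ω m n A B C f i φ} (L : Finset ℕ) (k : Env → (B.den →ₗ[ℂ] C.den))
      (ho : WithTy i A B φ) (hA : s.Ok A) (hp : Ω.Perm (Γ ++ Δ)) (hd : (domC Ω).Nodup)
      (hk : Supp Δ k) (hm : Sem s Γ m A f)
      (hn : ∀ x ∉ L, Sem s ((x, B) :: Δ) (n.inst 0 (.fvar x)) C (fun ρ => k ρ (ρ x B))) :
      Sem s Ω (.elimWith i m n) C (fun ρ => k ρ (φ (f ρ)))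
  | elimPlus {s Γ Δ Ω m n o A B C} {f : Env → (MTy.oplus A B).den} (L : Finset ℕ)
      (k : Env → (A.den →ₗ[ℂ] C.den)) (l : Env → (B.den →ₗ[ℂ] C.den))
      (hp : Ω.Perm (Γ ++ Δ)) (hd : (domC Ω).Nodup)
      (hk : Supp Δ k) (hl : Supp Δ l) (hm : Sem s Γ m (.oplus A B) f)
      (hn : ∀ x ∉ L, Sem s ((x, A) :: Δ) (n.inst 0 (.fvar x)) C (fun ρ => k ρ (ρ x A)))
      (ho : ∀ x ∉ L, Sem s ((x, B) :: Δ) (o.inst 0 (.fvar x)) C (fun ρ => l ρ (ρ x B))) :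
      Sem s Ω (.elimPlus m n o) C (fun ρ => (k ρ).coprod (l ρ) (f ρ))
  | elimTens {s Γ Δ Ω m n A B C f} (L : Finset ℕ)
      (k : Env → ((MTy.tens A B).den →ₗ[ℂ] C.den)) (hA : s.Ok (.tens A B))
      (hp : Ω.Perm (Γ ++ Δ)) (hd : (domC Ω).Nodup) (hk : Supp Δ k) (hm : Sem s Γ m (.tens A B) f)
      (hn : ∀ x ∉ L, ∀ y ∉ L, x ≠ y → Sem s ((x, A) :: (y, B) :: Δ)
        (n.inst2 (.fvar x) (.fvar y)) C (fun ρ => k ρ (ρ x A ⊗ₜ[ℂ] ρ y B))) :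
      Sem s Ω (.elimTens m n) C (fun ρ => k ρ (f ρ))
  | box {s m} (P : PTy) {f : Env → P.emb.den} : Sem .pure [] m P.emb f →
      Sem s [] (.box m) (.B P) (fun ρ => ketbra (P.iso.symm (f ρ)) (P.iso.symm (f ρ)))

/-! ### Structural properties of derivations -/

theorem mem_domC {T : Type} {Γ : List (ℕ × T)} {x : ℕ} : x ∈ domC Γ ↔ ∃ A, (x, A) ∈ Γ := by
  simp [domC]

theorem domC_append {T : Type} (Γ Δ : List (ℕ × T)) : domC (Γ ++ Δ) = domC Γ ++ domC Δ :=
  List.map_append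

theorem List.Perm.domC {T : Type} {Γ Δ : List (ℕ × T)} (h : Γ.Perm Δ) : (domC Γ).Perm (domC Δ) :=
  h.map _

theorem nodup_split {T : Type} {Ω Γ Δ : List (ℕ × T)} (hp : Ω.Perm (Γ ++ Δ))
    (hd : (domC Ω).Nodup) : (domC Γ).Nodup ∧ (domC Δ).Nodup ∧ (domC Γ).Disjoint (domC Δ) := by
  rw [hp.domC.nodup_iff, domC_append] at hd
  exact ⟨hd.of_append_left, hd.of_append_right, List.disjoint_of_nodup_append hd⟩

theorem mem_split {T : Type} {Ω Γ Δ : List (ℕ × T)} (hp : Ω.Perm (Γ ++ Δ)) {x : ℕ} :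
    x ∈ domC Ω ↔ x ∈ domC Γ ∨ x ∈ domC Δ := by
  rw [hp.domC.mem_iff, domC_append, List.mem_append]

theorem Agree.mono {Γ Δ : MCtx} (h : Γ ⊆ Δ) {ρ ρ' : Env} (ha : Agree Δ ρ ρ') : Agree Γ ρ ρ' :=
  fun p hp => ha p (h hp)

theorem Supp.mono {α : Type*} {Γ Δ : MCtx} (h : Γ ⊆ Δ) {k : Env → α} (hk : Supp Γ k) : Supp Δ k :=
  fun _ _ ha => hk _ _ (ha.mono h)

theorem Agree.upd {Γ : MCtx} {x : ℕ} (hx : x ∉ domC Γ) (ρ : Env) (A : MTy) (v : A.den) :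
    Agree Γ (ρ.upd x A v) ρ := fun p hp =>
  ρ.upd_of_ne (by rintro rfl; exact hx (List.mem_map_of_mem hp)) A p.2 v

theorem Supp.upd {α : Type*} {Γ : MCtx} {k : Env → α} (hk : Supp Γ k) {x : ℕ} (hx : x ∉ domC Γ)
    (ρ : Env) (A : MTy) (v : A.den) : k (ρ.upd x A v) = k ρ :=
  hk _ _ (Agree.upd hx ρ A v)

theorem Agree.cons_upd {Γ : MCtx} {ρ ρ' : Env} (h : Agree Γ ρ ρ') {x : ℕ} (A : MTy) (v : A.den)
    (hx : x ∉ domC Γ) : Agree ((x, A) :: Γ) (ρ.upd x A v) (ρ'.upd x A v) := by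
  intro p hp
  rcases List.mem_cons.1 hp with rfl | hp
  · simp only [Env.upd_self]
  · rw [Agree.upd hx ρ A v p hp, Agree.upd hx ρ' A v p hp, h p hp]

theorem exists_fresh (L : Finset ℕ) (l : List ℕ) : ∃ x, x ∉ L ∧ x ∉ l := by
  obtain ⟨x, hx⟩ := Infinite.exists_notMem_finset (L ∪ l.toFinset)
  simp only [Finset.mem_union, List.mem_toFinset, not_or] at hx
  exact ⟨x, hx⟩

theorem exists_fresh_pair (L : Finset ℕ) (l : List ℕ) :
    ∃ x y, x ∉ L ∧ y ∉ L ∧ x ∉ l ∧ y ∉ l ∧ x ≠ y := by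
  obtain ⟨x, hx, hx'⟩ := exists_fresh L l
  obtain ⟨y, hy, hy'⟩ := exists_fresh L (x :: l)
  simp only [List.mem_cons, not_or] at hy'
  exact ⟨x, y, hx, hy, hx', hy'.2, fun h => hy'.1 h.symm⟩

namespace Sem
variable {s : Mode} {Γ : MCtx} {m : Tm} {A : MTy} {f : Env → A.den}

theorem nodup (h : Sem s Γ m A f) : (domC Γ).Nodup := by
  induction h with
  | ax s x A => simp [domC]
  | topI s Γ hd => exact hd
  | star s => simp [domC]
  | un ho _ ih => exact ih
  | par ho _ _ ih _ => exact ih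
  | bin ho hA hp hd => exact hd
  | lam L k hk hm ih =>
    obtain ⟨x, hx, -⟩ := exists_fresh L []
    exact (List.nodup_cons.1 (ih x hx)).2
  | elimZero A hp hd => exact hd
  | elimWith L k ho hA hp hd => exact hd
  | elimPlus L k l hp hd => exact hd
  | elimTens L k hA hp hd => exact hd
  | box P _ ih => simp [domC]

theorem perm {Γ' : MCtx} (h : Sem s Γ m A f) (hΓ : Γ.Perm Γ') : Sem s Γ' m A f := by
  induction h generalizing Γ' with
  | ax s x A => rw [← List.singleton_perm.1 hΓ]; exact .ax s x A
  | topI s Γ hd => exact .topI s _ (hΓ.domC.nodup_iff.1 hd)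
  | star s => rw [List.nil_perm.1 hΓ]; exact .star s
  | un ho _ ih => exact .un ho (ih hΓ)
  | par ho _ _ ihm ihn => exact .par ho (ihm hΓ) (ihn hΓ)
  | bin ho hA hp hd hm hn => exact .bin ho hA (hΓ.symm.trans hp) (hΓ.domC.nodup_iff.1 hd) hm hn
  | lam L k hk hm ih =>
    exact .lam L k (hk.mono hΓ.subset) fun x hx => ih x hx (hΓ.cons _)
  | elimZero A hp hd hm =>
    exact .elimZero A (hΓ.symm.trans hp) (hΓ.domC.nodup_iff.1 hd) hm
  | elimWith L k ho hA hp hd hk hm hn =>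
    exact .elimWith L k ho hA (hΓ.symm.trans hp) (hΓ.domC.nodup_iff.1 hd) hk hm hn
  | elimPlus L k l hp hd hk hl hm hn ho =>
    exact .elimPlus L k l (hΓ.symm.trans hp) (hΓ.domC.nodup_iff.1 hd) hk hl hm hn ho
  | elimTens L k hA hp hd hk hm hn =>
    exact .elimTens L k hA (hΓ.symm.trans hp) (hΓ.domC.nodup_iff.1 hd) hk hm hn
  | box P hm ih => rw [List.nil_perm.1 hΓ]; exact .box P hm

theorem mem_domC_of_inst {m : Tm} {L : Finset ℕ} {l : List ℕ} {x : ℕ} (hx : x ∈ m.fv)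
    (h : ∀ y ∉ L, x ∈ (m.inst 0 (.fvar y)).fv → x ∈ y :: l) : x ∈ l := by
  obtain ⟨y, hy, hy'⟩ := exists_fresh L [x]
  rcases List.mem_cons.1 (h y hy (Tm.subset_fv_inst _ _ _ hx)) with rfl | h
  · simp at hy'
  · exact h

/-- Free variables are declared. -/
theorem mem_domC_of_mem_fv (h : Sem s Γ m A f) {x : ℕ} (hx : x ∈ m.fv) : x ∈ domC Γ := by
  induction h with
  | ax s y A => simpa [Tm.fv, domC] using hx
  | topI s Γ hd => simp [Tm.fv] at hx
  | star s => simp [Tm.fv] at hx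
  | un ho _ ih => exact ih hx
  | par ho _ _ ihm ihn => exact (Finset.mem_union.1 hx).elim ihm ihn
  | bin ho hA hp hd hm hn ihm ihn =>
    exact (mem_split hp).2 ((Finset.mem_union.1 hx).imp ihm ihn)
  | @lam s Γ m A B L k hk hm ih => exact mem_domC_of_inst (m := m) hx fun y hy h => ih y hy h
  | elimZero A hp hd hm ih => exact (mem_split hp).2 (.inl (ih hx))
  | @elimWith s Γ Δ Ω m n A B C f i φ L k ho hA hp hd hk hm hn ihm ihn =>
    exact (mem_split hp).2 ((Finset.mem_union.1 hx).imp ihm fun hx =>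
      mem_domC_of_inst (m := n) hx fun y hy h => ihn y hy h)
  | @elimPlus s Γ Δ Ω m n o A B C f L k l hp hd hk hl hm hn ho ihm ihn iho =>
    rw [Tm.fv, Finset.union_assoc, Finset.mem_union, Finset.mem_union] at hx
    refine (mem_split hp).2 (hx.imp ihm fun hx => hx.elim (fun hx => ?_) fun hx => ?_)
    · exact mem_domC_of_inst (m := n) hx fun y hy h => ihn y hy h
    · exact mem_domC_of_inst (m := o) hx fun y hy h => iho y hy h
  | elimTens L k hA hp hd hk hm hn ihm ihn =>
    refine (mem_split hp).2 ((Finset.mem_union.1 hx).imp ihm fun hx => ?_)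
    obtain ⟨y, z, hy, hz, hy', hz', hyz⟩ := exists_fresh_pair L [x]
    have h := ihn y hy z hz hyz (Tm.subset_fv_inst _ _ _ (Tm.subset_fv_inst _ _ _ hx))
    simp only [List.mem_singleton] at hy' hz'
    simpa [domC, Ne.symm hy', Ne.symm hz'] using h
  | box P _ ih => simp [Tm.fv] at hx

/-- Typed terms have no dangling bound variables. -/
theorem lc (h : Sem s Γ m A f) : m.LC := by
  induction h with
  | ax | topI | star | box => intro k u; rfl
  | un ho _ ih => intro j u; rw [Tm.inst, ih]
  | par ho _ _ ihm ihn => intro j u; rw [Tm.inst, ihm, ihn]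
  | bin ho hA hp hd hm hn ihm ihn => intro j u; rw [Tm.inst, ihm, ihn]
  | lam L k hk hm ih =>
    intro j u
    obtain ⟨x, hx, -⟩ := exists_fresh L []
    rw [Tm.inst, Tm.inst_of_inst (Nat.zero_ne_add_one j) (ih x hx _ _)]
  | elimZero A hp hd hm ih => intro j u; rw [Tm.inst, ih]
  | elimWith L k ho hA hp hd hk hm hn ihm ihn =>
    intro j u
    obtain ⟨x, hx, -⟩ := exists_fresh L []
    rw [Tm.inst, ihm, Tm.inst_of_inst (Nat.zero_ne_add_one j) (ihn x hx _ _)]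
  | elimPlus L k l hp hd hk hl hm hn ho ihm ihn iho =>
    intro j u
    obtain ⟨x, hx, -⟩ := exists_fresh L []
    rw [Tm.inst, ihm, Tm.inst_of_inst (Nat.zero_ne_add_one j) (ihn x hx _ _),
      Tm.inst_of_inst (Nat.zero_ne_add_one j) (iho x hx _ _)]
  | elimTens L k hA hp hd hk hm hn ihm ihn =>
    intro j u
    obtain ⟨x, y, hx, hy, -, -, hxy⟩ := exists_fresh_pair L []
    rw [Tm.inst, ihm, Tm.inst_of_inst (i := 1) (by omega)
      (Tm.inst_of_inst (i := 0) (by omega) (ihn x hx y hy hxy _ _))]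

/-- The interpretation depends only on the declared variables. -/
theorem supp (h : Sem s Γ m A f) : Supp Γ f := by
  induction h with
  | ax s x A => exact fun ρ ρ' h => h (x, A) (by simp)
  | topI | star | elimZero => exact fun _ _ _ => rfl
  | un ho _ ih => intro ρ ρ' h; beta_reduce; rw [ih ρ ρ' h]
  | par ho _ _ ihm ihn => intro ρ ρ' h; beta_reduce; rw [ihm ρ ρ' h, ihn ρ ρ' h]
  | bin ho hA hp hd hm hn ihm ihn =>
    intro ρ ρ' h
    have h' := h.mono hp.symm.subset
    beta_reduce
    rw [ihm ρ ρ' (h'.mono (List.subset_append_left _ _)),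
      ihn ρ ρ' (h'.mono (List.subset_append_right _ _))]
  | lam L k hk hm ih => intro ρ ρ' h; beta_reduce; rw [hk ρ ρ' h]
  | elimWith L k ho hA hp hd hk hm hn ihm ihn =>
    intro ρ ρ' h
    have h' := h.mono hp.symm.subset
    beta_reduce
    rw [ihm ρ ρ' (h'.mono (List.subset_append_left _ _)),
      hk ρ ρ' (h'.mono (List.subset_append_right _ _))]
  | elimPlus L k l hp hd hk hl hm hn ho ihm ihn iho =>
    intro ρ ρ' h
    have h' := h.mono hp.symm.subset
    beta_reduce
    rw [ihm ρ ρ' (h'.mono (List.subset_append_left _ _)),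
      hk ρ ρ' (h'.mono (List.subset_append_right _ _)),
      hl ρ ρ' (h'.mono (List.subset_append_right _ _))]
  | elimTens L k hA hp hd hk hm hn ihm ihn =>
    intro ρ ρ' h
    have h' := h.mono hp.symm.subset
    beta_reduce
    rw [ihm ρ ρ' (h'.mono (List.subset_append_left _ _)),
      hk ρ ρ' (h'.mono (List.subset_append_right _ _))]
  | box P _ ih => intro ρ ρ' h; beta_reduce; rw [ih ρ ρ' h]

/-- The body of a binder that vanishes on environments vanishes as a linear map. -/
theorem eq_zero_of_bind {Δ : MCtx} {A B : MTy} {k : Env → (A.den →ₗ[ℂ] B.den)} (hk : Supp Δ k)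
    {y : ℕ} (hy : y ∉ domC Δ) (h : ∀ ρ : Env, k ρ (ρ y A) = 0) (ρ : Env) : k ρ = 0 :=
  LinearMap.ext fun v => by
    have := h (ρ.upd y A v)
    rwa [Env.upd_self, hk.upd hy] at this

theorem notMem_fv_inst {m : Tm} {x y : ℕ} (hx : x ∉ m.fv) (hxy : x ≠ y) (k : ℕ) :
    x ∉ (m.inst k (.fvar y)).fv := fun h => by
  have := Tm.fv_inst _ _ _ h
  simp [Tm.fv, hx, hxy] at this

theorem notMem_fv_inst2 {m : Tm} {x y z : ℕ} (hx : x ∉ m.fv) (hxy : x ≠ y) (hxz : x ≠ z) :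
    x ∉ (m.inst2 (.fvar y) (.fvar z)).fv :=
  notMem_fv_inst (notMem_fv_inst hx hxy _) hxz _

/-- A declared variable that is not used has been absorbed by a rule for `⊤` or `0`, so the
interpretation vanishes. -/
theorem eq_zero (h : Sem s Γ m A f) {x : ℕ} (hx : x ∈ domC Γ) (hm : x ∉ m.fv) (ρ : Env) :
    f ρ = 0 := by
  induction h generalizing ρ with
  | ax s y A => simp [Tm.fv, domC] at hx hm; exact absurd hx hm
  | topI | elimZero => rfl
  | star => simp [domC] at hx
  | un ho _ ih => beta_reduce; rw [ih hx hm, map_zero]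
  | par ho _ _ ihm ihn =>
    simp only [Tm.fv, Finset.mem_union, not_or] at hm
    beta_reduce; rw [ihm hx hm.1, ihn hx hm.2]; exact map_zero _
  | bin ho hA hp hd _ _ ihm ihn =>
    simp only [Tm.fv, Finset.mem_union, not_or] at hm
    beta_reduce
    rcases (mem_split hp).1 hx with hx | hx
    · rw [ihm hx hm.1, TensorProduct.zero_tmul, map_zero]
    · rw [ihn hx hm.2, TensorProduct.tmul_zero, map_zero]
  | @lam s Γ m A B L k hk _ ih =>
    obtain ⟨y, hy, hy'⟩ := exists_fresh L (x :: domC Γ)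
    simp only [List.mem_cons, not_or] at hy'
    exact (congrArg (FCstar.ihomEquiv A.den B.den).symm (eq_zero_of_bind hk hy'.2
      (fun ρ => ih y hy (List.mem_cons_of_mem _ hx)
        (notMem_fv_inst (m := m) hm (Ne.symm hy'.1) _) ρ) ρ)).trans (map_zero _)
  | @elimWith s Γ Δ Ω m n A B C f i φ L k ho hA hp hd hk _ _ ihm ihn =>
    simp only [Tm.fv, Finset.mem_union, not_or] at hm
    beta_reduce
    rcases (mem_split hp).1 hx with hx | hx
    · rw [ihm hx hm.1, map_zero, map_zero]
    · obtain ⟨y, hy, hy'⟩ := exists_fresh L (x :: domC Δ)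
      simp only [List.mem_cons, not_or] at hy'
      rw [eq_zero_of_bind hk hy'.2 (fun ρ => ihn y hy (List.mem_cons_of_mem _ hx)
        (notMem_fv_inst hm.2 (Ne.symm hy'.1) _) ρ), LinearMap.zero_apply]
  | @elimPlus s Γ Δ Ω m n o A B C f L k l hp hd hk hl _ _ _ ihm ihn iho =>
    simp only [Tm.fv, Finset.mem_union, not_or] at hm
    beta_reduce
    rcases (mem_split hp).1 hx with hx | hx
    · rw [ihm hx hm.1.1]
      exact map_zero ((k ρ).coprod (l ρ))
    · obtain ⟨y, hy, hy'⟩ := exists_fresh L (x :: domC Δ)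
      simp only [List.mem_cons, not_or] at hy'
      rw [eq_zero_of_bind hk hy'.2 (fun ρ => ihn y hy (List.mem_cons_of_mem _ hx)
        (notMem_fv_inst hm.1.2 (Ne.symm hy'.1) _) ρ),
        eq_zero_of_bind hl hy'.2 (fun ρ => iho y hy (List.mem_cons_of_mem _ hx)
        (notMem_fv_inst hm.2 (Ne.symm hy'.1) _) ρ)]
      exact add_zero (0 : C.den)
  | @elimTens s Γ Δ Ω m n A B C f L k hA hp hd hk _ _ ihm ihn =>
    simp only [Tm.fv, Finset.mem_union, not_or] at hm
    beta_reduce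
    rcases (mem_split hp).1 hx with hx | hx
    · rw [ihm hx hm.1, map_zero]
    · obtain ⟨y, z, hy, hz, hy', hz', hyz⟩ := exists_fresh_pair L (x :: domC Δ)
      simp only [List.mem_cons, not_or] at hy' hz'
      have h0 : k ρ = 0 := TensorProduct.ext' fun v w => by
        have := ihn y hy z hz hyz (List.mem_cons_of_mem _ (List.mem_cons_of_mem _ hx))
          (notMem_fv_inst2 hm.2 (Ne.symm hy'.1) (Ne.symm hz'.1)) ((ρ.upd y A v).upd z B w)
        beta_reduce at this
        rwa [Env.upd_self, Env.upd_of_ne _ hyz, Env.upd_self, hk.upd hz'.2, hk.upd hy'.2] at this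
      rw [h0, LinearMap.zero_apply]
  | box P _ ih => simp [domC] at hx

end Sem

/-! ### Substitution -/

theorem Sem.congr {s : Mode} {Γ : MCtx} {m : Tm} {A : MTy} {f f' : Env → A.den}
    (h : Sem s Γ m A f) (e : ∀ ρ, f ρ = f' ρ) : Sem s Γ m A f' := funext e ▸ h

/-- If a context that contains `a` is split, then `a` lies in one of the parts. -/
theorem split_cons {T : Type} {Ω Γ₁ Γ₂ Γ : List T} {a : T} (hp : Ω.Perm (Γ₁ ++ Γ₂))
    (hΓ : Ω.Perm (a :: Γ)) :
    (∃ Γ', Γ₁.Perm (a :: Γ') ∧ Γ.Perm (Γ' ++ Γ₂)) ∨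
      ∃ Γ', Γ₂.Perm (a :: Γ') ∧ Γ.Perm (Γ₁ ++ Γ') := by
  have ha : a ∈ Γ₁ ++ Γ₂ := hp.subset (hΓ.symm.subset (by simp))
  rcases List.mem_append.1 ha with ha | ha
  · obtain ⟨l, r, rfl⟩ := List.append_of_mem ha
    refine .inl ⟨l ++ r, List.perm_middle, ?_⟩
    refine ((hΓ.symm.trans hp).trans ?_).cons_inv
    exact List.perm_middle.append_right _
  · obtain ⟨l, r, rfl⟩ := List.append_of_mem ha
    refine .inr ⟨l ++ r, List.perm_middle, ?_⟩
    refine ((hΓ.symm.trans hp).trans ?_).cons_inv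
    exact (List.perm_middle.append_left _).trans List.perm_middle

theorem perm_subst_left {T : Type} {Γ Γ₁ Γ₂ Δ : List T} (h : Γ.Perm (Γ₁ ++ Γ₂)) :
    (Γ ++ Δ).Perm (Γ₁ ++ Δ ++ Γ₂) := by
  refine (h.append_right Δ).trans ?_
  rw [List.append_assoc, List.append_assoc]
  exact List.perm_append_comm.append_left _

theorem perm_subst_right {T : Type} {Γ Γ₁ Γ₂ Δ : List T} (h : Γ.Perm (Γ₁ ++ Γ₂)) :
    (Γ ++ Δ).Perm (Γ₁ ++ (Γ₂ ++ Δ)) := by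
  refine (h.append_right Δ).trans ?_
  rw [List.append_assoc]

theorem notMem_right {T : Type} {Ω Γ₁ Γ₂ Γ' : List (ℕ × T)} {x : ℕ} {P : T}
    (hp : Ω.Perm (Γ₁ ++ Γ₂)) (hd : (domC Ω).Nodup) (h : Γ₁.Perm ((x, P) :: Γ')) : x ∉ domC Γ₂ :=
  fun hx => (nodup_split hp hd).2.2 (h.domC.mem_iff.2 (by simp [domC])) hx

theorem notMem_left {T : Type} {Ω Γ₁ Γ₂ Γ' : List (ℕ × T)} {x : ℕ} {P : T}
    (hp : Ω.Perm (Γ₁ ++ Γ₂)) (hd : (domC Ω).Nodup) (h : Γ₂.Perm ((x, P) :: Γ')) : x ∉ domC Γ₁ :=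
  fun hx => (nodup_split hp hd).2.2 hx (h.domC.mem_iff.2 (by simp [domC]))

theorem notMem_of_perm {T : Type} {Ω Γ : List (ℕ × T)} {x : ℕ} {P : T} (hd : (domC Ω).Nodup)
    (h : Ω.Perm ((x, P) :: Γ)) : x ∉ domC Γ :=
  (List.nodup_cons.1 (h.domC.nodup_iff.1 hd)).1

theorem nodup_append {T : Type} {Γ Δ : List (ℕ × T)} (h : (domC Γ).Nodup) (h' : (domC Δ).Nodup)
    (hΓΔ : (domC Γ).Disjoint (domC Δ)) : (domC (Γ ++ Δ)).Nodup := by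
  rw [domC_append]
  exact h.append h' hΓΔ

theorem Supp.subst {α : Type*} {Γx Γ Δ : MCtx} {k : Env → α} {x : ℕ} {P : MTy} {g : Env → P.den}
    (hk : Supp Γx k) (hΓ : Γx.Perm ((x, P) :: Γ)) (hx : x ∉ domC Γ) (hg : Supp Δ g) :
    Supp (Γ ++ Δ) fun ρ => k (ρ.upd x P (g ρ)) := by
  intro ρ ρ' h
  have hΔ : g ρ = g ρ' := hg _ _ (h.mono (List.subset_append_right _ _))
  refine hk _ _ (Agree.mono hΓ.subset ?_)
  rw [hΔ]
  exact Agree.cons_upd (h.mono (List.subset_append_left _ _)) P _ hx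

theorem List.Disjoint.of_perm_left {T : Type} {Γ Γ₁ Γ₂ Δ : List (ℕ × T)}
    (h : (domC Γ).Disjoint (domC Δ)) (hp : Γ.Perm (Γ₁ ++ Γ₂)) : (domC Γ₁).Disjoint (domC Δ) :=
  fun _ hx => h ((mem_split hp).2 (.inl hx))

theorem List.Disjoint.of_perm_right {T : Type} {Γ Γ₁ Γ₂ Δ : List (ℕ × T)}
    (h : (domC Γ).Disjoint (domC Δ)) (hp : Γ.Perm (Γ₁ ++ Γ₂)) : (domC Γ₂).Disjoint (domC Δ) :=
  fun _ hx => h ((mem_split hp).2 (.inr hx))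

namespace Sem
variable {s : Mode}

theorem notMem_fv_of_body {Δ : MCtx} {n : Tm} {B C : MTy} {L : Finset ℕ} {F : ℕ → Env → C.den}
    (hn : ∀ x ∉ L, Sem s ((x, B) :: Δ) (n.inst 0 (.fvar x)) C (F x)) {x : ℕ}
    (hx : x ∉ domC Δ) : x ∉ n.fv := fun h =>
  hx (mem_domC_of_inst h fun y hy hxy => (hn y hy).mem_domC_of_mem_fv hxy)

theorem notMem_fv_of_body2 {Δ : MCtx} {n : Tm} {A B C : MTy} {L : Finset ℕ}
    {F : ℕ → ℕ → Env → C.den}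
    (hn : ∀ x ∉ L, ∀ y ∉ L, x ≠ y → Sem s ((x, A) :: (y, B) :: Δ)
      (n.inst2 (.fvar x) (.fvar y)) C (F x y)) {x : ℕ}
    (hx : x ∉ domC Δ) : x ∉ n.fv := fun h => by
  obtain ⟨y, z, hy, hz, hy', hz', hyz⟩ := exists_fresh_pair L [x]
  have h := (hn y hy z hz hyz).mem_domC_of_mem_fv
    (Tm.subset_fv_inst _ _ _ (Tm.subset_fv_inst _ _ _ h))
  simp only [List.mem_singleton] at hy' hz'
  exact hx (by simpa [domC, Ne.symm hy', Ne.symm hz'] using h)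

theorem inst_fvar_sub_comm {u : Tm} (hu : u.LC) (n : Tm) {x y : ℕ} (h : y ≠ x) (k : ℕ) :
    (n.inst k (.fvar y)).sub x u = (n.sub x u).inst k (.fvar y) := by
  rw [Tm.inst_sub hu, Tm.sub, if_neg h]

/-- Substitution under a binder. -/
theorem subst_body {Δx Δ' Δ : MCtx} {n u : Tm} {x : ℕ} {P B C : MTy} {g : Env → P.den}
    {L : Finset ℕ} {k : Env → (B.den →ₗ[ℂ] C.den)}
    (hu : Sem s Δ u P g) (hΔ : (domC Δ').Disjoint (domC Δ)) (hΔx : Δx.Perm ((x, P) :: Δ'))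
    (ih : ∀ y ∉ L, ∀ Γ, ((y, B) :: Δx).Perm ((x, P) :: Γ) → (domC Γ).Disjoint (domC Δ) →
      Sem s (Γ ++ Δ) ((n.inst 0 (.fvar y)).sub x u) C
        (fun ρ => k (ρ.upd x P (g ρ)) (ρ.upd x P (g ρ) y B))) :
    ∀ y ∉ L ∪ (x :: domC Δ).toFinset, Sem s ((y, B) :: (Δ' ++ Δ)) ((n.sub x u).inst 0 (.fvar y)) C
        (fun ρ => k (ρ.upd x P (g ρ)) (ρ y B)) := by
  intro y hy
  simp only [Finset.mem_union, List.mem_toFinset, List.mem_cons, not_or] at hy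
  have h := ih y hy.1 ((y, B) :: Δ') ((hΔx.cons _).trans (List.Perm.swap _ _ _)) (by
    simp only [domC, List.map_cons, List.disjoint_cons_left]
    exact ⟨hy.2.2, hΔ⟩)
  rw [inst_fvar_sub_comm hu.lc _ hy.2.1] at h
  exact h.congr fun ρ => by rw [Env.upd_of_ne _ hy.2.1]

theorem subst_body2 {Δx Δ' Δ : MCtx} {n u : Tm} {x : ℕ} {P A B C : MTy} {g : Env → P.den}
    {L : Finset ℕ} {k : Env → ((MTy.tens A B).den →ₗ[ℂ] C.den)}
    (hu : Sem s Δ u P g) (hΔ : (domC Δ').Disjoint (domC Δ)) (hΔx : Δx.Perm ((x, P) :: Δ'))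
    (ih : ∀ y ∉ L, ∀ z ∉ L, y ≠ z → ∀ Γ, ((y, A) :: (z, B) :: Δx).Perm ((x, P) :: Γ) →
      (domC Γ).Disjoint (domC Δ) →
      Sem s (Γ ++ Δ) ((n.inst2 (.fvar y) (.fvar z)).sub x u) C
        (fun ρ => k (ρ.upd x P (g ρ)) (ρ.upd x P (g ρ) y A ⊗ₜ[ℂ] ρ.upd x P (g ρ) z B))) :
    ∀ y ∉ L ∪ (x :: domC Δ).toFinset, ∀ z ∉ L ∪ (x :: domC Δ).toFinset, y ≠ z →
      Sem s ((y, A) :: (z, B) :: (Δ' ++ Δ)) ((n.sub x u).inst2 (.fvar y) (.fvar z)) C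
        (fun ρ => k (ρ.upd x P (g ρ)) (ρ y A ⊗ₜ[ℂ] ρ z B)) := by
  intro y hy z hz hyz
  simp only [Finset.mem_union, List.mem_toFinset, List.mem_cons, not_or] at hy hz
  have h := ih y hy.1 z hz.1 hyz ((y, A) :: (z, B) :: Δ')
    ((((hΔx.cons _).trans (List.Perm.swap _ _ _)).cons _).trans (List.Perm.swap _ _ _)) (by
    simp only [domC, List.map_cons, List.disjoint_cons_left]
    exact ⟨hy.2.2, hz.2.2, hΔ⟩)
  rw [Tm.inst2, inst_fvar_sub_comm hu.lc _ hz.2.1, inst_fvar_sub_comm hu.lc _ hy.2.1] at h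
  exact h.congr fun ρ => by rw [Env.upd_of_ne _ hy.2.1, Env.upd_of_ne _ hz.2.1]

/-- Substitution of a typed term for a variable is substitution of its interpretation. -/
theorem subst {Γx Γ Δ : MCtx} {m u : Tm} {A P : MTy} {x : ℕ} {f : Env → A.den} {g : Env → P.den}
    (h : Sem s Γx m A f) (hu : Sem s Δ u P g) (hΓ : Γx.Perm ((x, P) :: Γ))
    (hΔ : (domC Γ).Disjoint (domC Δ)) :
    Sem s (Γ ++ Δ) (m.sub x u) A (fun ρ => f (ρ.upd x P (g ρ))) := by
  induction h generalizing Γ with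
  | ax s y A =>
    obtain ⟨h, rfl⟩ := List.cons.inj (List.singleton_perm.1 hΓ)
    cases h
    rw [Tm.sub, if_pos rfl]
    exact hu.congr fun ρ => (ρ.upd_self x _ _).symm
  | topI s Ω hd =>
    exact .topI s _ (nodup_append (List.nodup_cons.1 (hΓ.domC.nodup_iff.1 hd)).2 hu.nodup hΔ)
  | star s => exact absurd (List.nil_perm.1 hΓ) (by simp)
  | un ho _ ih => exact .un ho (ih hu hΓ hΔ)
  | par ho _ _ ihm ihn => exact .par ho (ihm hu hΓ hΔ) (ihn hu hΓ hΔ)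
  | @bin s Γ₁ Γ₂ Ω m n A B C f f' o φ ho hA hp hd hm hn ihm ihn =>
    have hd' := nodup_append (List.nodup_cons.1 (hΓ.domC.nodup_iff.1 hd)).2 hu.nodup hΔ
    rcases split_cons hp hΓ with ⟨Γ', h, h'⟩ | ⟨Γ', h, h'⟩
    · have hx := notMem_right hp hd h
      rw [Tm.sub, Tm.sub_of_notMem fun h => hx (hn.mem_domC_of_mem_fv h)]
      refine (Sem.bin ho hA (perm_subst_left h') hd' (ihm hu h (hΔ.of_perm_left h')) hn).congr
        fun ρ => ?_
      beta_reduce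
      rw [hn.supp.upd hx]
    · have hx := notMem_left hp hd h
      rw [Tm.sub, Tm.sub_of_notMem fun h => hx (hm.mem_domC_of_mem_fv h)]
      refine (Sem.bin ho hA (perm_subst_right h') hd' hm (ihn hu h (hΔ.of_perm_right h'))).congr
        fun ρ => ?_
      beta_reduce
      rw [hm.supp.upd hx]
  | @lam s Γ₁ m A B L k hk hm ih =>
    refine .lam _ (fun ρ => k (ρ.upd x P (g ρ))) (hk.subst hΓ (notMem_of_perm ?_ hΓ) hu.supp)
      (subst_body hu hΔ hΓ fun y hy Γ => ih y hy hu)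
    exact (Sem.lam L k hk hm).nodup
  | @elimZero s Γ₁ Γ₂ Ω m f A hp hd hm ih =>
    have hd' := nodup_append (List.nodup_cons.1 (hΓ.domC.nodup_iff.1 hd)).2 hu.nodup hΔ
    rcases split_cons hp hΓ with ⟨Γ', h, h'⟩ | ⟨Γ', h, h'⟩
    · exact .elimZero A (perm_subst_left h') hd' (ih hu h (hΔ.of_perm_left h'))
    · have hx := notMem_left hp hd h
      rw [Tm.sub, Tm.sub_of_notMem fun h => hx (hm.mem_domC_of_mem_fv h)]
      exact .elimZero A (perm_subst_right h') hd' hm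
  | @elimWith s Γ₁ Γ₂ Ω m n A B C f i φ L k ho hA hp hd hk hm hn ihm ihn =>
    have hd' := nodup_append (List.nodup_cons.1 (hΓ.domC.nodup_iff.1 hd)).2 hu.nodup hΔ
    rcases split_cons hp hΓ with ⟨Γ', h, h'⟩ | ⟨Γ', h, h'⟩
    · have hx := notMem_right hp hd h
      rw [Tm.sub, Tm.sub_of_notMem (m := n) (notMem_fv_of_body hn hx)]
      refine (Sem.elimWith L k ho hA (perm_subst_left h') hd' hk
        (ihm hu h (hΔ.of_perm_left h')) hn).congr fun ρ => ?_
      beta_reduce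
      rw [hk.upd hx]
    · have hx := notMem_left hp hd h
      rw [Tm.sub, Tm.sub_of_notMem fun h => hx (hm.mem_domC_of_mem_fv h)]
      refine (Sem.elimWith _ (fun ρ => k (ρ.upd x P (g ρ))) ho hA (perm_subst_right h') hd'
        (hk.subst h (notMem_of_perm (nodup_split hp hd).2.1 h) hu.supp) hm
        (subst_body hu (hΔ.of_perm_right h') h fun y hy Γ => ihn y hy hu)).congr fun ρ => ?_
      beta_reduce
      rw [hm.supp.upd hx]
  | @elimPlus s Γ₁ Γ₂ Ω m n o A B C f L k l hp hd hk hl hm hn ho ihm ihn iho =>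
    have hd' := nodup_append (List.nodup_cons.1 (hΓ.domC.nodup_iff.1 hd)).2 hu.nodup hΔ
    rcases split_cons hp hΓ with ⟨Γ', h, h'⟩ | ⟨Γ', h, h'⟩
    · have hx := notMem_right hp hd h
      rw [Tm.sub, Tm.sub_of_notMem (m := n) (notMem_fv_of_body hn hx),
        Tm.sub_of_notMem (m := o) (notMem_fv_of_body ho hx)]
      refine (Sem.elimPlus L k l (perm_subst_left h') hd' hk hl
        (ihm hu h (hΔ.of_perm_left h')) hn ho).congr fun ρ => ?_
      beta_reduce
      rw [hk.upd hx, hl.upd hx]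
    · have hx := notMem_left hp hd h
      have hx' := notMem_of_perm (nodup_split hp hd).2.1 h
      rw [Tm.sub, Tm.sub_of_notMem fun h => hx (hm.mem_domC_of_mem_fv h)]
      refine (Sem.elimPlus _ (fun ρ => k (ρ.upd x P (g ρ))) (fun ρ => l (ρ.upd x P (g ρ)))
        (perm_subst_right h') hd' (hk.subst h hx' hu.supp) (hl.subst h hx' hu.supp) hm
        (subst_body hu (hΔ.of_perm_right h') h fun y hy Γ => ihn y hy hu)
        (subst_body hu (hΔ.of_perm_right h') h fun y hy Γ => iho y hy hu)).congr fun ρ => ?_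
      beta_reduce
      rw [hm.supp.upd hx]
  | @elimTens s Γ₁ Γ₂ Ω m n A B C f L k hA hp hd hk hm hn ihm ihn =>
    have hd' := nodup_append (List.nodup_cons.1 (hΓ.domC.nodup_iff.1 hd)).2 hu.nodup hΔ
    rcases split_cons hp hΓ with ⟨Γ', h, h'⟩ | ⟨Γ', h, h'⟩
    · have hx := notMem_right hp hd h
      rw [Tm.sub, Tm.sub_of_notMem (m := n) (notMem_fv_of_body2 hn hx)]
      refine (Sem.elimTens L k hA (perm_subst_left h') hd' hk
        (ihm hu h (hΔ.of_perm_left h')) hn).congr fun ρ => ?_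
      beta_reduce
      rw [hk.upd hx]
    · have hx := notMem_left hp hd h
      rw [Tm.sub, Tm.sub_of_notMem fun h => hx (hm.mem_domC_of_mem_fv h)]
      refine (Sem.elimTens _ (fun ρ => k (ρ.upd x P (g ρ))) hA (perm_subst_right h') hd'
        (hk.subst h (notMem_of_perm (nodup_split hp hd).2.1 h) hu.supp) hm
        (subst_body2 hu (hΔ.of_perm_right h') h fun y hy z hz hyz Γ => ihn y hy z hz hyz hu)).congr
        fun ρ => ?_
      beta_reduce
      rw [hm.supp.upd hx]
  | box P hm ih => exact absurd (List.nil_perm.1 hΓ) (by simp)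

/-- Substitution for a bound variable, through an instance of the body at a fresh name. -/
theorem subst_inst {Γ Δ Ω : MCtx} {m u : Tm} {A B : MTy} {L : Finset ℕ}
    {k : Env → (A.den →ₗ[ℂ] B.den)} {g : Env → A.den} (hk : Supp Γ k)
    (hm : ∀ x ∉ L, Sem s ((x, A) :: Γ) (m.inst 0 (.fvar x)) B (fun ρ => k ρ (ρ x A)))
    (hu : Sem s Δ u A g) (hΩ : Ω.Perm (Γ ++ Δ)) (hd : (domC Ω).Nodup) :
    Sem s Ω (m.inst 0 u) B (fun ρ => k ρ (g ρ)) := by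
  obtain ⟨x, hx, hx'⟩ := exists_fresh (L ∪ m.fv) (domC Γ)
  simp only [Finset.mem_union, not_or] at hx
  have h := (hm x hx.1).subst hu (List.Perm.refl _) (nodup_split hΩ hd).2.2
  rw [Tm.inst_fvar_sub hx.2] at h
  exact (h.perm hΩ.symm).congr fun ρ => by rw [Env.upd_self, hk.upd hx']

theorem subst_inst2 {Γ Δ Δ' Ω : MCtx} {m u v : Tm} {A B C : MTy} {L : Finset ℕ}
    {k : Env → ((MTy.tens A B).den →ₗ[ℂ] C.den)} {g : Env → A.den} {g' : Env → B.den}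
    (hk : Supp Γ k)
    (hm : ∀ x ∉ L, ∀ y ∉ L, x ≠ y → Sem s ((x, A) :: (y, B) :: Γ)
      (m.inst2 (.fvar x) (.fvar y)) C (fun ρ => k ρ (ρ x A ⊗ₜ[ℂ] ρ y B)))
    (hu : Sem s Δ u A g) (hv : Sem s Δ' v B g') (hΩ : Ω.Perm (Γ ++ (Δ ++ Δ')))
    (hd : (domC Ω).Nodup) :
    Sem s Ω (m.inst2 u v) C (fun ρ => k ρ (g ρ ⊗ₜ[ℂ] g' ρ)) := by
  obtain ⟨x, y, hx, hy, hx', hy', hxy⟩ :=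
    exists_fresh_pair (L ∪ m.fv ∪ u.fv) (domC Γ ++ domC Δ ++ domC Δ')
  simp only [Finset.mem_union, not_or, List.mem_append] at hx hy hx' hy'
  have hd0 := nodup_split hΩ hd
  have hd1 := nodup_split (List.Perm.refl _) hd0.2.1
  have hd2 : ∀ z ∈ domC Γ, z ∉ domC Δ ∧ z ∉ domC Δ' := fun z hz =>
    ⟨fun h => hd0.2.2 hz ((mem_split (List.Perm.refl _)).2 (.inl h)),
      fun h => hd0.2.2 hz ((mem_split (List.Perm.refl _)).2 (.inr h))⟩
  -- the variable at index `0` goes first, so that the instance for index `1` stays in place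
  have h := ((hm x hx.1.1 y hy.1.1 hxy).subst hv (Γ := (x, A) :: Γ) (List.Perm.swap _ _ _) (by
      simp only [domC, List.map_cons, List.disjoint_cons_left]
      exact ⟨hx'.2, fun z hz => (hd2 z hz).2⟩)).subst hu (x := x) (Γ := Γ ++ Δ')
        (List.Perm.refl _) (by
      intro z hz hz'
      rcases (mem_split (List.Perm.refl _)).1 hz with hz | hz
      · exact (hd2 z hz).1 hz'
      · exact hd1.2.2 hz' hz)
  rw [Tm.inst2, Tm.inst_fvar_sub (notMem_fv_inst hy.1.2 (Ne.symm hxy) _), Tm.inst_sub hu.lc,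
    Tm.inst_fvar_sub hx.1.2, Tm.sub_of_notMem fun h => hx'.2 (hv.mem_domC_of_mem_fv h)] at h
  refine (h.perm ?_).congr fun ρ => ?_
  · refine (List.Perm.trans ?_ hΩ.symm)
    rw [List.append_assoc]
    exact List.perm_append_comm.append_left _
  · rw [Env.upd_self, Env.upd_of_ne _ hxy, Env.upd_self, hk.upd hy'.1.1, hk.upd hx'.1.1,
      hv.supp.upd hx'.2]

/-- A premise of a binding rule, from one fresh instance. -/
theorem bind {Γ : MCtx} {m : Tm} {A B : MTy} {x : ℕ} (hx : x ∉ m.fv) {F : Env → B.den}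
    {k : Env → (A.den →ₗ[ℂ] B.den)} (h : Sem s ((x, A) :: Γ) (m.inst 0 (.fvar x)) B F)
    (hk : ∀ ρ v, F (ρ.upd x A v) = k ρ v) :
    Supp Γ k ∧ ∃ L : Finset ℕ,
      ∀ y ∉ L, Sem s ((y, A) :: Γ) (m.inst 0 (.fvar y)) B (fun ρ => k ρ (ρ y A)) := by
  have hd := List.nodup_cons.1 h.nodup
  refine ⟨fun ρ ρ' ha => LinearMap.ext fun v => ?_, (domC Γ).toFinset, fun y hy => ?_⟩
  · rw [← hk, ← hk]
    exact h.supp _ _ (ha.cons_upd A v hd.1)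
  · rw [List.mem_toFinset] at hy
    have h' := h.subst (Sem.ax s y A) (List.Perm.refl _) (by
      intro z hz hz'
      simp only [domC, List.map_cons, List.map_nil, List.mem_singleton] at hz'
      exact hy (hz' ▸ hz))
    rw [Tm.inst_fvar_sub hx] at h'
    exact (h'.perm List.perm_append_comm).congr fun ρ => hk _ _

/-- A premise of a binding rule with two variables, from one fresh instance. -/
theorem bind2 {Γ : MCtx} {m : Tm} {A B C : MTy} {x y : ℕ} (hx : x ∉ m.fv) (hy : y ∉ m.fv)
    {F : Env → C.den} {k : Env → ((MTy.tens A B).den →ₗ[ℂ] C.den)}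
    (h : Sem s ((x, A) :: (y, B) :: Γ) (m.inst2 (.fvar x) (.fvar y)) C F)
    (hk : ∀ ρ v w, F ((ρ.upd y B w).upd x A v) = k ρ (v ⊗ₜ[ℂ] w)) :
    Supp Γ k ∧ ∃ L : Finset ℕ, ∀ x ∉ L, ∀ y ∉ L, x ≠ y → Sem s ((x, A) :: (y, B) :: Γ)
      (m.inst2 (.fvar x) (.fvar y)) C (fun ρ => k ρ (ρ x A ⊗ₜ[ℂ] ρ y B)) := by
  have hd := List.nodup_cons.1 h.nodup
  have hd' := List.nodup_cons.1 hd.2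
  have hxy : y ≠ x := fun e => hd.1 (by simp [e])
  have hxΓ : x ∉ domC Γ := fun e => hd.1 (List.mem_cons_of_mem _ e)
  refine ⟨fun ρ ρ' ha => TensorProduct.ext' fun v w => ?_, (x :: y :: domC Γ).toFinset,
    fun x' hx' y' hy' hxy' => ?_⟩
  · refine (hk ρ v w).symm.trans (Eq.trans ?_ (hk ρ' v w))
    exact h.supp _ _ ((ha.cons_upd B w hd'.1).cons_upd A v hd.1)
  · simp only [List.mem_toFinset, List.mem_cons, not_or] at hx' hy'
    have h' := (h.subst (Sem.ax s x' A) (List.Perm.refl _) (by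
      intro z hz hz'
      simp only [domC, List.map_cons, List.map_nil, List.mem_singleton] at hz'
      subst hz'
      simp only [domC, List.map_cons, List.mem_cons] at hz
      exact hz.elim hx'.2.1 hx'.2.2)).subst (Sem.ax s y' B) (x := y) (Γ := Γ ++ [(x', A)])
      (List.Perm.refl _) (by
      intro z hz hz'
      simp only [domC, List.map_cons, List.map_nil, List.mem_singleton] at hz'
      subst hz'
      simp only [domC, List.map_append, List.mem_append, List.map_cons, List.map_nil,
        List.mem_singleton] at hz
      exact hz.elim hy'.2.2 (Ne.symm hxy'))
    have e : ∀ u k, u ≠ y → ((m.inst 1 (.fvar u)).inst k (.fvar y)).sub y (.fvar y') =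
        (m.inst 1 (.fvar u)).inst k (.fvar y') := fun u k hu =>
      Tm.inst_fvar_sub (notMem_fv_inst hy (Ne.symm hu) _) _ _
    rw [Tm.inst2, inst_fvar_sub_comm (fun _ _ => rfl) _ hxy, Tm.inst_fvar_sub hx,
      e _ _ hx'.2.1] at h'
    refine (h'.perm ?_).congr fun ρ => ?_
    · rw [List.append_assoc]
      exact List.perm_append_comm
    · rw [Env.upd_of_ne _ hx'.2.1, hk]

end Sem

/-! ### Coherence: independence of the derivation -/

namespace FCstar
variable {X X' Y Y' : FCstar}

/-- The relation between linear maps that take related arguments to related results. -/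
def relHom (R : Submodule ℂ (X × X')) (S : Submodule ℂ (Y × Y')) :
    Submodule ℂ (ihom X Y × ihom X' Y') where
  carrier := {p | ∀ a ∈ R, (ihomEquiv X Y p.1 a.1, ihomEquiv X' Y' p.2 a.2) ∈ S}
  add_mem' {p q} hp hq a ha := by
    have := S.add_mem (hp a ha) (hq a ha)
    simpa using this
  zero_mem' a _ := by
    simp only [Prod.fst_zero, Prod.snd_zero, map_zero, LinearMap.zero_apply]
    exact S.zero_mem
  smul_mem' c p hp a ha := by
    have := S.smul_mem c (hp a ha)
    simpa using this

/-- The relation between pairs with related components. -/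
def relSum (R : Submodule ℂ (X × X')) (S : Submodule ℂ (Y × Y')) :
    Submodule ℂ (sum X Y × sum X' Y') where
  carrier := {p | (p.1.1, p.2.1) ∈ R ∧ (p.1.2, p.2.2) ∈ S}
  add_mem' hp hq := ⟨R.add_mem hp.1 hq.1, S.add_mem hp.2 hq.2⟩
  zero_mem' := ⟨R.zero_mem, S.zero_mem⟩
  smul_mem' c _ hp := ⟨R.smul_mem c hp.1, S.smul_mem c hp.2⟩

/-- The relation that is spanned by the tensors of related vectors. -/
def relTens (R : Submodule ℂ (X × X')) (S : Submodule ℂ (Y × Y')) :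
    Submodule ℂ (tensor X Y × tensor X' Y') :=
  Submodule.span ℂ {p | ∃ a ∈ R, ∃ b ∈ S, p = (a.1 ⊗ₜ[ℂ] b.1, a.2 ⊗ₜ[ℂ] b.2)}

theorem tmul_mem_relTens {R : Submodule ℂ (X × X')} {S : Submodule ℂ (Y × Y')} {a : X} {a' : X'}
    {b : Y} {b' : Y'} (ha : (a, a') ∈ R) (hb : (b, b') ∈ S) :
    (a ⊗ₜ[ℂ] b, a' ⊗ₜ[ℂ] b') ∈ relTens R S :=
  Submodule.subset_span ⟨_, ha, _, hb, rfl⟩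

/-- A relation that is equality. -/
def IsDiag (R : Submodule ℂ (X × X)) : Prop := ∀ a b, (a, b) ∈ R ↔ a = b

theorem isDiag_relHom {R : Submodule ℂ (X × X)} {S : Submodule ℂ (Y × Y)} (hR : IsDiag R)
    (hS : IsDiag S) : IsDiag (relHom R S) := by
  intro f g
  constructor
  · intro h
    refine (ihomEquiv X Y).injective (LinearMap.ext fun x => ?_)
    exact (hS _ _).1 (h (x, x) ((hR _ _).2 rfl))
  · rintro rfl ⟨a, b⟩ h
    obtain rfl := (hR _ _).1 h
    exact (hS _ _).2 rfl

theorem isDiag_relSum {R : Submodule ℂ (X × X)} {S : Submodule ℂ (Y × Y)} (hR : IsDiag R)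
    (hS : IsDiag S) : IsDiag (relSum R S) := by
  intro f g
  constructor
  · intro h
    exact Prod.ext ((hR _ _).1 h.1) ((hS _ _).1 h.2)
  · rintro rfl
    exact ⟨(hR _ _).2 rfl, (hS _ _).2 rfl⟩

theorem mem_of_span_le {V W : Type*} [AddCommGroup V] [Module ℂ V] [AddCommGroup W] [Module ℂ W]
    {s : Set V} {T : Submodule ℂ W} (φ : V →ₗ[ℂ] W) (h : ∀ v ∈ s, φ v ∈ T) {v : V}
    (hv : v ∈ Submodule.span ℂ s) : φ v ∈ T :=
  (Submodule.span_le (p := T.comap φ)).2 h hv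

theorem map_mem_of_span {V V' W W' : Type*} [AddCommGroup V] [Module ℂ V] [AddCommGroup W]
    [Module ℂ W] [AddCommGroup V'] [Module ℂ V'] [AddCommGroup W'] [Module ℂ W']
    {s : Set (V × V')} {T : Submodule ℂ (W × W')} (φ : V →ₗ[ℂ] W) (φ' : V' →ₗ[ℂ] W')
    (h : ∀ v ∈ s, (φ v.1, φ' v.2) ∈ T) {v : V} {v' : V'}
    (hv : (v, v') ∈ Submodule.span ℂ s) : (φ v, φ' v') ∈ T :=
  mem_of_span_le (φ.prodMap φ') h hv

theorem map_mem_of_span₂ {V V' U U' W W' : Type*} [AddCommGroup V] [Module ℂ V] [AddCommGroup W]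
    [Module ℂ W] [AddCommGroup V'] [Module ℂ V'] [AddCommGroup W'] [Module ℂ W']
    [AddCommGroup U] [Module ℂ U] [AddCommGroup U'] [Module ℂ U']
    {s : Set (V × V')} {t : Set (U × U')} {T : Submodule ℂ (W × W')} (φ : V →ₗ[ℂ] U →ₗ[ℂ] W)
    (φ' : V' →ₗ[ℂ] U' →ₗ[ℂ] W')
    (h : ∀ v ∈ s, ∀ u ∈ t, (φ v.1 u.1, φ' v.2 u.2) ∈ T) {v : V} {v' : V'} {u : U} {u' : U'}
    (hv : (v, v') ∈ Submodule.span ℂ s) (hu : (u, u') ∈ Submodule.span ℂ t) :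
    (φ v u, φ' v' u') ∈ T :=
  map_mem_of_span (φ v) (φ' v') (fun w hw => map_mem_of_span (φ.flip w.1) (φ'.flip w.2)
    (fun x hx => h x hx w hw) hv) hu

theorem eq_of_mem_span {V : Type*} [AddCommGroup V] [Module ℂ V] {s : Set (V × V)}
    (h : ∀ v ∈ s, v.1 = v.2) {a b : V} (hv : (a, b) ∈ Submodule.span ℂ s) : a = b := by
  have := mem_of_span_le (T := ⊥) (LinearMap.fst ℂ V V - LinearMap.snd ℂ V V)
    (fun v hv => by simp [h v hv]) hv
  simpa [sub_eq_zero] using this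

theorem isDiag_relTens {R : Submodule ℂ (X × X)} {S : Submodule ℂ (Y × Y)} (hR : IsDiag R)
    (hS : IsDiag S) : IsDiag (relTens R S) := by
  intro f g
  constructor
  · refine fun h => eq_of_mem_span ?_ h
    rintro _ ⟨⟨a, a'⟩, ha, ⟨b, b'⟩, hb, rfl⟩
    rw [(hR _ _).1 ha, (hS _ _).1 hb]
  · rintro rfl
    refine TensorProduct.induction_on f ?_ (fun a b => ?_) fun a b ha hb => ?_
    · exact Submodule.zero_mem _
    · exact Submodule.subset_span ⟨(a, a), (hR _ _).2 rfl, (b, b), (hS _ _).2 rfl, rfl⟩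
    · exact Submodule.add_mem _ ha hb

end FCstar

/-- The logical relation between the interpretations of two pure propositions. -/
def relP : (P Q : PTy) → Submodule ℂ (P.emb.den × Q.emb.den)
  | .top, .top => ⊤
  | .one, .one => LinearMap.range ((LinearMap.id (R := ℂ) (M := ℂ)).prod LinearMap.id)
  | .lolli P P', .lolli Q Q' => FCstar.relHom (relP P Q) (relP P' Q')
  | .amp P P', .amp Q Q' => FCstar.relSum (relP P Q) (relP P' Q')
  | .tens P P', .tens Q Q' => FCstar.relTens (relP P Q) (relP P' Q')
  | _, _ => ⊥

/-- The relation between operators that is spanned by the operators `|v⟩⟨w|` for related vectors. -/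
def relB (P Q : PTy) : Submodule ℂ (FCstar.ofHilb P.den × FCstar.ofHilb Q.den) :=
  Submodule.span ℂ {p | ∃ a ∈ relP P Q, ∃ b ∈ relP P Q,
    p = (ketbra (P.iso.symm a.1) (P.iso.symm b.1), ketbra (Q.iso.symm a.2) (Q.iso.symm b.2))}

theorem ketbra_mem_relB {P Q : PTy} {v w : P.emb.den} {v' w' : Q.emb.den}
    (hv : (v, v') ∈ relP P Q) (hw : (w, w') ∈ relP P Q) :
    (ketbra (P.iso.symm v) (P.iso.symm w), ketbra (Q.iso.symm v') (Q.iso.symm w')) ∈ relB P Q :=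
  Submodule.subset_span ⟨_, hv, _, hw, rfl⟩

/-- The logical relation between the interpretations of two propositions.  Only zero is related to
zero if the propositions have different outermost connectives. -/
def rel : (A A' : MTy) → Submodule ℂ (A.den × A'.den)
  | .zero, .zero => ⊤
  | .one, .one => LinearMap.range ((LinearMap.id (R := ℂ) (M := ℂ)).prod LinearMap.id)
  | .lolli A B, .lolli A' B' => FCstar.relHom (rel A A') (rel B B')
  | .oplus A B, .oplus A' B' => FCstar.relSum (rel A A') (rel B B')
  | .tens A B, .tens A' B' => FCstar.relTens (rel A A') (rel B B')
  | .B P, .B Q => relB P Q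
  | _, _ => ⊥

theorem rel_emb (P Q : PTy) : rel P.emb Q.emb = relP P Q := by
  induction P generalizing Q with
  | top => cases Q <;> rfl
  | one => cases Q <;> rfl
  | lolli P P' ih ih' =>
    cases Q with
    | lolli Q Q' => exact congrArg₂ FCstar.relHom (ih Q) (ih' Q')
    | _ => rfl
  | amp P P' ih ih' =>
    cases Q with
    | amp Q Q' => exact congrArg₂ FCstar.relSum (ih Q) (ih' Q')
    | _ => rfl
  | tens P P' ih ih' =>
    cases Q with
    | tens Q Q' => exact congrArg₂ FCstar.relTens (ih Q) (ih' Q')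
    | _ => rfl

theorem isDiag_one : FCstar.IsDiag (X := .unit)
    (LinearMap.range ((LinearMap.id (R := ℂ) (M := ℂ)).prod LinearMap.id)) := by
  intro a b
  constructor
  · rintro ⟨c, hc⟩
    rw [Prod.ext_iff] at hc
    exact hc.1.symm.trans hc.2
  · rintro rfl
    exact ⟨a, rfl⟩

theorem isDiag_zero : FCstar.IsDiag (X := .zero) ⊤ :=
  fun _ _ => ⟨fun _ => Subsingleton.elim _ _, fun _ => trivial⟩

theorem isDiag_relP (P : PTy) : FCstar.IsDiag (relP P P) := by
  induction P with
  | top => exact isDiag_zero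
  | one => exact isDiag_one
  | lolli P P' ih ih' => exact FCstar.isDiag_relHom ih ih'
  | amp P P' ih ih' => exact FCstar.isDiag_relSum ih ih'
  | tens P P' ih ih' => exact FCstar.isDiag_relTens ih ih'

/-- Every operator is a combination of operators `|v⟩⟨w|`. -/
theorem eq_sum_ketbra {H : FHilb} (a : FCstar.ofHilb H) :
    a = ∑ i, ketbra ((show H →ₗ[ℂ] H from a) (stdOrthonormalBasis ℂ H i))
      (stdOrthonormalBasis ℂ H i) := by
  refine LinearMap.ext fun x => ?_
  have e : (show H →ₗ[ℂ] H from ∑ i, ketbra ((show H →ₗ[ℂ] H from a) (stdOrthonormalBasis ℂ H i))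
      (stdOrthonormalBasis ℂ H i)) x = ∑ i, (Inner.inner ℂ (stdOrthonormalBasis ℂ H i) x : ℂ) •
        (show H →ₗ[ℂ] H from a) (stdOrthonormalBasis ℂ H i) := LinearMap.sum_apply _ _ _
  refine Eq.trans ?_ e.symm
  conv_lhs => rw [← (stdOrthonormalBasis ℂ H).sum_repr' x]
  refine (map_sum (show H →ₗ[ℂ] H from a) _ _).trans (Finset.sum_congr rfl fun i _ => ?_)
  exact map_smul (show H →ₗ[ℂ] H from a) _ _

theorem isDiag_relB (P : PTy) : FCstar.IsDiag (relB P P) := by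
  intro a b
  constructor
  · refine fun h => FCstar.eq_of_mem_span ?_ h
    rintro _ ⟨⟨a, a'⟩, ha, ⟨b, b'⟩, hb, rfl⟩
    rw [(isDiag_relP P _ _).1 ha, (isDiag_relP P _ _).1 hb]
  · rintro rfl
    have key : ∀ v w, (ketbra v w, ketbra v w) ∈ relB P P := fun v w =>
      Submodule.subset_span ⟨(P.iso v, P.iso v), (isDiag_relP P _ _).2 rfl,
        (P.iso w, P.iso w), (isDiag_relP P _ _).2 rfl, by simp⟩
    rw [eq_sum_ketbra a]
    generalize (Finset.univ : Finset (Fin (Module.finrank ℂ P.den))) = t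
    classical
    induction t using Finset.induction_on with
    | empty => exact Submodule.zero_mem _
    | insert i t hi ih =>
      rw [Finset.sum_insert hi]
      exact Submodule.add_mem _ (key _ _) ih

theorem isDiag_rel (A : MTy) : FCstar.IsDiag (rel A A) := by
  induction A with
  | zero => exact isDiag_zero
  | one => exact isDiag_one
  | lolli A B ih ih' => exact FCstar.isDiag_relHom ih ih'
  | oplus A B ih ih' => exact FCstar.isDiag_relSum ih ih'
  | tens A B ih ih' => exact FCstar.isDiag_relTens ih ih'
  | B P => exact isDiag_relB P

theorem tauIso_ketbra {H K : FHilb} (v w : H) (v' w' : K) :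
    tauIso H K (ketbra v w ⊗ₜ ketbra v' w') = ketbra (v ⊗ₜ v') (w ⊗ₜ w') := by
  refine TensorProduct.ext' fun x y => ?_
  have e : (ketbra (H := .tensor H K) (v ⊗ₜ v') (w ⊗ₜ w') : H ⊗[ℂ] K →ₗ[ℂ] H ⊗[ℂ] K) (x ⊗ₜ y) =
    (Inner.inner ℂ (w ⊗ₜ[ℂ] w') (x ⊗ₜ[ℂ] y) : ℂ) • (v ⊗ₜ[ℂ] v') := rfl
  have e' : (tauIso H K (ketbra v w ⊗ₜ ketbra v' w') : H ⊗[ℂ] K →ₗ[ℂ] H ⊗[ℂ] K) (x ⊗ₜ y) =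
    (Inner.inner ℂ w x • v) ⊗ₜ[ℂ] (Inner.inner ℂ w' y • v') :=
    LinearMap.congr_fun (tauIso_tmul H K (ketbra v w) (ketbra v' w')) (x ⊗ₜ y)
  refine e'.trans (Eq.trans ?_ e.symm)
  rw [TensorProduct.inner_tmul, TensorProduct.smul_tmul_smul]

theorem BMap_ketbra {H K : FHilb} (f : H →ₗ[ℂ] K) (v w : H) :
    BMap f (ketbra v w) = ketbra (f v) (f w) := by
  refine LinearMap.ext fun x => ?_
  change f ((Inner.inner ℂ w (LinearMap.adjoint f x) : ℂ) • v) = (Inner.inner ℂ (f w) x : ℂ) • f v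
  rw [map_smul, LinearMap.adjoint_inner_right]

theorem tauIso_rel {P P' Q Q' : PTy} {z : FCstar.tensor (.ofHilb P.den) (.ofHilb P'.den)}
    {z' : FCstar.tensor (.ofHilb Q.den) (.ofHilb Q'.den)}
    (h : (z, z') ∈ FCstar.relTens (relB P Q) (relB P' Q')) :
    (tauIso P.den P'.den z, tauIso Q.den Q'.den z') ∈ relB (.tens P P') (.tens Q Q') := by
  refine FCstar.map_mem_of_span (T := relB (.tens P P') (.tens Q Q'))
    (tauIso P.den P'.den).toLinearMap (tauIso Q.den Q'.den).toLinearMap ?_ h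
  rintro _ ⟨⟨a, a'⟩, ha, ⟨b, b'⟩, hb, rfl⟩
  refine FCstar.map_mem_of_span₂
    ((TensorProduct.mk ℂ (FCstar.ofHilb P.den) (FCstar.ofHilb P'.den)).compr₂
      (tauIso P.den P'.den).toLinearMap)
    ((TensorProduct.mk ℂ (FCstar.ofHilb Q.den) (FCstar.ofHilb Q'.den)).compr₂
      (tauIso Q.den Q'.den).toLinearMap) ?_ ha hb
  rintro _ ⟨⟨v, v'⟩, hv, ⟨w, w'⟩, hw, rfl⟩ _ ⟨⟨x, x'⟩, hx, ⟨y, y'⟩, hy, rfl⟩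
  have key := ketbra_mem_relB (P := .tens P P') (Q := .tens Q Q')
    (FCstar.tmul_mem_relTens hv hx) (FCstar.tmul_mem_relTens hw hy)
  refine Eq.mp (congrArg (· ∈ relB (.tens P P') (.tens Q Q')) ?_) key
  exact Prod.ext (tauIso_ketbra _ _ _ _).symm (tauIso_ketbra _ _ _ _).symm

theorem BMap_rel {P P' Q Q' : PTy} {f : P.den →ₗ[ℂ] P'.den} {g : Q.den →ₗ[ℂ] Q'.den}
    (h : ∀ a ∈ relP P Q, (P'.iso (f (P.iso.symm a.1)), Q'.iso (g (Q.iso.symm a.2))) ∈ relP P' Q')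
    {a : FCstar.ofHilb P.den} {a' : FCstar.ofHilb Q.den} (ha : (a, a') ∈ relB P Q) :
    (BMap f a, BMap g a') ∈ relB P' Q' := by
  refine FCstar.map_mem_of_span (BMap f) (BMap g) ?_ ha
  rintro _ ⟨⟨v, v'⟩, hv, ⟨w, w'⟩, hw, rfl⟩
  have key := ketbra_mem_relB (h _ hv) (h _ hw)
  simp only [LinearEquiv.symm_apply_apply] at key
  refine Eq.mp (congrArg (· ∈ relB P' Q') ?_) key
  exact Prod.ext (BMap_ketbra _ _ _).symm (BMap_ketbra _ _ _).symm

/-- The isomorphisms between the two interpretations of pure propositions respect evaluation. -/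
theorem PTy.iso_eval {P Q : PTy} (f : (PTy.lolli P Q).emb.den) (v : P.emb.den) :
    Q.iso (FHilb.eval P.den Q.den ((PTy.lolli P Q).iso.symm f ⊗ₜ P.iso.symm v)) =
      FCstar.ihomEquiv P.emb.den Q.emb.den f v := by
  have e : (PTy.lolli P Q).iso.symm f = (FHilb.ihomEquiv P.den Q.den).symm
      ((LinearEquiv.arrowCongr P.iso Q.iso).symm (FCstar.ihomEquiv P.emb.den Q.emb.den f)) := rfl
  rw [e, FHilb.eval, TensorProduct.lift.tmul]
  refine (congrArg (fun l : P.den →ₗ[ℂ] Q.den => Q.iso (l (P.iso.symm v)))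
    (LinearEquiv.apply_symm_apply (FHilb.ihomEquiv P.den Q.den) _)).trans ?_
  simp [LinearEquiv.arrowCongr_symm_apply]

theorem UnTy.rel {o : UnOp} {A B A' B' : MTy} {φ : A.den →ₗ[ℂ] B.den} {φ' : A'.den →ₗ[ℂ] B'.den}
    (h : UnTy o A B φ) (h' : UnTy o A' B' φ') {a : A.den} {a' : A'.den} (ha : (a, a') ∈ rel A A') :
    (φ a, φ' a') ∈ rel B B' := by
  cases h with
  | smul c => cases h'; exact Submodule.smul_mem _ c ha
  | inl => cases h'; exact ⟨ha, Submodule.zero_mem _⟩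
  | inr => cases h'; exact ⟨Submodule.zero_mem _, ha⟩
  | tau P Q => cases h'; exact tauIso_rel ha

theorem ParTy.rel {o : ParOp} {A B C A' B' C' : MTy} {φ : FCstar.sum A.den B.den →ₗ[ℂ] C.den}
    {φ' : FCstar.sum A'.den B'.den →ₗ[ℂ] C'.den}
    (h : ParTy o A B C φ) (h' : ParTy o A' B' C' φ') {a : A.den} {a' : A'.den} {b : B.den}
    {b' : B'.den} (ha : (a, a') ∈ rel A A') (hb : (b, b') ∈ rel B B') :
    (φ (a, b), φ' (a', b')) ∈ rel C C' := by
  cases h with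
  | add => cases h'; exact Submodule.add_mem _ ha hb
  | pair => cases h'; exact ⟨ha, hb⟩

theorem rel_boxApp {P P' Q Q' : PTy} {a : FCstar.ofHilb (PTy.lolli P P').den}
    {b : FCstar.ofHilb P.den}
    {a' : FCstar.ofHilb (PTy.lolli Q Q').den} {b' : FCstar.ofHilb Q.den}
    (ha : (a, a') ∈ relB (.lolli P P') (.lolli Q Q')) (hb : (b, b') ∈ relB P Q) :
    (BMap (FHilb.eval P.den P'.den) (tauIso (.ihom P.den P'.den) P.den (a ⊗ₜ b)),
      BMap (FHilb.eval Q.den Q'.den) (tauIso (.ihom Q.den Q'.den) Q.den (a' ⊗ₜ b'))) ∈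
      relB P' Q' := by
  refine BMap_rel (P := .tens (.lolli P P') P) (Q := .tens (.lolli Q Q') Q) ?_
    (tauIso_rel (P := .lolli P P') (Q := .lolli Q Q') (P' := P) (Q' := Q)
      (FCstar.tmul_mem_relTens ha hb))
  rintro ⟨a, a'⟩ h
  refine FCstar.map_mem_of_span
    (P'.iso.toLinearMap ∘ₗ FHilb.eval P.den P'.den ∘ₗ
      (PTy.tens (.lolli P P') P).iso.symm.toLinearMap)
    (Q'.iso.toLinearMap ∘ₗ FHilb.eval Q.den Q'.den ∘ₗ
      (PTy.tens (.lolli Q Q') Q).iso.symm.toLinearMap)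
    ?_ h
  rintro _ ⟨f, hf, v, hv, rfl⟩
  have := hf _ hv
  rw [← PTy.iso_eval, ← PTy.iso_eval] at this
  exact this

theorem BinTy.rel {o : BinOp} {A B C A' B' C' : MTy} {φ : FCstar.tensor A.den B.den →ₗ[ℂ] C.den}
    {φ' : FCstar.tensor A'.den B'.den →ₗ[ℂ] C'.den}
    (h : BinTy o A B C φ) (h' : BinTy o A' B' C' φ') {a : A.den} {a' : A'.den} {b : B.den}
    {b' : B'.den} (ha : (a, a') ∈ rel A A') (hb : (b, b') ∈ rel B B') :
    (φ (a ⊗ₜ b), φ' (a' ⊗ₜ b')) ∈ rel C C' := by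
  have h0 : (a, a') ∈ (⊥ : Submodule ℂ (A.den × A'.den)) → (φ (a ⊗ₜ b), φ' (a' ⊗ₜ b')) ∈
      _root_.rel C C' := by
    intro h
    have h1 : a = 0 := congrArg Prod.fst ((Submodule.mem_bot ℂ).1 h)
    have h2 : a' = 0 := congrArg Prod.snd ((Submodule.mem_bot ℂ).1 h)
    rw [h1, h2, TensorProduct.zero_tmul, TensorProduct.zero_tmul, map_zero, map_zero]
    exact Submodule.zero_mem _
  cases h with
  | elimOne =>
    cases h'
    obtain rfl := (isDiag_one _ _).1 ha
    exact Submodule.smul_mem _ a hb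
  | app =>
    cases h' with
    | app => exact ha _ hb
    | boxApp => exact h0 ha
  | boxApp =>
    cases h' with
    | app => exact h0 ha
    | boxApp => exact rel_boxApp ha hb
  | tens =>
    cases h'
    exact FCstar.tmul_mem_relTens ha hb

theorem WithTy.rel {i : Bool} {A C A' C' : MTy} {φ : A.den →ₗ[ℂ] C.den} {φ' : A'.den →ₗ[ℂ] C'.den}
    (h : WithTy i A C φ) (h' : WithTy i A' C' φ') {a : A.den} {a' : A'.den}
    (ha : (a, a') ∈ rel A A') : (φ a, φ' a') ∈ rel C C' := by
  cases h with
  | fst => cases h'; exact ha.1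
  | snd => cases h'; exact ha.2

/-- Environments that take related values at the declarations of a variable. -/
def RelEnv (Γ Γ' : MCtx) (ρ ρ' : Env) : Prop :=
  ∀ x A A', (x, A) ∈ Γ → (x, A') ∈ Γ' → (ρ x A, ρ' x A') ∈ rel A A'

theorem RelEnv.mono {Γ Γ' Δ Δ' : MCtx} {ρ ρ' : Env} (h : RelEnv Γ Γ' ρ ρ') (hΔ : Δ ⊆ Γ)
    (hΔ' : Δ' ⊆ Γ') : RelEnv Δ Δ' ρ ρ' :=
  fun x A A' hA hA' => h x A A' (hΔ hA) (hΔ' hA')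

theorem RelEnv.cons {Γ Γ' : MCtx} {ρ ρ' : Env} (h : RelEnv Γ Γ' ρ ρ') {x : ℕ} {A A' : MTy}
    (hx : x ∉ domC Γ) (hx' : x ∉ domC Γ') {a : A.den} {a' : A'.den} (ha : (a, a') ∈ rel A A') :
    RelEnv ((x, A) :: Γ) ((x, A') :: Γ') (ρ.upd x A a) (ρ'.upd x A' a') := by
  intro y B B' hB hB'
  rcases List.mem_cons.1 hB with e | h1
  · cases e
    rcases List.mem_cons.1 hB' with e | h2
    · cases e
      rwa [Env.upd_self, Env.upd_self]
    · exact absurd (mem_domC.2 ⟨_, h2⟩) hx'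
  · rcases List.mem_cons.1 hB' with e | h2
    · cases e
      exact absurd (mem_domC.2 ⟨_, h1⟩) hx
    · have hy : y ≠ x := by rintro rfl; exact hx (mem_domC.2 ⟨_, h1⟩)
      rw [Env.upd_of_ne _ hy, Env.upd_of_ne _ hy]
      exact h y B B' h1 h2

/-- If all declared variables are used, the free variables of the subterms determine how the context
is split. -/
theorem domC_split {Ω Γ Δ Ω' Γ' Δ' : MCtx} {a b : Finset ℕ} (hp : Ω.Perm (Γ ++ Δ))
    (hd : (domC Ω).Nodup) (hp' : Ω'.Perm (Γ' ++ Δ')) (hd' : (domC Ω').Nodup)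
    (hΩ : ∀ x, x ∈ domC Ω ↔ x ∈ domC Ω') (ha : ∀ x ∈ a, x ∈ domC Γ) (hb : ∀ x ∈ b, x ∈ domC Δ)
    (ha' : ∀ x ∈ a, x ∈ domC Γ') (hb' : ∀ x ∈ b, x ∈ domC Δ') (hu : ∀ x ∈ domC Ω, x ∈ a ∪ b) :
    (∀ x, x ∈ domC Γ ↔ x ∈ domC Γ') ∧ ∀ x, x ∈ domC Δ ↔ x ∈ domC Δ' := by
  have h := (nodup_split hp hd).2.2
  have h' := (nodup_split hp' hd').2.2
  have hu' : ∀ x, x ∈ domC Γ ∨ x ∈ domC Δ → x ∈ a ∨ x ∈ b := fun x hx =>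
    Finset.mem_union.1 (hu x ((mem_split hp).2 hx))
  have hu'' : ∀ x, x ∈ domC Γ' ∨ x ∈ domC Δ' → x ∈ a ∨ x ∈ b := fun x hx =>
    Finset.mem_union.1 (hu x ((hΩ x).2 ((mem_split hp').2 hx)))
  have d : ∀ x, x ∈ domC Γ → x ∉ domC Δ := fun x hx hx' => h hx hx'
  have d' : ∀ x, x ∈ domC Γ' → x ∉ domC Δ' := fun x hx hx' => h' hx hx'
  exact ⟨fun x => by grind, fun x => by grind⟩

namespace Sem

theorem rel_of_unused {s s' : Mode} {Γ Γ' : MCtx} {m : Tm} {A A' : MTy} {f : Env → A.den}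
    {f' : Env → A'.den} (h : Sem s Γ m A f) (h' : Sem s' Γ' m A' f')
    (hΓ : ∀ x, x ∈ domC Γ ↔ x ∈ domC Γ') (hu : ¬ ∀ x ∈ domC Γ, x ∈ m.fv) (ρ ρ' : Env) :
    (f ρ, f' ρ') ∈ _root_.rel A A' := by
  push Not at hu
  obtain ⟨x, hx, hm⟩ := hu
  rw [h.eq_zero hx hm, h'.eq_zero ((hΓ x).1 hx) hm]
  exact Submodule.zero_mem _

theorem mem_domC_of_body {s : Mode} {Δ : MCtx} {n : Tm} {B C : MTy} {L : Finset ℕ}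
    {F : ℕ → Env → C.den}
    (hn : ∀ x ∉ L, Sem s ((x, B) :: Δ) (n.inst 0 (.fvar x)) C (F x)) : ∀ x ∈ n.fv, x ∈ domC Δ :=
  fun _ h => by_contra fun h' => notMem_fv_of_body hn h' h

theorem mem_domC_of_body2 {s : Mode} {Δ : MCtx} {n : Tm} {A B C : MTy} {L : Finset ℕ}
    {F : ℕ → ℕ → Env → C.den}
    (hn : ∀ x ∉ L, ∀ y ∉ L, x ≠ y → Sem s ((x, A) :: (y, B) :: Δ)
      (n.inst2 (.fvar x) (.fvar y)) C (F x y)) : ∀ x ∈ n.fv, x ∈ domC Δ :=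
  fun _ h => by_contra fun h' => notMem_fv_of_body2 hn h' h

/-- The bodies of two binders, as linear maps, take related vectors to related vectors. -/
theorem rel_body {s' : Mode} {Δ Δ' : MCtx} {n : Tm} {B B' C C' : MTy} {L L' : Finset ℕ}
    {k : Env → (B.den →ₗ[ℂ] C.den)} {k' : Env → (B'.den →ₗ[ℂ] C'.den)} (hk : Supp Δ k)
    (hk' : Supp Δ' k')
    (ih : ∀ x ∉ L, ∀ {s' : Mode} {Γ' : MCtx} {A' : MTy} {f' : Env → A'.den},
      Sem s' Γ' (n.inst 0 (.fvar x)) A' f' → (∀ y, y ∈ domC ((x, B) :: Δ) ↔ y ∈ domC Γ') →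
      ∀ {ρ ρ' : Env}, RelEnv ((x, B) :: Δ) Γ' ρ ρ' → (k ρ (ρ x B), f' ρ') ∈ _root_.rel C A')
    (hn : ∀ x ∉ L', Sem s' ((x, B') :: Δ') (n.inst 0 (.fvar x)) C' (fun ρ => k' ρ (ρ x B')))
    (hΔ : ∀ x, x ∈ domC Δ ↔ x ∈ domC Δ') {ρ ρ' : Env} (hρ : RelEnv Δ Δ' ρ ρ') {b : B.den}
    {b' : B'.den} (hb : (b, b') ∈ _root_.rel B B') : (k ρ b, k' ρ' b') ∈ _root_.rel C C' := by
  obtain ⟨x, hx, hx'⟩ := exists_fresh (L ∪ L') (domC Δ)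
  simp only [Finset.mem_union, not_or] at hx
  have hx'' : x ∉ domC Δ' := fun h => hx' ((hΔ x).2 h)
  have := ih x hx.1 (hn x hx.2) (fun y => by
    have := hΔ y
    simp only [domC, List.map_cons, List.mem_cons] at this ⊢
    rw [this]) (hρ.cons hx' hx'' hb)
  rwa [Env.upd_self, Env.upd_self, hk.upd hx', hk'.upd hx''] at this

theorem rel_body2 {s' : Mode} {Δ Δ' : MCtx} {n : Tm} {A A' B B' C C' : MTy} {L L' : Finset ℕ}
    {k : Env → ((MTy.tens A B).den →ₗ[ℂ] C.den)}
    {k' : Env → ((MTy.tens A' B').den →ₗ[ℂ] C'.den)} (hk : Supp Δ k)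
    (hk' : Supp Δ' k')
    (ih : ∀ x ∉ L, ∀ y ∉ L, x ≠ y → ∀ {s' : Mode} {Γ' : MCtx} {A' : MTy} {f' : Env → A'.den},
      Sem s' Γ' (n.inst2 (.fvar x) (.fvar y)) A' f' →
      (∀ z, z ∈ domC ((x, A) :: (y, B) :: Δ) ↔ z ∈ domC Γ') →
      ∀ {ρ ρ' : Env}, RelEnv ((x, A) :: (y, B) :: Δ) Γ' ρ ρ' →
        (k ρ (ρ x A ⊗ₜ[ℂ] ρ y B), f' ρ') ∈ _root_.rel C A')
    (hn : ∀ x ∉ L', ∀ y ∉ L', x ≠ y → Sem s' ((x, A') :: (y, B') :: Δ')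
      (n.inst2 (.fvar x) (.fvar y)) C' (fun ρ => k' ρ (ρ x A' ⊗ₜ[ℂ] ρ y B')))
    (hΔ : ∀ x, x ∈ domC Δ ↔ x ∈ domC Δ') {ρ ρ' : Env} (hρ : RelEnv Δ Δ' ρ ρ')
    {b : (MTy.tens A B).den} {b' : (MTy.tens A' B').den}
    (hb : (b, b') ∈ _root_.rel (.tens A B) (.tens A' B')) :
    (k ρ b, k' ρ' b') ∈ _root_.rel C C' := by
  obtain ⟨x, y, hx, hy, hx', hy', hxy⟩ := exists_fresh_pair (L ∪ L') (domC Δ)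
  simp only [Finset.mem_union, not_or] at hx hy
  have hx'' : x ∉ domC Δ' := fun h => hx' ((hΔ x).2 h)
  have hy'' : y ∉ domC Δ' := fun h => hy' ((hΔ y).2 h)
  refine FCstar.map_mem_of_span (k ρ) (k' ρ') ?_ hb
  rintro _ ⟨⟨v, v'⟩, hv, ⟨w, w'⟩, hw, rfl⟩
  have := ih x hx.1 y hy.1 hxy (hn x hx.2 y hy.2 hxy) (fun z => by
    have := hΔ z
    simp only [domC, List.map_cons, List.mem_cons] at this ⊢
    rw [this]) ((hρ.cons hy' hy'' hw).cons (by simp [domC, hxy, mem_domC.not.1 hx'])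
      (by simp [domC, hxy, mem_domC.not.1 hx'']) hv)
  rwa [Env.upd_self, Env.upd_self, Env.upd_of_ne _ (Ne.symm hxy), Env.upd_of_ne _ (Ne.symm hxy),
    Env.upd_self, Env.upd_self, hk.upd hx', hk'.upd hx'', hk.upd hy', hk'.upd hy''] at this

/-- Interpretations of the same term are related, even for different propositions and for contexts
that declare the same variables with different propositions. -/
theorem rel {s s' : Mode} {Γ Γ' : MCtx} {m : Tm} {A A' : MTy} {f : Env → A.den} {f' : Env → A'.den}
    (h : Sem s Γ m A f) (h' : Sem s' Γ' m A' f') (hΓ : ∀ x, x ∈ domC Γ ↔ x ∈ domC Γ') {ρ ρ' : Env}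
    (hρ : RelEnv Γ Γ' ρ ρ') : (f ρ, f' ρ') ∈ _root_.rel A A' := by
  induction h generalizing s' Γ' A' ρ ρ' with
  | ax s x A =>
    cases h'
    exact hρ x _ _ (by simp) (by simp)
  | topI =>
    cases h'
    exact Submodule.zero_mem _
  | star =>
    cases h'
    exact (isDiag_one _ _).2 rfl
  | un ho _ ih =>
    cases h' with
    | un ho' hm' => exact ho.rel ho' (ih hm' hΓ hρ)
  | par ho _ _ ihm ihn =>
    cases h' with
    | par ho' hm' hn' => exact ho.rel ho' (ihm hm' hΓ hρ) (ihn hn' hΓ hρ)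
  | @bin s Γ₁ Γ₂ Ω m n A B C f g o φ ho hA hp hd hm hn ihm ihn =>
    by_cases hu : ∀ x ∈ domC Ω, x ∈ (Tm.bin o m n).fv
    swap
    · exact rel_of_unused (.bin ho hA hp hd hm hn) h' hΓ hu ρ ρ'
    cases h' with
    | bin ho' hA' hp' hd' hm' hn' =>
      obtain ⟨h1, h2⟩ := domC_split hp hd hp' hd' hΓ (fun _ => hm.mem_domC_of_mem_fv)
        (fun _ => hn.mem_domC_of_mem_fv) (fun _ => hm'.mem_domC_of_mem_fv)
        (fun _ => hn'.mem_domC_of_mem_fv) hu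
      have hρ' := hρ.mono hp.symm.subset hp'.symm.subset
      exact ho.rel ho'
        (ihm hm' h1 (hρ'.mono (List.subset_append_left _ _) (List.subset_append_left _ _)))
        (ihn hn' h2 (hρ'.mono (List.subset_append_right _ _) (List.subset_append_right _ _)))
  | @lam s Γ m A B L k hk hm ih =>
    cases h' with
    | lam L' k' hk' hm' =>
      rintro ⟨a, a'⟩ ha
      have := rel_body hk hk' (fun x hx _ _ _ _ h => ih x hx h) hm' hΓ hρ ha
      simpa using this
  | elimZero =>
    cases h'
    exact Submodule.zero_mem _
  | @elimWith s Γ₁ Γ₂ Ω m n A B C f i φ L k ho hA hp hd hk hm hn ihm ihn =>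
    by_cases hu : ∀ x ∈ domC Ω, x ∈ (Tm.elimWith i m n).fv
    swap
    · exact rel_of_unused (.elimWith L k ho hA hp hd hk hm hn) h' hΓ hu ρ ρ'
    cases h' with
    | elimWith L' k' ho' hA' hp' hd' hk' hm' hn' =>
      obtain ⟨h1, h2⟩ := domC_split hp hd hp' hd' hΓ (fun _ => hm.mem_domC_of_mem_fv)
        (mem_domC_of_body hn) (fun _ => hm'.mem_domC_of_mem_fv) (mem_domC_of_body hn') hu
      have hρ' := hρ.mono hp.symm.subset hp'.symm.subset
      exact rel_body hk hk' (fun x hx _ _ _ _ h => ihn x hx h) hn' h2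
        (hρ'.mono (List.subset_append_right _ _) (List.subset_append_right _ _))
        (ho.rel ho'
          (ihm hm' h1 (hρ'.mono (List.subset_append_left _ _) (List.subset_append_left _ _))))
  | @elimPlus s Γ₁ Γ₂ Ω m n o A B C f L k l hp hd hk hl hm hn ho ihm ihn iho =>
    by_cases hu : ∀ x ∈ domC Ω, x ∈ (Tm.elimPlus m n o).fv
    swap
    · exact rel_of_unused (.elimPlus L k l hp hd hk hl hm hn ho) h' hΓ hu ρ ρ'
    cases h' with
    | elimPlus L' k' l' hp' hd' hk' hl' hm' hn' ho' =>
      obtain ⟨h1, h2⟩ := domC_split (a := m.fv) (b := n.fv ∪ o.fv) hp hd hp' hd' hΓ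
        (fun _ => hm.mem_domC_of_mem_fv)
        (fun x hx => (Finset.mem_union.1 hx).elim (mem_domC_of_body hn x) (mem_domC_of_body ho x))
        (fun _ => hm'.mem_domC_of_mem_fv)
        (fun x hx => (Finset.mem_union.1 hx).elim (mem_domC_of_body hn' x) (mem_domC_of_body ho' x))
        (fun x hx => by rw [← Finset.union_assoc]; exact hu x hx)
      have hρ' := hρ.mono hp.symm.subset hp'.symm.subset
      have hρ2 := hρ'.mono (List.subset_append_right _ _) (List.subset_append_right _ _)
      have hm2 := ihm hm' h1
        (hρ'.mono (List.subset_append_left _ _) (List.subset_append_left _ _))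
      exact Submodule.add_mem _
        (rel_body hk hk' (fun x hx _ _ _ _ h => ihn x hx h) hn' h2 hρ2 hm2.1)
        (rel_body hl hl' (fun x hx _ _ _ _ h => iho x hx h) ho' h2 hρ2 hm2.2)
  | @elimTens s Γ₁ Γ₂ Ω m n A B C f L k hA hp hd hk hm hn ihm ihn =>
    by_cases hu : ∀ x ∈ domC Ω, x ∈ (Tm.elimTens m n).fv
    swap
    · exact rel_of_unused (.elimTens L k hA hp hd hk hm hn) h' hΓ hu ρ ρ'
    cases h' with
    | elimTens L' k' hA' hp' hd' hk' hm' hn' =>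
      obtain ⟨h1, h2⟩ := domC_split hp hd hp' hd' hΓ (fun _ => hm.mem_domC_of_mem_fv)
        (mem_domC_of_body2 hn) (fun _ => hm'.mem_domC_of_mem_fv) (mem_domC_of_body2 hn') hu
      have hρ' := hρ.mono hp.symm.subset hp'.symm.subset
      exact rel_body2 hk hk' (fun x hx y hy hxy _ _ _ _ h => ihn x hx y hy hxy h) hn' h2
        (hρ'.mono (List.subset_append_right _ _) (List.subset_append_right _ _))
        (ihm hm' h1 (hρ'.mono (List.subset_append_left _ _) (List.subset_append_left _ _)))
  | box P hm ih =>
    cases h' with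
    | box P' hm' =>
      have := ih hm' hΓ hρ
      rw [rel_emb] at this
      exact ketbra_mem_relB this this

/-- Coherence: a judgement has only one interpretation. -/
theorem coherent {s s' : Mode} {Γ : MCtx} {m : Tm} {A : MTy} {f f' : Env → A.den}
    (h : Sem s Γ m A f) (h' : Sem s' Γ m A f') : f = f' :=
  funext fun ρ => (isDiag_rel A _ _).1 <| h.rel h' (fun _ => Iff.rfl) fun x B B' hB hB' => by
    obtain rfl : B = B' := by
      have := List.inj_on_of_nodup_map h.nodup hB hB' rfl
      exact congrArg Prod.snd this
    exact (isDiag_rel _ _ _).2 rfl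

end Sem

/-! ### Both fragments as parts of the common syntax -/

/-- Pure terms as terms of the common syntax. -/
def PTm.emb : PTm → Tm
  | bvar k => .bvar k
  | fvar x => .fvar x
  | add m n => .par .add m.emb n.emb
  | smul a m => .un (.smul a) m.emb
  | topI => .topI
  | star => .star
  | elimOne m n => .bin .elimOne m.emb n.emb
  | lam m => .lam m.emb
  | app m n => .bin .app m.emb n.emb
  | pair m n => .par .pair m.emb n.emb
  | elimWith1 m n => .elimWith false m.emb n.emb
  | elimWith2 m n => .elimWith true m.emb n.emb
  | tens m n => .bin .tens m.emb n.emb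
  | elimTens m n => .elimTens m.emb n.emb

/-- Mixed terms as terms of the common syntax. -/
def MTm.emb : MTm → Tm
  | bvar k => .bvar k
  | fvar x => .fvar x
  | add m n => .par .add m.emb n.emb
  | smul p m => .un (.smul ((p : ℝ) : ℂ)) m.emb
  | elimZero m => .elimZero m.emb
  | star => .star
  | elimOne m n => .bin .elimOne m.emb n.emb
  | lam m => .lam m.emb
  | app m n => .bin .app m.emb n.emb
  | inl m => .un .inl m.emb
  | inr m => .un .inr m.emb
  | elimPlus m n o => .elimPlus m.emb n.emb o.emb
  | tens m n => .bin .tens m.emb n.emb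
  | elimTens m n => .elimTens m.emb n.emb
  | B m => .box m.emb
  | tau m => .un .tau m.emb

theorem PTm.emb_inst (m u : PTm) (k : ℕ) : (m.inst k u).emb = m.emb.inst k u.emb := by
  induction m generalizing k with
  | bvar j => simp only [inst, emb, Tm.inst]; split <;> rfl
  | _ => simp_all [inst, emb, Tm.inst]

theorem MTm.emb_inst (m u : MTm) (k : ℕ) : (m.inst k u).emb = m.emb.inst k u.emb := by
  induction m generalizing k with
  | bvar j => simp only [inst, emb, Tm.inst]; split <;> rfl
  | _ => simp_all [inst, emb, Tm.inst]

theorem PTm.emb_inst2 (m u v : PTm) : (m.inst2 u v).emb = m.emb.inst2 u.emb v.emb := by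
  rw [inst2, emb_inst, emb_inst, Tm.inst2]

theorem MTm.emb_inst2 (m u v : MTm) : (m.inst2 u v).emb = m.emb.inst2 u.emb v.emb := by
  rw [inst2, emb_inst, emb_inst, Tm.inst2]

theorem PTm.mem_fv_emb (m : PTm) (x : ℕ) : x ∈ m.emb.fv ↔ x ∈ m.fv := by
  induction m with
  | _ => simp_all [fv, emb, Tm.fv]

theorem MTm.mem_fv_emb (m : MTm) (x : ℕ) : x ∈ m.emb.fv ↔ x ∈ m.fv := by
  induction m with
  | elimPlus m n o ihm ihn iho =>
    simp only [fv, emb, Tm.fv, Finset.mem_union, Set.mem_union, ihm, ihn, iho]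
  | _ => simp_all [fv, emb, Tm.fv]

/-- A pure context read as a mixed one. -/
def PDer.embC (Γ : PCtx) : MCtx := Γ.map fun p => (p.1, p.2.emb)

theorem PDer.domC_embC (Γ : PCtx) : domC (embC Γ) = domC Γ := by
  simp [embC, domC]

theorem PDer.embC_append (Γ Δ : PCtx) : embC (Γ ++ Δ) = embC Γ ++ embC Δ := List.map_append

/-- The pure tensor of the values of an environment at a pure context. -/
def PDer.pt (ρ : Env) : (Γ : PCtx) → PDer.ctx Γ
  | [] => (1 : ℂ)
  | (x, P) :: Γ => P.iso.symm (ρ x P.emb) ⊗ₜ[ℂ] PDer.pt ρ Γ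

/-- The pure tensor of the values of an environment at a mixed context. -/
def MDer.pt (ρ : Env) : (Γ : MCtx) → MDer.ctx Γ
  | [] => (1 : ℂ)
  | (x, A) :: Γ => ρ x A ⊗ₜ[ℂ] MDer.pt ρ Γ

namespace PDer

theorem pt_congr {ρ ρ' : Env} {Γ : PCtx} (h : Agree (embC Γ) ρ ρ') : pt ρ Γ = pt ρ' Γ := by
  induction Γ with
  | nil => rfl
  | cons p Γ ih =>
    have h1 := h (p.1, p.2.emb) (by simp [embC])
    have h2 := ih (h.mono (List.subset_cons_self _ _))
    exact congrArg₂ (fun a b => (PTy.iso p.2).symm a ⊗ₜ[ℂ] b) h1 h2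

theorem pt_upd {Γ : PCtx} {x : ℕ} (hx : x ∉ domC Γ) (ρ : Env) (A : MTy) (v : A.den) :
    pt (ρ.upd x A v) Γ = pt ρ Γ :=
  pt_congr (Agree.upd (by rwa [domC_embC]) ρ A v)

theorem split_pt (ρ : Env) (Γ Δ : PCtx) : split Γ Δ (pt ρ (Γ ++ Δ)) = pt ρ Γ ⊗ₜ pt ρ Δ := by
  induction Γ with
  | nil => exact TensorProduct.lid_symm_apply _
  | cons p Γ ih =>
    refine (congrArg (TensorProduct.assoc ℂ p.2.den (PDer.ctx Γ) (PDer.ctx Δ)).symm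
      (congrArg (fun z => (PTy.iso p.2).symm (ρ p.1 p.2.emb) ⊗ₜ[ℂ] z) ih)).trans ?_
    exact TensorProduct.assoc_symm_tmul _ _ _

theorem snoc_pt (ρ : Env) (Γ : PCtx) (x : ℕ) (P : PTy) :
    snoc Γ x P (pt ρ Γ ⊗ₜ P.iso.symm (ρ x P.emb)) = pt ρ (Γ ++ [(x, P)]) := by
  refine (LinearEquiv.symm_apply_eq (split Γ [(x, P)])).2 ((split_pt ρ Γ [(x, P)]).trans ?_).symm
  rfl

theorem snoc2_pt (ρ : Env) (Γ : PCtx) (x y : ℕ) (P Q : PTy) :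
    snoc2 Γ x y P Q (pt ρ Γ ⊗ₜ (P.iso.symm (ρ x P.emb) ⊗ₜ[ℂ] Q.iso.symm (ρ y Q.emb))) =
      pt ρ (Γ ++ [(x, P), (y, Q)]) := by
  refine (LinearEquiv.symm_apply_eq (split Γ [(x, P), (y, Q)])).2
    ((split_pt ρ Γ [(x, P), (y, Q)]).trans ?_).symm
  rfl

theorem swap_pt (ρ : Env) (x y : ℕ) (P Q : PTy) (Γ Δ : PCtx) :
    swap x y P Q Γ Δ (pt ρ (Δ ++ (x, P) :: (y, Q) :: Γ)) = pt ρ (Δ ++ (y, Q) :: (x, P) :: Γ) := by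
  induction Δ with
  | nil => exact TensorProduct.leftComm_tmul ..
  | cons p Δ ih => exact congrArg (fun z => (PTy.iso p.2).symm (ρ p.1 p.2.emb) ⊗ₜ[ℂ] z) ih

/-- Pure tensors span.  As the variables are distinct, an environment can give them any values. -/
theorem ext_pt {Γ : PCtx} (hΓ : (domC Γ).Nodup) {V : Type*} [AddCommGroup V] [Module ℂ V]
    {f g : PDer.ctx Γ →ₗ[ℂ] V} (h : ∀ ρ, f (pt ρ Γ) = g (pt ρ Γ)) : f = g := by
  induction Γ with
  | nil => exact LinearMap.ext_ring (h fun _ _ => 0)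
  | cons p Γ ih =>
    obtain ⟨x, P⟩ := p
    obtain ⟨hx, hΓ⟩ := List.nodup_cons.1 hΓ
    refine TensorProduct.ext (LinearMap.ext fun v => ih hΓ fun ρ => ?_)
    have := h (ρ.upd x P.emb (P.iso v))
    simp only [pt, Env.upd_self, pt_upd hx, LinearEquiv.symm_apply_apply] at this
    exact this

end PDer

namespace MDer

theorem pt_congr {ρ ρ' : Env} {Γ : MCtx} (h : Agree Γ ρ ρ') : pt ρ Γ = pt ρ' Γ := by
  induction Γ with
  | nil => rfl
  | cons p Γ ih =>
    have h1 := h p (by simp)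
    have h2 := ih (h.mono (List.subset_cons_self _ _))
    exact congrArg₂ (fun a b => a ⊗ₜ[ℂ] b) h1 h2

theorem pt_upd {Γ : MCtx} {x : ℕ} (hx : x ∉ domC Γ) (ρ : Env) (A : MTy) (v : A.den) :
    pt (ρ.upd x A v) Γ = pt ρ Γ :=
  pt_congr (Agree.upd hx ρ A v)

theorem split_pt (ρ : Env) (Γ Δ : MCtx) : split Γ Δ (pt ρ (Γ ++ Δ)) = pt ρ Γ ⊗ₜ pt ρ Δ := by
  induction Γ with
  | nil => exact TensorProduct.lid_symm_apply _
  | cons p Γ ih =>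
    refine (congrArg (TensorProduct.assoc ℂ p.2.den (MDer.ctx Γ) (MDer.ctx Δ)).symm
      (congrArg (fun z => ρ p.1 p.2 ⊗ₜ[ℂ] z) ih)).trans ?_
    exact TensorProduct.assoc_symm_tmul _ _ _

theorem snoc_pt (ρ : Env) (Γ : MCtx) (x : ℕ) (A : MTy) :
    snoc Γ x A (pt ρ Γ ⊗ₜ ρ x A) = pt ρ (Γ ++ [(x, A)]) := by
  refine (LinearEquiv.symm_apply_eq (split Γ [(x, A)])).2 ((split_pt ρ Γ [(x, A)]).trans ?_).symm
  rfl

theorem snoc2_pt (ρ : Env) (Γ : MCtx) (x y : ℕ) (A B : MTy) :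
    snoc2 Γ x y A B (pt ρ Γ ⊗ₜ (ρ x A ⊗ₜ[ℂ] ρ y B)) = pt ρ (Γ ++ [(x, A), (y, B)]) := by
  refine (LinearEquiv.symm_apply_eq (split Γ [(x, A), (y, B)])).2
    ((split_pt ρ Γ [(x, A), (y, B)]).trans ?_).symm
  rfl

theorem swap_pt (ρ : Env) (x y : ℕ) (A B : MTy) (Γ Δ : MCtx) :
    swap x y A B Γ Δ (pt ρ (Δ ++ (x, A) :: (y, B) :: Γ)) = pt ρ (Δ ++ (y, B) :: (x, A) :: Γ) := by
  induction Δ with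
  | nil => exact TensorProduct.leftComm_tmul ..
  | cons p Δ ih => exact congrArg (fun z => ρ p.1 p.2 ⊗ₜ[ℂ] z) ih

/-- Pure tensors span.  As the variables are distinct, an environment can give them any values. -/
theorem ext_pt {Γ : MCtx} (hΓ : (domC Γ).Nodup) {V : Type*} [AddCommGroup V] [Module ℂ V]
    {f g : MDer.ctx Γ →ₗ[ℂ] V} (h : ∀ ρ, f (pt ρ Γ) = g (pt ρ Γ)) : f = g := by
  induction Γ with
  | nil => exact LinearMap.ext_ring (h fun _ _ => 0)
  | cons p Γ ih =>
    obtain ⟨x, A⟩ := p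
    obtain ⟨hx, hΓ⟩ := List.nodup_cons.1 hΓ
    refine TensorProduct.ext (LinearMap.ext fun v => ih hΓ fun ρ => ?_)
    have := h (ρ.upd x A v)
    simp only [pt, Env.upd_self, pt_upd hx] at this
    exact this

end MDer

/-! ### Interpretations of pure derivations -/

theorem notMem_embC {Γ : PCtx} {x : ℕ} {P : PTy} {s : Mode} {m : Tm} {A : MTy} {f : Env → A.den}
    (h : Sem s (PDer.embC (Γ ++ [(x, P)])) m A f) : x ∉ domC Γ := by
  have := h.nodup
  rw [PDer.domC_embC, domC_append] at this
  exact fun hx => List.disjoint_of_nodup_append this hx (by simp [domC])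

namespace PDer

theorem map_split (ρ : Env) {Γ Δ : PCtx} {X Y : FHilb} (f : PDer.ctx Γ →ₗ[ℂ] X)
    (g : PDer.ctx Δ →ₗ[ℂ] Y) :
    FHilb.map f g (split Γ Δ (pt ρ (Γ ++ Δ))) = f (pt ρ Γ) ⊗ₜ g (pt ρ Δ) := by
  rw [split_pt]; rfl

/-- The interpretation of the body of a binder, as a linear map of the bound variable. -/
def body {Γ : PCtx} {x : ℕ} {P R : PTy} (F : PDer.ctx (Γ ++ [(x, P)]) →ₗ[ℂ] R.den) (ρ : Env) :
    P.emb.den →ₗ[ℂ] R.emb.den :=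
  R.iso.toLinearMap ∘ₗ F ∘ₗ (snoc Γ x P).toLinearMap ∘ₗ
    TensorProduct.mk ℂ (PDer.ctx Γ) P.den (pt ρ Γ) ∘ₗ P.iso.symm.toLinearMap

theorem body_bind {Γ : PCtx} {x : ℕ} {P R : PTy} {m : PTm} (hx : x ∉ m.fv)
    {F : PDer.ctx (Γ ++ [(x, P)]) →ₗ[ℂ] R.den}
    (h : Sem .pure (embC (Γ ++ [(x, P)])) (m.inst 0 (.fvar x)).emb R.emb
      (fun ρ => R.iso (F (pt ρ (Γ ++ [(x, P)]))))) :
    Supp (embC Γ) (body F) ∧ ∃ L : Finset ℕ, ∀ y ∉ L, Sem .pure ((y, P.emb) :: embC Γ)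
      (m.emb.inst 0 (.fvar y)) R.emb (fun ρ => body F ρ (ρ y P.emb)) := by
  have hx' := notMem_embC h
  rw [PTm.emb_inst, embC_append] at h
  refine Sem.bind (fun h => hx ((m.mem_fv_emb x).1 h)) (h.perm List.perm_append_comm) fun ρ v => ?_
  have := snoc_pt (ρ.upd x P.emb v) Γ x P
  rw [Env.upd_self, pt_upd hx'] at this
  exact congrArg (fun z => R.iso (F z)) this.symm

/-- The interpretation of the body of a binder with two variables, as a linear map of the tensor
product of the two. -/
def body2 {Γ : PCtx} {x y : ℕ} {P Q R : PTy} (F : PDer.ctx (Γ ++ [(x, P), (y, Q)]) →ₗ[ℂ] R.den)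
    (ρ : Env) : (PTy.tens P Q).emb.den →ₗ[ℂ] R.emb.den :=
  R.iso.toLinearMap ∘ₗ F ∘ₗ (snoc2 Γ x y P Q).toLinearMap ∘ₗ
    TensorProduct.mk ℂ (PDer.ctx Γ) (PTy.tens P Q).den (pt ρ Γ) ∘ₗ
    (PTy.tens P Q).iso.symm.toLinearMap

theorem body2_bind {Γ : PCtx} {x y : ℕ} {P Q R : PTy} {m : PTm} (hx : x ∉ m.fv) (hy : y ∉ m.fv)
    {F : PDer.ctx (Γ ++ [(x, P), (y, Q)]) →ₗ[ℂ] R.den}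
    (h : Sem .pure (embC (Γ ++ [(x, P), (y, Q)])) (m.inst2 (.fvar x) (.fvar y)).emb R.emb
      (fun ρ => R.iso (F (pt ρ (Γ ++ [(x, P), (y, Q)]))))) :
    Supp (embC Γ) (body2 F) ∧ ∃ L : Finset ℕ, ∀ x ∉ L, ∀ y ∉ L, x ≠ y →
      Sem .pure ((x, P.emb) :: (y, Q.emb) :: embC Γ) (m.emb.inst2 (.fvar x) (.fvar y)) R.emb
        (fun ρ => body2 F ρ (ρ x P.emb ⊗ₜ[ℂ] ρ y Q.emb)) := by
  have hd := h.nodup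
  rw [domC_embC, domC_append] at hd
  have hd' := List.disjoint_of_nodup_append hd
  have hx' : x ∉ domC Γ := fun h => hd' h (by simp [domC])
  have hy' : y ∉ domC Γ := fun h => hd' h (by simp [domC])
  have hxy : y ≠ x := fun e => by
    have := hd.of_append_right
    simp [domC, e] at this
  rw [PTm.emb_inst2, embC_append] at h
  refine Sem.bind2 (fun h => hx ((m.mem_fv_emb x).1 h)) (fun h => hy ((m.mem_fv_emb y).1 h))
    (h.perm List.perm_append_comm) fun ρ v w => ?_
  have := snoc2_pt ((ρ.upd y Q.emb w).upd x P.emb v) Γ x y P Q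
  rw [Env.upd_self, Env.upd_of_ne _ hxy, Env.upd_self, pt_upd hx', pt_upd hy'] at this
  exact congrArg (fun z => R.iso (F z)) this.symm

theorem embC_perm (Γ Δ : PCtx) : (embC (Γ ++ Δ)).Perm (embC Γ ++ embC Δ) := by
  rw [embC_append]

theorem nodup {Γ : PCtx} {m : PTm} {P : PTy} (D : PDer Γ m P) : (domC Γ).Nodup := by
  induction D with
  | ax => simp [domC]
  | topI Γ h => exact h
  | oneI => simp [domC]
  | sum _ _ ih => exact ih
  | prod _ _ ih => exact ih
  | withI _ _ ih => exact ih
  | oneE h _ _ ih ih' => exact nodup_append ih ih' h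
  | lolliI x hx _ ih => rw [domC_append] at ih; exact ih.of_append_left
  | lolliE h _ _ ih ih' => exact nodup_append ih ih' h
  | withE1 x h hx _ _ ih ih' => rw [domC_append] at ih'; exact nodup_append ih ih'.of_append_left h
  | withE2 x h hx _ _ ih ih' => rw [domC_append] at ih'; exact nodup_append ih ih'.of_append_left h
  | tensI h _ _ ih ih' => exact nodup_append ih ih' h
  | tensE x y h hx hy _ _ ih ih' =>
    rw [domC_append] at ih'; exact nodup_append ih ih'.of_append_left h
  | ex _ ih =>
    exact (((List.Perm.swap _ _ _).append_left _).domC.nodup_iff).1 ih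

/-- The interpretation of a derivation on pure tensors. -/
theorem sem {Γ : PCtx} {m : PTm} {P : PTy} (D : PDer Γ m P) :
    Sem .pure (embC Γ) m.emb P.emb (fun ρ => P.iso (D.den (pt ρ Γ))) := by
  have hn := D.nodup
  rw [← domC_embC] at hn
  induction D with
  | ax x P =>
    refine (Sem.ax .pure x P.emb).congr fun ρ => ?_
    refine (congrArg P.iso ((TensorProduct.rid_tmul (R := ℂ) _ _).trans (one_smul ℂ _)) |>.trans
      ?_).symm
    exact P.iso.apply_symm_apply _
  | sum D E ihD ihE =>
    exact (Sem.par (.add _) (ihD hn) (ihE hn)).congr fun ρ => (map_add (PTy.iso _) _ _).symm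
  | prod a D ih =>
    exact (Sem.un (.smul a _) (ih hn)).congr fun ρ => (map_smul (PTy.iso _) _ _).symm
  | topI Γ h => exact (Sem.topI _ _ hn).congr fun ρ => (map_zero PTy.top.iso).symm
  | oneI => exact (Sem.star _)
  | @oneE Γ Δ m n P h D E ihD ihE =>
    refine (Sem.bin (.elimOne _) (show Mode.pure.Ok .one from ⟨.one, rfl⟩) (embC_perm _ _) hn
      (ihD (by rw [domC_embC]; exact D.nodup))
      (ihE (by rw [domC_embC]; exact E.nodup))).congr fun ρ => ?_
    exact ((congrArg (fun z => P.iso (TensorProduct.lid ℂ P.den z)) (map_split ρ D.den E.den)).trans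
      (map_smul P.iso _ _)).symm
  | @lolliI Γ m P Q x hx D ih =>
    obtain ⟨hk, L, hL⟩ := body_bind hx (ih (by rw [domC_embC]; exact D.nodup))
    refine (Sem.lam L _ hk hL).congr fun ρ => ?_
    refine congrArg (FCstar.ihomEquiv P.emb.den Q.emb.den).symm (LinearMap.ext fun v => ?_)
    refine Eq.symm (congrArg (fun l : P.den →ₗ[ℂ] Q.den => Q.iso (l (P.iso.symm v)))
      (LinearEquiv.apply_symm_apply (FHilb.ihomEquiv P.den Q.den) _))
  | @lolliE Γ Δ m n P Q h D E ihD ihE =>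
    refine (Sem.bin (.app _ _) (show Mode.pure.Ok _ from ⟨.lolli P Q, rfl⟩) (embC_perm _ _) hn
      (ihD (by rw [domC_embC]; exact D.nodup))
      (ihE (by rw [domC_embC]; exact E.nodup))).congr fun ρ => ?_
    refine (PTy.iso_eval _ _).symm.trans ?_
    rw [LinearEquiv.symm_apply_apply, LinearEquiv.symm_apply_apply]
    exact (congrArg (fun z => Q.iso (FHilb.eval P.den Q.den z)) (map_split ρ D.den E.den)).symm
  | @withI Γ m n P Q D E ihD ihE => exact (Sem.par (.pair _ _) (ihD hn) (ihE hn))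
  | @withE1 Γ Δ m n P Q R x h hx D E ihD ihE =>
    obtain ⟨hk, L, hL⟩ := body_bind hx (ihE (by rw [domC_embC]; exact E.nodup))
    refine (Sem.elimWith L _ (.fst _ _) (show Mode.pure.Ok _ from ⟨.amp P Q, rfl⟩) (embC_perm _ _)
      hn
      hk (ihD (by rw [domC_embC]; exact D.nodup)) hL).congr fun ρ => ?_
    refine Eq.trans ?_ (congrArg (fun z => R.iso (E.den (snoc Δ x P (FHilb.symm P.den _ z))))
      (map_split ρ (FHilb.fst P.den Q.den ∘ₗ D.den) LinearMap.id)).symm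
    refine congrArg (fun z => R.iso (E.den (snoc Δ x P (pt ρ Δ ⊗ₜ z)))) ?_
    exact P.iso.symm_apply_apply _
  | @withE2 Γ Δ m n P Q R x h hx D E ihD ihE =>
    obtain ⟨hk, L, hL⟩ := body_bind hx (ihE (by rw [domC_embC]; exact E.nodup))
    refine (Sem.elimWith L _ (.snd _ _) (show Mode.pure.Ok _ from ⟨.amp P Q, rfl⟩) (embC_perm _ _)
      hn
      hk (ihD (by rw [domC_embC]; exact D.nodup)) hL).congr fun ρ => ?_
    refine Eq.trans ?_ (congrArg (fun z => R.iso (E.den (snoc Δ x Q (FHilb.symm Q.den _ z))))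
      (map_split ρ (FHilb.snd P.den Q.den ∘ₗ D.den) LinearMap.id)).symm
    refine congrArg (fun z => R.iso (E.den (snoc Δ x Q (pt ρ Δ ⊗ₜ z)))) ?_
    exact Q.iso.symm_apply_apply _
  | @tensI Δ Γ m n P Q h D E ihD ihE =>
    refine (Sem.bin (.tens _ _) (show Mode.pure.Ok _ from ⟨P, rfl⟩) (embC_perm _ _) hn
      (ihD (by rw [domC_embC]; exact D.nodup))
      (ihE (by rw [domC_embC]; exact E.nodup))).congr fun ρ => ?_
    exact (congrArg (PTy.tens P Q).iso (map_split ρ D.den E.den)).symm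
  | @tensE Δ Γ m n P Q R x y h hx hy D E ihD ihE =>
    obtain ⟨hk, L, hL⟩ := body2_bind hx hy (ihE (by rw [domC_embC]; exact E.nodup))
    refine (Sem.elimTens L _ (show Mode.pure.Ok _ from ⟨.tens P Q, rfl⟩) (embC_perm _ _) hn
      hk (ihD (by rw [domC_embC]; exact D.nodup)) hL).congr fun ρ => ?_
    refine Eq.trans ?_ (congrArg (fun z => R.iso (E.den (snoc2 Γ x y P Q
      (FHilb.symm (.tensor P.den Q.den) _ z)))) (map_split ρ D.den LinearMap.id)).symm
    refine congrArg (fun z => R.iso (E.den (snoc2 Γ x y P Q (pt ρ Γ ⊗ₜ z)))) ?_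
    exact (PTy.tens P Q).iso.symm_apply_apply _
  | @ex Δ Γ m P Q R x y D ih =>
    refine ((ih (by rw [domC_embC]; exact D.nodup)).perm
      (((List.Perm.swap _ _ _).append_left _).map _)).congr fun ρ => ?_
    exact congrArg (fun z => R.iso (D.den z)) (swap_pt ρ x y Q P Γ Δ).symm

end PDer

/-! ### Interpretations of mixed derivations -/

namespace MDer

theorem map_split (ρ : Env) {Γ Δ : MCtx} {X Y : FCstar} (f : MDer.ctx Γ →ₗ[ℂ] X)
    (g : MDer.ctx Δ →ₗ[ℂ] Y) :
    FCstar.map f g (split Γ Δ (pt ρ (Γ ++ Δ))) = f (pt ρ Γ) ⊗ₜ g (pt ρ Δ) := by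
  rw [split_pt]; rfl

/-- The interpretation of the body of a binder, as a linear map of the bound variable. -/
def body {Γ : MCtx} {x : ℕ} {A C : MTy} (F : MDer.ctx (Γ ++ [(x, A)]) →ₗ[ℂ] C.den) (ρ : Env) :
    A.den →ₗ[ℂ] C.den :=
  F ∘ₗ (snoc Γ x A).toLinearMap ∘ₗ TensorProduct.mk ℂ (MDer.ctx Γ) A.den (pt ρ Γ)

theorem body_bind {Γ : MCtx} {x : ℕ} {A C : MTy} {m : MTm} (hx : x ∉ m.fv)
    {F : MDer.ctx (Γ ++ [(x, A)]) →ₗ[ℂ] C.den}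
    (h : Sem .mixed (Γ ++ [(x, A)]) (m.inst 0 (.fvar x)).emb C
      (fun ρ => F (pt ρ (Γ ++ [(x, A)])))) :
    Supp Γ (body F) ∧ ∃ L : Finset ℕ, ∀ y ∉ L, Sem .mixed ((y, A) :: Γ)
      (m.emb.inst 0 (.fvar y)) C (fun ρ => body F ρ (ρ y A)) := by
  have hd := h.nodup
  rw [domC_append] at hd
  have hx' : x ∉ domC Γ := fun h => List.disjoint_of_nodup_append hd h (by simp [domC])
  rw [MTm.emb_inst] at h
  refine Sem.bind (fun h => hx ((m.mem_fv_emb x).1 h)) (h.perm List.perm_append_comm) fun ρ v => ?_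
  have := snoc_pt (ρ.upd x A v) Γ x A
  rw [Env.upd_self, pt_upd hx'] at this
  exact congrArg F this.symm

/-- The interpretation of the body of a binder with two variables, as a linear map of the tensor
product of the two. -/
def body2 {Γ : MCtx} {x y : ℕ} {A B C : MTy} (F : MDer.ctx (Γ ++ [(x, A), (y, B)]) →ₗ[ℂ] C.den)
    (ρ : Env) : (MTy.tens A B).den →ₗ[ℂ] C.den :=
  F ∘ₗ (snoc2 Γ x y A B).toLinearMap ∘ₗ
    TensorProduct.mk ℂ (MDer.ctx Γ) (MTy.tens A B).den (pt ρ Γ)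

theorem body2_bind {Γ : MCtx} {x y : ℕ} {A B C : MTy} {m : MTm} (hx : x ∉ m.fv) (hy : y ∉ m.fv)
    {F : MDer.ctx (Γ ++ [(x, A), (y, B)]) →ₗ[ℂ] C.den}
    (h : Sem .mixed (Γ ++ [(x, A), (y, B)]) (m.inst2 (.fvar x) (.fvar y)).emb C
      (fun ρ => F (pt ρ (Γ ++ [(x, A), (y, B)])))) :
    Supp Γ (body2 F) ∧ ∃ L : Finset ℕ, ∀ x ∉ L, ∀ y ∉ L, x ≠ y →
      Sem .mixed ((x, A) :: (y, B) :: Γ) (m.emb.inst2 (.fvar x) (.fvar y)) C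
        (fun ρ => body2 F ρ (ρ x A ⊗ₜ[ℂ] ρ y B)) := by
  have hd := h.nodup
  rw [domC_append] at hd
  have hd' := List.disjoint_of_nodup_append hd
  have hx' : x ∉ domC Γ := fun h => hd' h (by simp [domC])
  have hy' : y ∉ domC Γ := fun h => hd' h (by simp [domC])
  have hxy : y ≠ x := fun e => by
    have := hd.of_append_right
    simp [domC, e] at this
  rw [MTm.emb_inst2] at h
  refine Sem.bind2 (fun h => hx ((m.mem_fv_emb x).1 h)) (fun h => hy ((m.mem_fv_emb y).1 h))
    (h.perm List.perm_append_comm) fun ρ v w => ?_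
  have := snoc2_pt ((ρ.upd y B w).upd x A v) Γ x y A B
  rw [Env.upd_self, Env.upd_of_ne _ hxy, Env.upd_self, pt_upd hx', pt_upd hy'] at this
  exact congrArg F this.symm

theorem nodup {Γ : MCtx} {m : MTm} {A : MTy} (D : MDer Γ m A) : (domC Γ).Nodup := by
  induction D with
  | ax => simp [domC]
  | oneI => simp [domC]
  | boxI => simp [domC]
  | sum _ _ ih => exact ih
  | prod _ _ ih => exact ih
  | zeroE Δ A hΔ h _ ih => exact nodup_append ih hΔ h
  | oneE h _ _ ih ih' => exact nodup_append ih ih' h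
  | lolliI x hx _ ih => rw [domC_append] at ih; exact ih.of_append_left
  | lolliE h _ _ ih ih' => exact nodup_append ih ih' h
  | boxE h _ _ ih ih' => exact nodup_append ih ih' h
  | oplusI1 _ _ ih => exact ih
  | oplusI2 _ _ ih => exact ih
  | tau _ ih => exact ih
  | oplusE x y h hx hy _ _ _ ih ih' _ =>
    rw [domC_append] at ih'; exact nodup_append ih ih'.of_append_left h
  | tensI h _ _ ih ih' => exact nodup_append ih ih' h
  | tensE x y h hx hy _ _ ih ih' =>
    rw [domC_append] at ih'; exact nodup_append ih ih'.of_append_left h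
  | ex _ ih =>
    exact (((List.Perm.swap _ _ _).append_left _).domC.nodup_iff).1 ih

theorem tauUnit_one {H : FHilb} (f : FHilb.unit →ₗ[ℂ] H) :
    BMap f (tauUnit (1 : ℂ)) = ketbra (f (1 : ℂ)) (f (1 : ℂ)) := by
  rw [← BMap_ketbra]
  refine congrArg (BMap f) (LinearMap.ext fun (x : ℂ) => ?_)
  change x * 1 = (Inner.inner ℂ (1 : ℂ) x : ℂ) * 1
  simp

/-- The interpretation of a derivation on pure tensors. -/
theorem sem {Γ : MCtx} {m : MTm} {A : MTy} (D : MDer Γ m A) :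
    Sem .mixed Γ m.emb A (fun ρ => D.den (pt ρ Γ)) := by
  have hn := D.nodup
  induction D with
  | ax x A =>
    exact (Sem.ax .mixed x A).congr fun ρ =>
      ((TensorProduct.rid_tmul (R := ℂ) _ _).trans (one_smul ℂ _)).symm
  | sum D E ihD ihE => exact Sem.par (.add _) (ihD hn) (ihE hn)
  | prod a D ih => exact Sem.un (.smul _ _) (ih hn)
  | @zeroE Γ m Δ A hΔ h D ih => exact Sem.elimZero A (List.Perm.refl _) hn (ih D.nodup)
  | oneI => exact (Sem.star _)
  | @oneE Γ Δ m n A h D E ihD ihE =>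
    exact (Sem.bin (.elimOne _) (show Mode.mixed.Ok .one from trivial) (List.Perm.refl _) hn
      (ihD D.nodup) (ihE E.nodup)).congr fun ρ =>
        (congrArg (TensorProduct.lid ℂ A.den) (map_split ρ D.den E.den)).symm
  | @lolliI Γ m A B x hx D ih =>
    obtain ⟨hk, L, hL⟩ := body_bind hx (ih D.nodup)
    exact Sem.lam L _ hk hL
  | @lolliE Γ Δ m n A B h D E ihD ihE =>
    exact (Sem.bin (.app _ _) (show Mode.mixed.Ok _ from trivial) (List.Perm.refl _) hn
      (ihD D.nodup) (ihE E.nodup)).congr fun ρ =>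
        (congrArg (FCstar.eval A.den B.den) (map_split ρ D.den E.den)).symm
  | oplusI1 B D ih => exact Sem.un (.inl _ _) (ih hn)
  | oplusI2 A D ih => exact Sem.un (.inr _ _) (ih hn)
  | @oplusE Δ Γ m n o A B C x y h hx hy D E F ihD ihE ihF =>
    obtain ⟨hk, L, hL⟩ := body_bind hx (ihE E.nodup)
    obtain ⟨hl, L', hL'⟩ := body_bind hy (ihF F.nodup)
    refine (Sem.elimPlus (L ∪ L') _ _ (List.Perm.refl _) hn hk hl (ihD D.nodup)
      (fun z hz => hL z fun h => hz (Finset.mem_union_left _ h))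
      (fun z hz => hL' z fun h => hz (Finset.mem_union_right _ h))).congr fun ρ => ?_
    exact (congrArg (fun z => FCstar.copair (E.den ∘ₗ (MDer.snoc Γ x A).toLinearMap)
      (F.den ∘ₗ (MDer.snoc Γ y B).toLinearMap) (FCstar.distr (MDer.ctx Γ) A.den B.den
      (FCstar.symm (.sum A.den B.den) (MDer.ctx Γ) z))) (map_split ρ D.den LinearMap.id)).symm
  | @tensI Δ Γ m n A B h D E ihD ihE =>
    exact (Sem.bin (.tens _ _) (show Mode.mixed.Ok _ from trivial) (List.Perm.refl _) hn
      (ihD D.nodup) (ihE E.nodup)).congr fun ρ => (map_split ρ D.den E.den).symm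
  | @tensE Δ Γ m n A B C x y h hx hy D E ihD ihE =>
    obtain ⟨hk, L, hL⟩ := body2_bind hx hy (ihE E.nodup)
    refine (Sem.elimTens L _ (show Mode.mixed.Ok _ from trivial) (List.Perm.refl _) hn
      hk (ihD D.nodup) hL).congr fun ρ => ?_
    exact (congrArg (fun z => E.den (snoc2 Γ x y A B
      (FCstar.symm (.tensor A.den B.den) _ z))) (map_split ρ D.den LinearMap.id)).symm
  | @boxI m P D =>
    refine (Sem.box P D.sem).congr fun ρ => ?_
    rw [LinearEquiv.symm_apply_apply]
    exact (tauUnit_one D.den).symm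
  | @boxE Γ Δ m n P Q h D E ihD ihE =>
    exact (Sem.bin (.boxApp _ _) (show Mode.mixed.Ok _ from trivial) (List.Perm.refl _) hn
      (ihD D.nodup) (ihE E.nodup)).congr fun ρ => (congrArg (fun z =>
        BMap (FHilb.eval P.den Q.den) (tauIso (.ihom P.den Q.den) P.den z))
        (map_split ρ D.den E.den)).symm
  | tau D ih => exact Sem.un (.tau _ _) (ih hn)
  | @ex Δ Γ m A B C x y D ih =>
    refine ((ih D.nodup).perm ((List.Perm.swap _ _ _).append_left _)).congr fun ρ => ?_
    exact congrArg D.den (swap_pt ρ x y B A Γ Δ).symm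

end MDer

/-! ### From interpretations back to derivations -/

/-- Exchange below a common prefix `Θ`, to which the induction on permutations adds. -/
theorem PDer.perm_aux {Γ Δ : PCtx} (h : Γ.Perm Δ) {m : PTm} {P : PTy} :
    ∀ Θ : PCtx, Nonempty (PDer (Θ ++ Γ) m P) → Nonempty (PDer (Θ ++ Δ) m P) := by
  induction h with
  | nil => exact fun _ D => D
  | cons a _ ih => exact fun Θ D => by simpa using ih (Θ ++ [a]) (by simpa using D)
  | swap a b Γ => exact fun Θ ⟨D⟩ => ⟨.ex D⟩
  | trans _ _ ih ih' => exact fun Θ D => ih' Θ (ih Θ D)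

theorem PDer.perm {Γ Δ : PCtx} {m : PTm} {P : PTy} (D : PDer Γ m P) (h : Γ.Perm Δ) :
    Nonempty (PDer Δ m P) := PDer.perm_aux h [] ⟨D⟩

/-- Exchange below a common prefix `Θ`, to which the induction on permutations adds. -/
theorem MDer.perm_aux {Γ Δ : MCtx} (h : Γ.Perm Δ) {m : MTm} {A : MTy} :
    ∀ Θ : MCtx, Nonempty (MDer (Θ ++ Γ) m A) → Nonempty (MDer (Θ ++ Δ) m A) := by
  induction h with
  | nil => exact fun _ D => D
  | cons a _ ih => exact fun Θ D => by simpa using ih (Θ ++ [a]) (by simpa using D)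
  | swap a b Γ => exact fun Θ ⟨D⟩ => ⟨.ex D⟩
  | trans _ _ ih ih' => exact fun Θ D => ih' Θ (ih Θ D)

theorem MDer.perm {Γ Δ : MCtx} {m : MTm} {A : MTy} (D : MDer Γ m A) (h : Γ.Perm Δ) :
    Nonempty (MDer Δ m A) := MDer.perm_aux h [] ⟨D⟩

/-- The parts of a pure context are pure. -/
theorem embC_split {Γ : PCtx} {Γ₁ Γ₂ : MCtx} (h : (PDer.embC Γ).Perm (Γ₁ ++ Γ₂)) :
    ∃ Δ₁ Δ₂, Γ₁ = PDer.embC Δ₁ ∧ Γ₂ = PDer.embC Δ₂ ∧ Γ.Perm (Δ₁ ++ Δ₂) := by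
  have hinj : Function.Injective fun p : ℕ × PTy => (p.1, p.2.emb) := fun p q h =>
    Prod.ext (Prod.mk.inj h).1 (PTy.emb_injective (Prod.mk.inj h).2)
  have key : ∀ Θ : MCtx, Θ ⊆ PDer.embC Γ → ∃ Δ, Θ = PDer.embC Δ := by
    intro Θ
    induction Θ with
    | nil => exact fun _ => ⟨[], rfl⟩
    | cons p Θ ih =>
      intro hs
      obtain ⟨Δ, rfl⟩ := ih fun q hq => hs (List.mem_cons_of_mem _ hq)
      obtain ⟨q, -, rfl⟩ := List.mem_map.1 (hs (List.mem_cons_self))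
      exact ⟨q :: Δ, rfl⟩
  obtain ⟨Δ₁, rfl⟩ := key Γ₁ fun p hp => h.symm.subset (List.mem_append_left _ hp)
  obtain ⟨Δ₂, rfl⟩ := key Γ₂ fun p hp => h.symm.subset (List.mem_append_right _ hp)
  rw [← PDer.embC_append] at h
  exact ⟨Δ₁, Δ₂, rfl, rfl, (List.map_perm_map_iff hinj).1 h⟩

theorem domC_disjoint_embC {Ω : PCtx} {Δ₁ Δ₂ : PCtx} (hp : Ω.Perm (Δ₁ ++ Δ₂))
    (hd : (domC (PDer.embC Ω)).Nodup) : (domC Δ₁).Disjoint (domC Δ₂) := by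
  rw [PDer.domC_embC] at hd
  exact (nodup_split hp hd).2.2

/-- Interpreted pure terms have derivations. -/
theorem Sem.pder {s : Mode} {Γ' : MCtx} {m' : Tm} {A : MTy} {f : Env → A.den}
    (h : Sem s Γ' m' A f) (hs : s = .pure) {Γ : PCtx} {m : PTm} {P : PTy} (hΓ : Γ' = PDer.embC Γ)
    (hm : m' = m.emb) (hP : A = P.emb) : Nonempty (PDer Γ m P) := by
  induction h generalizing Γ m P with
  | ax s x A =>
    cases m <;> simp only [PTm.emb, Tm.fvar.injEq, reduceCtorEq] at hm
    subst hm hP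
    obtain ⟨⟨y, Q⟩, rfl, e⟩ := List.map_eq_singleton_iff.1 hΓ.symm
    obtain ⟨e₁, e₂⟩ := Prod.mk.inj e
    dsimp only at e₁ e₂
    subst e₁
    rw [PTy.emb_injective e₂]
    exact ⟨.ax _ _⟩
  | topI s Ω hd =>
    cases m <;> simp only [PTm.emb, reduceCtorEq] at hm
    cases P <;> simp only [PTy.emb, reduceCtorEq] at hP
    subst hΓ
    rw [PDer.domC_embC] at hd
    exact ⟨.topI _ hd⟩
  | star s =>
    cases m <;> simp only [PTm.emb, reduceCtorEq] at hm
    cases P <;> simp only [PTy.emb, reduceCtorEq] at hP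
    rw [List.map_eq_nil_iff.1 hΓ.symm]
    exact ⟨.oneI⟩
  | un ho _ ih =>
    cases m <;> simp only [PTm.emb, Tm.un.injEq, reduceCtorEq] at hm
    obtain ⟨rfl, rfl⟩ := hm
    cases ho
    obtain ⟨D⟩ := ih hs hΓ rfl hP
    exact ⟨.prod _ D⟩
  | par ho _ _ ihm ihn =>
    cases m <;> simp only [PTm.emb, Tm.par.injEq, reduceCtorEq] at hm
    · obtain ⟨rfl, rfl, rfl⟩ := hm
      cases ho
      obtain ⟨D⟩ := ihm hs hΓ rfl hP
      obtain ⟨E⟩ := ihn hs hΓ rfl hP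
      exact ⟨.sum D E⟩
    · obtain ⟨rfl, rfl, rfl⟩ := hm
      cases ho
      cases P <;> simp only [PTy.emb, MTy.oplus.injEq, reduceCtorEq] at hP
      obtain ⟨D⟩ := ihm hs hΓ rfl hP.1
      obtain ⟨E⟩ := ihn hs hΓ rfl hP.2
      exact ⟨.withI D E⟩
  | bin ho hA hp hd _ _ ihm ihn =>
    subst hs hΓ
    obtain ⟨Δ₁, Δ₂, rfl, rfl, hp'⟩ := embC_split hp
    have hd' := domC_disjoint_embC hp' hd
    obtain ⟨R, hR⟩ := hA
    cases m <;> simp only [PTm.emb, Tm.bin.injEq, reduceCtorEq] at hm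
    all_goals obtain ⟨rfl, rfl, rfl⟩ := hm
    · cases ho
      cases R <;> simp only [PTy.emb, reduceCtorEq] at hR
      obtain ⟨D⟩ := ihm rfl rfl rfl (P := .one) rfl
      obtain ⟨E⟩ := ihn rfl rfl rfl hP
      exact (PDer.oneE hd' D E).perm hp'.symm
    · cases ho <;> cases R <;> simp only [PTy.emb, MTy.lolli.injEq, reduceCtorEq] at hR
      obtain ⟨rfl, rfl⟩ := hR
      obtain ⟨D⟩ := ihm rfl rfl rfl (P := .lolli _ _) rfl
      obtain ⟨E⟩ := ihn rfl rfl rfl rfl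
      rw [← PTy.emb_injective hP]
      exact (PDer.lolliE hd' D E).perm hp'.symm
    · cases ho
      cases P <;> simp only [PTy.emb, MTy.tens.injEq, reduceCtorEq] at hP
      obtain ⟨D⟩ := ihm rfl rfl rfl hP.1
      obtain ⟨E⟩ := ihn rfl rfl rfl hP.2
      exact (PDer.tensI hd' D E).perm hp'.symm
  | lam L k hk _ ih =>
    cases m with
    | lam m =>
      cases P with
      | lolli P Q =>
        simp only [PTm.emb, Tm.lam.injEq] at hm
        simp only [PTy.emb, MTy.lolli.injEq] at hP
        obtain ⟨rfl, rfl⟩ := hP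
        subst hm hΓ
        obtain ⟨x, hx, -⟩ := exists_fresh (L ∪ m.emb.fv) []
        simp only [Finset.mem_union, not_or] at hx
        obtain ⟨D⟩ := ih x hx.1 hs (Γ := (x, P) :: Γ) (m := m.inst 0 (.fvar x)) rfl
          (PTm.emb_inst m (.fvar x) 0).symm rfl
        obtain ⟨D⟩ := D.perm (Δ := Γ ++ [(x, P)]) (List.perm_append_comm (l₁ := [_]))
        exact ⟨.lolliI x (fun h => hx.2 ((m.mem_fv_emb x).2 h)) D⟩
      | _ => simp [PTy.emb] at hP
    | _ => simp [PTm.emb] at hm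
  | elimZero => cases m <;> simp [PTm.emb] at hm
  | elimWith L k ho hA hp hd hk _ _ ihm ihn =>
    subst hs hΓ
    obtain ⟨Δ₁, Δ₂, rfl, rfl, hp'⟩ := embC_split hp
    have hd' := domC_disjoint_embC hp' hd
    obtain ⟨R, hR⟩ := hA
    cases m with
    | elimWith1 m n =>
      simp only [PTm.emb, Tm.elimWith.injEq] at hm
      obtain ⟨rfl, rfl, rfl⟩ := hm
      obtain ⟨x, hx, -⟩ := exists_fresh (L ∪ n.emb.fv) []
      simp only [Finset.mem_union, not_or] at hx
      cases ho
      cases R <;> simp only [PTy.emb, MTy.oplus.injEq, reduceCtorEq] at hR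
      obtain ⟨rfl, rfl⟩ := hR
      obtain ⟨D⟩ := ihm rfl rfl rfl (P := .amp _ _) rfl
      obtain ⟨E⟩ := ihn x hx.1 rfl (Γ := (x, _) :: Δ₂) (m := n.inst 0 (.fvar x)) rfl
          (PTm.emb_inst n (.fvar x) 0).symm hP
      obtain ⟨E⟩ := E.perm (Δ := Δ₂ ++ [(x, _)]) (List.perm_append_comm (l₁ := [_]))
      exact (PDer.withE1 x hd' (fun h => hx.2 ((n.mem_fv_emb x).2 h)) D E).perm hp'.symm
    | elimWith2 m n =>
      simp only [PTm.emb, Tm.elimWith.injEq] at hm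
      obtain ⟨rfl, rfl, rfl⟩ := hm
      obtain ⟨x, hx, -⟩ := exists_fresh (L ∪ n.emb.fv) []
      simp only [Finset.mem_union, not_or] at hx
      cases ho
      cases R <;> simp only [PTy.emb, MTy.oplus.injEq, reduceCtorEq] at hR
      obtain ⟨rfl, rfl⟩ := hR
      obtain ⟨D⟩ := ihm rfl rfl rfl (P := .amp _ _) rfl
      obtain ⟨E⟩ := ihn x hx.1 rfl (Γ := (x, _) :: Δ₂) (m := n.inst 0 (.fvar x)) rfl
          (PTm.emb_inst n (.fvar x) 0).symm hP
      obtain ⟨E⟩ := E.perm (Δ := Δ₂ ++ [(x, _)]) (List.perm_append_comm (l₁ := [_]))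
      exact (PDer.withE2 x hd' (fun h => hx.2 ((n.mem_fv_emb x).2 h)) D E).perm hp'.symm
    | _ => simp [PTm.emb] at hm
  | elimPlus => cases m <;> simp [PTm.emb] at hm
  | elimTens L k hA hp hd hk _ _ ihm ihn =>
    subst hs hΓ
    obtain ⟨Δ₁, Δ₂, rfl, rfl, hp'⟩ := embC_split hp
    have hd' := domC_disjoint_embC hp' hd
    obtain ⟨R, hR⟩ := hA
    cases m with
    | elimTens m n =>
      simp only [PTm.emb, Tm.elimTens.injEq] at hm
      obtain ⟨rfl, rfl⟩ := hm
      obtain ⟨x, y, hx, hy, -, -, hxy⟩ := exists_fresh_pair (L ∪ n.emb.fv) []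
      simp only [Finset.mem_union, not_or] at hx hy
      cases R <;> simp only [PTy.emb, MTy.tens.injEq, reduceCtorEq] at hR
      obtain ⟨rfl, rfl⟩ := hR
      obtain ⟨D⟩ := ihm rfl rfl rfl (P := .tens _ _) rfl
      obtain ⟨E⟩ := ihn x hx.1 y hy.1 hxy rfl (Γ := (x, _) :: (y, _) :: Δ₂)
          (m := n.inst2 (.fvar x) (.fvar y)) rfl (PTm.emb_inst2 n (.fvar x) (.fvar y)).symm hP
      obtain ⟨E⟩ := E.perm (Δ := Δ₂ ++ [(x, _), (y, _)]) (List.perm_append_comm (l₁ := [_, _]))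
      exact (PDer.tensE x y hd' (fun h => hx.2 ((n.mem_fv_emb x).2 h))
        (fun h => hy.2 ((n.mem_fv_emb y).2 h)) D E).perm hp'.symm
    | _ => simp [PTm.emb] at hm
  | box => cases m <;> simp [PTm.emb] at hm

/-- Interpreted mixed terms have derivations. -/
theorem Sem.mder {s : Mode} {Γ : MCtx} {m' : Tm} {A : MTy} {f : Env → A.den}
    (h : Sem s Γ m' A f) {m : MTm} (hm : m' = m.emb) : Nonempty (MDer Γ m A) := by
  induction h generalizing m with
  | ax s x A =>
    cases m <;> simp only [MTm.emb, Tm.fvar.injEq, reduceCtorEq] at hm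
    subst hm
    exact ⟨.ax _ _⟩
  | topI s Ω hd => cases m <;> simp [MTm.emb] at hm
  | star s =>
    cases m <;> simp only [MTm.emb, reduceCtorEq] at hm
    exact ⟨.oneI⟩
  | un ho _ ih =>
    cases m <;> simp only [MTm.emb, Tm.un.injEq, reduceCtorEq] at hm
    all_goals
      obtain ⟨rfl, rfl⟩ := hm
      cases ho
      obtain ⟨D⟩ := ih rfl
    · exact ⟨.prod _ D⟩
    · exact ⟨.oplusI1 _ D⟩
    · exact ⟨.oplusI2 _ D⟩
    · exact ⟨.tau D⟩
  | par ho _ _ ihm ihn =>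
    cases m <;> simp only [MTm.emb, Tm.par.injEq, reduceCtorEq] at hm
    obtain ⟨rfl, rfl, rfl⟩ := hm
    cases ho
    obtain ⟨D⟩ := ihm rfl
    obtain ⟨E⟩ := ihn rfl
    exact ⟨.sum D E⟩
  | bin ho hA hp hd _ _ ihm ihn =>
    have hd' := (nodup_split hp hd).2.2
    cases m <;> simp only [MTm.emb, Tm.bin.injEq, reduceCtorEq] at hm
    all_goals
      obtain ⟨rfl, rfl, rfl⟩ := hm
      obtain ⟨D⟩ := ihm rfl
      obtain ⟨E⟩ := ihn rfl
    · cases ho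
      exact (MDer.oneE hd' D E).perm hp.symm
    · cases ho
      · exact (MDer.lolliE hd' D E).perm hp.symm
      · exact (MDer.boxE hd' D E).perm hp.symm
    · cases ho
      exact (MDer.tensI hd' D E).perm hp.symm
  | @lam s Γ _ A B L k hk _ ih =>
    cases m with
    | lam m =>
      simp only [MTm.emb, Tm.lam.injEq] at hm
      subst hm
      obtain ⟨x, hx, -⟩ := exists_fresh (L ∪ m.emb.fv) []
      simp only [Finset.mem_union, not_or] at hx
      obtain ⟨D⟩ := ih x hx.1 (MTm.emb_inst m (.fvar x) 0).symm
      obtain ⟨D⟩ := D.perm (Δ := Γ ++ [(x, A)]) (List.perm_append_comm (l₁ := [_]))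
      exact ⟨.lolliI x (fun h => hx.2 ((m.mem_fv_emb x).2 h)) D⟩
    | _ => simp [MTm.emb] at hm
  | @elimZero s Γ Δ Ω _ f A hp hd _ ih =>
    cases m <;> simp only [MTm.emb, Tm.elimZero.injEq, reduceCtorEq] at hm
    have hd' := nodup_split hp hd
    obtain ⟨D⟩ := ih hm
    exact (MDer.zeroE Δ A hd'.2.1 hd'.2.2 D).perm hp.symm
  | elimWith => cases m <;> simp [MTm.emb] at hm
  | @elimPlus s Γ Δ Ω _ _ _ A B C f L k l hp hd hk hl _ _ _ ihm ihn iho =>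
    have hd' := (nodup_split hp hd).2.2
    cases m with
    | elimPlus m n o =>
      simp only [MTm.emb, Tm.elimPlus.injEq] at hm
      obtain ⟨rfl, rfl, rfl⟩ := hm
      obtain ⟨x, hx, -⟩ := exists_fresh (L ∪ n.emb.fv ∪ o.emb.fv) []
      simp only [Finset.mem_union, not_or] at hx
      obtain ⟨D⟩ := ihm rfl
      obtain ⟨E⟩ := ihn x hx.1.1 (MTm.emb_inst n (.fvar x) 0).symm
      obtain ⟨F⟩ := iho x hx.1.1 (MTm.emb_inst o (.fvar x) 0).symm
      obtain ⟨E⟩ := E.perm (Δ := Δ ++ [(x, A)]) (List.perm_append_comm (l₁ := [_]))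
      obtain ⟨F⟩ := F.perm (Δ := Δ ++ [(x, B)]) (List.perm_append_comm (l₁ := [_]))
      exact (MDer.oplusE x x hd' (fun h => hx.1.2 ((n.mem_fv_emb x).2 h))
        (fun h => hx.2 ((o.mem_fv_emb x).2 h)) D E F).perm hp.symm
    | _ => simp [MTm.emb] at hm
  | @elimTens s Γ Δ Ω _ _ A B C f L k hA hp hd hk _ _ ihm ihn =>
    have hd' := (nodup_split hp hd).2.2
    cases m with
    | elimTens m n =>
      simp only [MTm.emb, Tm.elimTens.injEq] at hm
      obtain ⟨rfl, rfl⟩ := hm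
      obtain ⟨x, y, hx, hy, -, -, hxy⟩ := exists_fresh_pair (L ∪ n.emb.fv) []
      simp only [Finset.mem_union, not_or] at hx hy
      obtain ⟨D⟩ := ihm rfl
      obtain ⟨E⟩ := ihn x hx.1 y hy.1 hxy (MTm.emb_inst2 n (.fvar x) (.fvar y)).symm
      obtain ⟨E⟩ := E.perm (Δ := Δ ++ [(x, A), (y, B)]) (List.perm_append_comm (l₁ := [_, _]))
      exact (MDer.tensE x y hd' (fun h => hx.2 ((n.mem_fv_emb x).2 h))
        (fun h => hy.2 ((n.mem_fv_emb y).2 h)) D E).perm hp.symm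
    | _ => simp [MTm.emb] at hm
  | box P hm' ih =>
    cases m <;> simp only [MTm.emb, Tm.box.injEq, reduceCtorEq] at hm
    obtain ⟨D⟩ := hm'.pder rfl (Γ := []) rfl hm rfl
    exact ⟨.boxI D⟩

/-! ### Algebraic equivalence -/

namespace Tm

/-- The algebraic rules.  Their soundness does not need the side condition of `m + 0 • n ⇄ m`. -/
inductive Alg : Tm → Tm → Prop
  | oneSmul (m : Tm) : Alg (un (.smul 1) m) m
  | comm (m n : Tm) : Alg (par .add m n) (par .add n m)
  | assoc (m n o : Tm) : Alg (par .add m (par .add n o)) (par .add (par .add m n) o)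
  | addSmul (a b : ℂ) (m : Tm) :
      Alg (par .add (un (.smul a) m) (un (.smul b) m)) (un (.smul (a + b)) m)
  | smulSmul (a b : ℂ) (m : Tm) : Alg (un (.smul a) (un (.smul b) m)) (un (.smul (a * b)) m)
  | smulAdd (a : ℂ) (m n : Tm) :
      Alg (un (.smul a) (par .add m n)) (par .add (un (.smul a) m) (un (.smul a) n))
  | addZero (m n : Tm) : Alg (par .add m (un (.smul 0) n)) m
  | tensSmul (a : ℂ) (m n : Tm) : Alg (bin .tens m (un (.smul a) n)) (un (.smul a) (bin .tens m n))
  | smulTens (a : ℂ) (m n : Tm) : Alg (bin .tens (un (.smul a) m) n) (un (.smul a) (bin .tens m n))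
  | addTens (m m' n : Tm) :
      Alg (bin .tens (par .add m m') n) (par .add (bin .tens m n) (bin .tens m' n))
  | tensAdd (m n n' : Tm) :
      Alg (bin .tens m (par .add n n')) (par .add (bin .tens m n) (bin .tens m n'))

/-- One application of an algebraic rule anywhere in a term. -/
inductive Rw : Tm → Tm → Prop
  | alg {m m'} : Alg m m' → Rw m m'
  | un (o : UnOp) {m m'} : Rw m m' → Rw (un o m) (un o m')
  | parL (o : ParOp) {m m'} (n : Tm) : Rw m m' → Rw (par o m n) (par o m' n)
  | parR (o : ParOp) (m : Tm) {n n'} : Rw n n' → Rw (par o m n) (par o m n')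
  | binL (o : BinOp) {m m'} (n : Tm) : Rw m m' → Rw (bin o m n) (bin o m' n)
  | binR (o : BinOp) (m : Tm) {n n'} : Rw n n' → Rw (bin o m n) (bin o m n')
  | lam {m m'} : Rw m m' → Rw (lam m) (lam m')
  | elimZero {m m'} : Rw m m' → Rw (elimZero m) (elimZero m')
  | elimWithL (i : Bool) {m m'} (n : Tm) : Rw m m' → Rw (elimWith i m n) (elimWith i m' n)
  | elimWithR (i : Bool) (m : Tm) {n n'} : Rw n n' → Rw (elimWith i m n) (elimWith i m n')
  | elimPlus1 {m m'} (n o : Tm) : Rw m m' → Rw (elimPlus m n o) (elimPlus m' n o)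
  | elimPlus2 (m : Tm) {n n'} (o : Tm) : Rw n n' → Rw (elimPlus m n o) (elimPlus m n' o)
  | elimPlus3 (m n : Tm) {o o'} : Rw o o' → Rw (elimPlus m n o) (elimPlus m n o')
  | elimTensL {m m'} (n : Tm) : Rw m m' → Rw (elimTens m n) (elimTens m' n)
  | elimTensR (m : Tm) {n n'} : Rw n n' → Rw (elimTens m n) (elimTens m n')
  | box {m m'} : Rw m m' → Rw (box m) (box m')

theorem Alg.inst {m n : Tm} (h : Alg m n) (k : ℕ) (u : Tm) : Alg (m.inst k u) (n.inst k u) := by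
  cases h <;> constructor

theorem Rw.inst {m n : Tm} (h : Rw m n) (k : ℕ) (u : Tm) : Rw (m.inst k u) (n.inst k u) := by
  induction h generalizing k with
  | alg h => exact .alg (h.inst k u)
  | un o _ ih => exact .un o (ih k)
  | parL o n _ ih => exact .parL o _ (ih k)
  | parR o m _ ih => exact .parR o _ (ih k)
  | binL o n _ ih => exact .binL o _ (ih k)
  | binR o m _ ih => exact .binR o _ (ih k)
  | lam _ ih => exact .lam (ih _)
  | elimZero _ ih => exact .elimZero (ih k)
  | elimWithL i n _ ih => exact .elimWithL i _ (ih k)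
  | elimWithR i m _ ih => exact .elimWithR i _ (ih _)
  | elimPlus1 n o _ ih => exact .elimPlus1 _ _ (ih k)
  | elimPlus2 m o _ ih => exact .elimPlus2 _ _ (ih _)
  | elimPlus3 m n _ ih => exact .elimPlus3 _ _ (ih _)
  | elimTensL n _ ih => exact .elimTensL _ (ih k)
  | elimTensR m _ ih => exact .elimTensR _ (ih _)
  | box h _ => exact .box h

end Tm

namespace Sem
variable {s : Mode} {Γ : MCtx} {m n : Tm} {A : MTy}

theorem smul (a : ℂ) {f : Env → A.den} (h : Sem s Γ m A f) :
    Sem s Γ (.un (.smul a) m) A (a • f) := .un (.smul a A) h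

theorem add {f g : Env → A.den} (h : Sem s Γ m A f) (h' : Sem s Γ n A g) :
    Sem s Γ (.par .add m n) A (f + g) := .par (.add A) h h'

theorem smul_inv {a : ℂ} {F : Env → A.den} (h : Sem s Γ (.un (.smul a) m) A F) :
    ∃ f, Sem s Γ m A f ∧ F = a • f := by
  cases h with
  | un ho h => cases ho; exact ⟨_, h, rfl⟩

theorem add_inv {F : Env → A.den} (h : Sem s Γ (.par .add m n) A F) :
    ∃ f g, Sem s Γ m A f ∧ Sem s Γ n A g ∧ F = f + g := by
  cases h with
  | par ho h h' => cases ho; exact ⟨_, _, h, h', rfl⟩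

end Sem

namespace Tm

/-- Every interpretation of `m` is an interpretation of `n`. -/
def Le (m n : Tm) : Prop := ∀ s Γ A f, Sem s Γ m A f → Sem s Γ n A f

/-- The algebraic rules preserve the interpretation.  In `a • m + b • m` the term `m` is interpreted
twice, and the two interpretations agree by coherence. -/
theorem Alg.le {m n : Tm} (h : Alg m n) : Le m n := by
  intro s Γ A f hm
  cases h with
  | oneSmul m =>
    obtain ⟨f, h, rfl⟩ := hm.smul_inv
    rwa [one_smul]
  | comm m n =>
    obtain ⟨f, g, h, h', rfl⟩ := hm.add_inv
    rw [add_comm]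
    exact h'.add h
  | assoc m n o =>
    obtain ⟨f, F, hf, h, rfl⟩ := hm.add_inv
    obtain ⟨g, h, hg, hh, rfl⟩ := h.add_inv
    rw [← add_assoc]
    exact (hf.add hg).add hh
  | addSmul a b m =>
    obtain ⟨F, G, hF, hG, rfl⟩ := hm.add_inv
    obtain ⟨f, hf, rfl⟩ := hF.smul_inv
    obtain ⟨g, hg, rfl⟩ := hG.smul_inv
    rw [hg.coherent hf, ← add_smul]
    exact hf.smul _
  | smulSmul a b m =>
    obtain ⟨F, hF, rfl⟩ := hm.smul_inv
    obtain ⟨f, hf, rfl⟩ := hF.smul_inv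
    rw [smul_smul]
    exact hf.smul _
  | smulAdd a m n =>
    obtain ⟨F, hF, rfl⟩ := hm.smul_inv
    obtain ⟨f, g, hf, hg, rfl⟩ := hF.add_inv
    rw [smul_add]
    exact (hf.smul a).add (hg.smul a)
  | addZero m n =>
    obtain ⟨f, G, hf, hG, rfl⟩ := hm.add_inv
    obtain ⟨g, hg, rfl⟩ := hG.smul_inv
    rwa [zero_smul, add_zero]
  | tensSmul a m n =>
    cases hm with
    | bin ho hA hp hd hm hn =>
      cases ho
      obtain ⟨g, hg, rfl⟩ := hn.smul_inv
      exact ((Sem.bin (.tens _ _) hA hp hd hm hg).smul a).congr fun ρ =>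
        (TensorProduct.tmul_smul a _ _).symm
  | smulTens a m n =>
    cases hm with
    | bin ho hA hp hd hm hn =>
      cases ho
      obtain ⟨g, hg, rfl⟩ := hm.smul_inv
      exact ((Sem.bin (.tens _ _) hA hp hd hg hn).smul a).congr fun ρ =>
        (TensorProduct.smul_tmul' a _ _).symm
  | addTens m m' n =>
    cases hm with
    | bin ho hA hp hd hm hn =>
      cases ho
      obtain ⟨f, g, hf, hg, rfl⟩ := hm.add_inv
      exact ((Sem.bin (.tens _ _) hA hp hd hf hn).add (Sem.bin (.tens _ _) hA hp hd hg hn)).congr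
        fun ρ => (TensorProduct.add_tmul _ _ _).symm
  | tensAdd m n n' =>
    cases hm with
    | bin ho hA hp hd hm hn =>
      cases ho
      obtain ⟨f, g, hf, hg, rfl⟩ := hn.add_inv
      exact ((Sem.bin (.tens _ _) hA hp hd hm hf).add (Sem.bin (.tens _ _) hA hp hd hm hg)).congr
        fun ρ => (TensorProduct.tmul_add _ _ _).symm

end Tm

/-- Algebraic rules preserve the interpretation wherever they are applied. -/
theorem Sem.rw {s : Mode} {Γ : MCtx} {m n : Tm} {A : MTy} {f : Env → A.den} (h : Sem s Γ m A f)
    (hr : Tm.Rw m n) : Sem s Γ n A f := by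
  induction h generalizing n with
  | ax s x A => cases hr with | alg h => cases h
  | topI s Γ hd => cases hr with | alg h => cases h
  | star s => cases hr with | alg h => cases h
  | un ho hm ih =>
    cases hr with
    | alg h => exact h.le _ _ _ _ (.un ho hm)
    | un o h => exact .un ho (ih h)
  | par ho hm hn ihm ihn =>
    cases hr with
    | alg h => exact h.le _ _ _ _ (.par ho hm hn)
    | parL o n h => exact .par ho (ihm h) hn
    | parR o n h => exact .par ho hm (ihn h)
  | bin ho hA hp hd hm hn ihm ihn =>
    cases hr with
    | alg h => exact h.le _ _ _ _ (.bin ho hA hp hd hm hn)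
    | binL o n h => exact .bin ho hA hp hd (ihm h) hn
    | binR o n h => exact .bin ho hA hp hd hm (ihn h)
  | lam L k hk hm ih =>
    cases hr with
    | alg h => cases h
    | lam h => exact .lam L k hk fun x hx => ih x hx (h.inst _ _)
  | elimZero A hp hd hm ih =>
    cases hr with
    | alg h => cases h
    | elimZero h => exact .elimZero A hp hd (ih h)
  | elimWith L k ho hA hp hd hk hm hn ihm ihn =>
    cases hr with
    | alg h => cases h
    | elimWithL i n h => exact .elimWith L k ho hA hp hd hk (ihm h) hn
    | elimWithR i m h => exact .elimWith L k ho hA hp hd hk hm fun x hx => ihn x hx (h.inst _ _)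
  | elimPlus L k l hp hd hk hl hm hn ho ihm ihn iho =>
    cases hr with
    | alg h => cases h
    | elimPlus1 n o h => exact .elimPlus L k l hp hd hk hl (ihm h) hn ho
    | elimPlus2 m o h =>
      exact .elimPlus L k l hp hd hk hl hm (fun x hx => ihn x hx (h.inst _ _)) ho
    | elimPlus3 m n h =>
      exact .elimPlus L k l hp hd hk hl hm hn fun x hx => iho x hx (h.inst _ _)
  | elimTens L k hA hp hd hk hm hn ihm ihn =>
    cases hr with
    | alg h => cases h
    | elimTensL n h => exact .elimTens L k hA hp hd hk (ihm h) hn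
    | elimTensR m h =>
      exact .elimTens L k hA hp hd hk hm fun x hx y hy hxy =>
        ihn x hx y hy hxy ((h.inst _ _).inst _ _)
  | box P hm ih =>
    cases hr with
    | alg h => cases h
    | box h => exact .box P (ih h)

theorem PRw.emb {m n : PTm} (h : PRw m n) : Tm.Rw m.emb n.emb := by
  induction h with
  | oneSmul m => exact .alg (.oneSmul _)
  | comm m n => exact .alg (.comm _ _)
  | assoc m n o => exact .alg (.assoc _ _ _)
  | addSmul a b m => exact .alg (.addSmul _ _ _)
  | smulSmul a b m => exact .alg (.smulSmul _ _ _)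
  | smulAdd a m n => exact .alg (.smulAdd _ _ _)
  | addZero m n h => exact .alg (.addZero _ _)
  | tensSmul a m n => exact .alg (.tensSmul _ _ _)
  | smulTens a m n => exact .alg (.smulTens _ _ _)
  | addTens m m' n => exact .alg (.addTens _ _ _)
  | tensAdd m n n' => exact .alg (.tensAdd _ _ _)
  | addL n _ ih => exact .parL _ _ ih
  | addR m _ ih => exact .parR _ _ ih
  | smul a _ ih => exact .un _ ih
  | elimOneL n _ ih => exact .binL _ _ ih
  | elimOneR m _ ih => exact .binR _ _ ih
  | lam _ ih => exact .lam ih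
  | appL n _ ih => exact .binL _ _ ih
  | appR m _ ih => exact .binR _ _ ih
  | pairL n _ ih => exact .parL _ _ ih
  | pairR m _ ih => exact .parR _ _ ih
  | elimWith1L n _ ih => exact .elimWithL _ _ ih
  | elimWith1R m _ ih => exact .elimWithR _ _ ih
  | elimWith2L n _ ih => exact .elimWithL _ _ ih
  | elimWith2R m _ ih => exact .elimWithR _ _ ih
  | tensL n _ ih => exact .binL _ _ ih
  | tensR m _ ih => exact .binR _ _ ih
  | elimTensL n _ ih => exact .elimTensL _ ih
  | elimTensR m _ ih => exact .elimTensR _ ih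

theorem MRw.emb {m n : MTm} (h : MRw m n) : Tm.Rw m.emb n.emb := by
  induction h with
  | oneSmul m =>
    have := Tm.Alg.oneSmul m.emb
    exact .alg (by simpa [MTm.emb] using this)
  | comm m n => exact .alg (.comm _ _)
  | assoc m n o => exact .alg (.assoc _ _ _)
  | addSmul p q m =>
    have := Tm.Alg.addSmul (p : ℝ) (q : ℝ) m.emb
    exact .alg (by simpa [MTm.emb] using this)
  | smulSmul p q m =>
    have := Tm.Alg.smulSmul (p : ℝ) (q : ℝ) m.emb
    exact .alg (by simpa [MTm.emb] using this)
  | smulAdd a m n => exact .alg (.smulAdd _ _ _)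
  | addZero m n h =>
    have := Tm.Alg.addZero m.emb n.emb
    exact .alg (by simpa [MTm.emb] using this)
  | tensSmul a m n => exact .alg (.tensSmul _ _ _)
  | smulTens a m n => exact .alg (.smulTens _ _ _)
  | addTens m m' n => exact .alg (.addTens _ _ _)
  | tensAdd m n n' => exact .alg (.tensAdd _ _ _)
  | addL n _ ih => exact .parL _ _ ih
  | addR m _ ih => exact .parR _ _ ih
  | smul a _ ih => exact .un _ ih
  | elimZero _ ih => exact .elimZero ih
  | elimOneL n _ ih => exact .binL _ _ ih
  | elimOneR m _ ih => exact .binR _ _ ih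
  | lam _ ih => exact .lam ih
  | appL n _ ih => exact .binL _ _ ih
  | appR m _ ih => exact .binR _ _ ih
  | inl _ ih => exact .un _ ih
  | inr _ ih => exact .un _ ih
  | elimPlus1 n o _ ih => exact .elimPlus1 _ _ ih
  | elimPlus2 m o _ ih => exact .elimPlus2 _ _ ih
  | elimPlus3 m n _ ih => exact .elimPlus3 _ _ ih
  | tensL n _ ih => exact .binL _ _ ih
  | tensR m _ ih => exact .binR _ _ ih
  | elimTensL n _ ih => exact .elimTensL _ ih
  | elimTensR m _ ih => exact .elimTensR _ ih
  | B h => exact .box h.emb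
  | tau _ ih => exact .un _ ih

/-! ### Linear combinations -/

/-- `Tm.Lin l t`: `t` is `∑ aᵢ • mᵢ`, where `l` is the multiset of the pairs `(aᵢ, mᵢ)`. -/
def Tm.Lin (l : Multiset (ℂ × Tm)) (t : Tm) : Prop :=
  SumOf (Tm.par .add) (l.map fun q => Tm.un (.smul q.1) q.2) t

theorem SumOf.map {T T' : Type} {add : T → T → T} {add' : T' → T' → T'} (e : T → T')
    (he : ∀ x y, e (add x y) = add' (e x) (e y)) {s : Multiset T} {t : T} (h : SumOf add s t) :
    SumOf add' (s.map e) (e t) := by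
  induction h with
  | single t => rw [Multiset.map_singleton]; exact .single _
  | add _ _ ih ih' => rw [Multiset.map_add, he]; exact .add ih ih'

theorem SumOf.exists_mem {T : Type} {add : T → T → T} {s : Multiset T} {t : T}
    (h : SumOf add s t) : ∃ u, u ∈ s := by
  induction h with
  | single t => exact ⟨t, Multiset.mem_singleton_self t⟩
  | add _ _ ih _ => exact ih.imp fun u hu => Multiset.mem_add.2 (.inl hu)

theorem PLin.emb {ι : Type} {l : Multiset ι} {c : ι → ℂ} {a : ι → PTm} {t : PTm}
    (h : PLin (l.map fun i => (c i, a i)) t) : Tm.Lin (l.map fun i => (c i, (a i).emb)) t.emb := by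
  have := SumOf.map PTm.emb (add' := Tm.par .add) (fun _ _ => rfl) h
  simpa [Tm.Lin, Multiset.map_map, Function.comp_def, PTm.emb] using this

theorem MLin.emb {ι : Type} {l : Multiset ι} {c : ι → ℝ≥0} {a : ι → MTm} {t : MTm}
    (h : MLin (l.map fun i => (c i, a i)) t) :
    Tm.Lin (l.map fun i => (((c i : ℝ) : ℂ), (a i).emb)) t.emb := by
  have := SumOf.map MTm.emb (add' := Tm.par .add) (fun _ _ => rfl) h
  simpa [Tm.Lin, Multiset.map_map, Function.comp_def, MTm.emb] using this

namespace Sem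

variable {s : Mode} {Γ Δ : MCtx} {A B : MTy}

theorem sumOf {S : Multiset Tm} {t : Tm} (h : SumOf (Tm.par .add) S t) {V : Tm → Env → A.den}
    (hV : ∀ u ∈ S, Sem s Γ u A (V u)) : Sem s Γ t A (S.map V).sum := by
  induction h with
  | single t => simpa using hV t (Multiset.mem_singleton_self t)
  | add _ _ ih ih' =>
    rw [Multiset.map_add, Multiset.sum_add]
    exact (ih fun u hu => hV u (Multiset.mem_add.2 (.inl hu))).add
      (ih' fun u hu => hV u (Multiset.mem_add.2 (.inr hu)))

theorem sumOf_inv {S : Multiset Tm} {t : Tm} (h : SumOf (Tm.par .add) S t) {f : Env → A.den}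
    (ht : Sem s Γ t A f) : ∀ u ∈ S, ∃ g, Sem s Γ u A g := by
  induction h generalizing f with
  | single t =>
    intro u hu
    rw [Multiset.mem_singleton.1 hu]
    exact ⟨f, ht⟩
  | add _ _ ih ih' =>
    obtain ⟨g, g', h, h', -⟩ := ht.add_inv
    exact fun u hu => (Multiset.mem_add.1 hu).elim (ih h u) (ih' h' u)

/-- A choice of interpretations of the terms that have one. -/
theorem exists_val (s : Mode) (Γ : MCtx) (A : MTy) :
    ∃ V : Tm → Env → A.den, ∀ u f, Sem s Γ u A f → Sem s Γ u A (V u) := by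
  have : ∀ u, ∃ g, ∀ f, Sem s Γ u A f → Sem s Γ u A g := fun u => by
    by_cases h : ∃ f, Sem s Γ u A f
    · exact h.imp fun f hf _ _ => hf
    · exact ⟨0, fun f hf => absurd ⟨f, hf⟩ h⟩
  choose V hV using this
  exact ⟨V, hV⟩

variable {ι : Type} {l : Multiset ι} {c : ι → ℂ} {a b : ι → Tm} {t t' : Tm}

/-- The interpretation of a linear combination. -/
theorem lin (ht : Tm.Lin (l.map fun i => (c i, a i)) t) {F : ι → Env → A.den}
    (hF : ∀ i ∈ l, Sem s Γ (a i) A (F i)) : Sem s Γ t A (l.map fun i => c i • F i).sum := by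
  obtain ⟨V, hV⟩ := exists_val s Γ A
  unfold Tm.Lin at ht
  rw [Multiset.map_map] at ht
  have h := sumOf (A := A) (Γ := Γ) (s := s) ht (V := V) fun u hu => by
    obtain ⟨i, hi, rfl⟩ := Multiset.mem_map.1 hu
    exact hV _ _ ((hF i hi).smul (c i))
  rw [Multiset.map_map] at h
  rw [Multiset.map_congr rfl fun i hi => coherent ((hF i hi).smul (c i))
    (hV _ _ ((hF i hi).smul (c i)))]
  exact h

theorem lin_inv (ht : Tm.Lin (l.map fun i => (c i, a i)) t) {f : Env → A.den}
    (h : Sem s Γ t A f) : ∀ i ∈ l, ∃ F, Sem s Γ (a i) A F := fun i hi => by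
  obtain ⟨g, hg⟩ := sumOf_inv ht h (.un (.smul (c i)) (a i)) (by
    rw [Multiset.map_map]
    exact Multiset.mem_map_of_mem (fun i => Tm.un (.smul (c i)) (a i)) hi)
  obtain ⟨F, hF, -⟩ := hg.smul_inv
  exact ⟨F, hF⟩

/-- A linear operation on interpretations commutes with linear combinations. -/
theorem lin_map (ht : Tm.Lin (l.map fun i => (c i, a i)) t)
    (ht' : Tm.Lin (l.map fun i => (c i, b i)) t')
    (Λ : (Env → A.den) →ₗ[ℂ] (Env → B.den)) {f : Env → A.den} (h : Sem s Γ t A f)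
    (hab : ∀ i ∈ l, ∀ F, Sem s Γ (a i) A F → Sem s Δ (b i) B (Λ F)) : Sem s Δ t' B (Λ f) := by
  obtain ⟨V, hV⟩ := exists_val s Γ A
  have hF : ∀ i ∈ l, Sem s Γ (a i) A (V (a i)) := fun i hi =>
    (lin_inv ht h i hi).elim fun F hF => hV _ _ hF
  rw [h.coherent (lin ht hF), map_multiset_sum, Multiset.map_map]
  simp only [Function.comp_def, map_smul]
  exact lin ht' fun i hi => hab i hi _ (hF i hi)

end Sem

/-! ### Reduction -/

theorem ketbra_smul {H : FHilb} (a : ℂ) (v w : H) :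
    ketbra (a • v) (a • w) = (a * (starRingEnd ℂ) a) • ketbra v w := by
  refine LinearMap.ext fun x => ?_
  change (Inner.inner ℂ (a • w) x : ℂ) • a • v =
    (a * (starRingEnd ℂ) a) • (Inner.inner ℂ w x : ℂ) • v
  rw [inner_smul_left, smul_smul, smul_smul]
  congr 1
  ring

/-- A linear map that depends on the environment, as a linear operation on functions of the
environment. -/
def Env.lift {X Y : FCstar} (φ : Env → (X →ₗ[ℂ] Y)) : (Env → X) →ₗ[ℂ] (Env → Y) :=
  LinearMap.pi fun ρ => φ ρ ∘ₗ LinearMap.proj ρ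

/-- A bilinear map, as a bilinear operation on functions of the environment. -/
def Env.lift₂ {X Y Z : FCstar} (φ : FCstar.tensor X Y →ₗ[ℂ] Z) :
    (Env → X) →ₗ[ℂ] (Env → Y) →ₗ[ℂ] (Env → Z) :=
  LinearMap.mk₂ ℂ (fun F G ρ => φ (F ρ ⊗ₜ[ℂ] G ρ))
    (fun F F' G => funext fun ρ => by simp [TensorProduct.add_tmul])
    (fun c F G => funext fun ρ =>
      (congrArg φ (TensorProduct.smul_tmul' c (F ρ) (G ρ)).symm).trans (map_smul φ c _))
    (fun F G G' => funext fun ρ => by simp [TensorProduct.tmul_add])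
    (fun c F G => funext fun ρ => by simp [TensorProduct.tmul_smul])

theorem Tm.Lin.exists_mem {ι : Type} {l : Multiset ι} {c : ι → ℂ} {a : ι → Tm} {t : Tm}
    (h : Tm.Lin (l.map fun i => (c i, a i)) t) : ∃ i, i ∈ l := by
  obtain ⟨u, hu⟩ := SumOf.exists_mem h
  rw [Multiset.map_map] at hu
  exact (Multiset.mem_map.1 hu).imp fun i hi => hi.1

theorem Tm.Lin.inst {ι : Type} {l : Multiset ι} {c : ι → ℂ} {a : ι → Tm} {t : Tm}
    (h : Tm.Lin (l.map fun i => (c i, a i)) t) (k : ℕ) (u : Tm) :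
    Tm.Lin (l.map fun i => (c i, (a i).inst k u)) (t.inst k u) := by
  have := SumOf.map (fun m => Tm.inst m k u) (add' := Tm.par .add) (fun _ _ => rfl) h
  simpa [Tm.Lin, Multiset.map_map, Function.comp_def, Tm.inst] using this

theorem perm_swap_append {T : Type} {Ω Γ Δ : List T} (h : Ω.Perm (Γ ++ Δ)) : Ω.Perm (Δ ++ Γ) :=
  h.trans List.perm_append_comm

namespace Tm.Le

theorem elimOne (a : ℂ) (m : Tm) : Le (bin .elimOne (un (.smul a) star) m) (un (.smul a) m) := by
  intro s Ω A f h
  cases h with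
  | @bin _ _ _ _ _ _ _ B _ f g _ φ ho hA hp hd hm hn =>
    cases ho
    obtain ⟨g', hg, rfl⟩ := hm.smul_inv
    cases hg
    refine ((hn.perm hp.symm).smul a).congr fun ρ => ?_
    exact (congrArg (fun c : ℂ => c • g ρ) (mul_one a)).symm

theorem beta (m v : Tm) : Le (bin .app (lam m) v) (m.inst 0 v) := by
  intro s Ω A f h
  cases h with
  | @bin _ _ _ _ _ _ _ _ _ f g _ φ ho hA hp hd hm hn =>
    cases hm with
    | @lam _ _ _ B C L k hk hm =>
      cases ho
      refine (Sem.subst_inst hk hm hn hp hd).congr fun ρ => ?_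
      exact (LinearMap.congr_fun
        (LinearEquiv.apply_symm_apply (FCstar.ihomEquiv _ _) (k ρ)) (g ρ)).symm

theorem with1 (v w t : Tm) : Le (elimWith false (par .pair v w) t) (t.inst 0 v) := by
  intro s Ω A f h
  cases h with
  | elimWith L k ho hA hp hd hk hm hn =>
    cases hm with
    | par ho' hv hw =>
      cases ho'
      cases ho
      exact Sem.subst_inst hk hn hv (perm_swap_append hp) hd

theorem with2 (v w t : Tm) : Le (elimWith true (par .pair v w) t) (t.inst 0 w) := by
  intro s Ω A f h
  cases h with
  | elimWith L k ho hA hp hd hk hm hn =>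
    cases hm with
    | par ho' hv hw =>
      cases ho'
      cases ho
      exact Sem.subst_inst hk hn hw (perm_swap_append hp) hd

theorem plus1 (v m n : Tm) : Le (elimPlus (un .inl v) m n) (m.inst 0 v) := by
  intro s Ω A f h
  cases h with
  | elimPlus L k l hp hd hk hl hm hn hn' =>
    cases hm with
    | un ho hv =>
      cases ho
      refine (Sem.subst_inst hk hn hv (perm_swap_append hp) hd).congr fun ρ => ?_
      exact ((congrArg (_ + ·) (map_zero (l ρ))).trans (add_zero _)).symm

theorem plus2 (v m n : Tm) : Le (elimPlus (un .inr v) m n) (n.inst 0 v) := by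
  intro s Ω A f h
  cases h with
  | elimPlus L k l hp hd hk hl hm hn hn' =>
    cases hm with
    | un ho hv =>
      cases ho
      refine (Sem.subst_inst hl hn' hv (perm_swap_append hp) hd).congr fun ρ => ?_
      exact ((congrArg (· + _) (map_zero (k ρ))).trans (zero_add _)).symm

theorem tens (v w m : Tm) : Le (elimTens (bin .tens v w) m) (m.inst2 v w) := by
  intro s Ω A f h
  cases h with
  | elimTens L k hA hp hd hk hm hn =>
    cases hm with
    | bin ho hA' hp' hd' hv hw =>
      cases ho
      exact Sem.subst_inst2 hk hn hv hw ((perm_swap_append hp).trans (hp'.append_left _)) hd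

theorem commTop (a : ℂ) : Le (un (.smul a) topI) topI := by
  intro s Ω A f h
  obtain ⟨g, hg, rfl⟩ := h.smul_inv
  cases hg with
  | topI s Γ hd => exact (Sem.topI _ _ hd).congr fun ρ => (smul_zero a).symm

variable {ι : Type} {l : Multiset ι} {c : ι → ℂ} {a b : ι → Tm} {m t u : Tm}

theorem commLam (hm : Lin (l.map fun i => (c i, lam (a i))) m)
    (ht : Lin (l.map fun i => (c i, a i)) t) : Le m (lam t) := by
  intro s Γ A f h
  obtain ⟨i, hi⟩ := hm.exists_mem
  obtain ⟨F, hF⟩ := Sem.lin_inv hm h i hi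
  cases hF with
  | @lam _ _ _ B C L k hk hF =>
    refine (Sem.lam (domC Γ).toFinset (fun ρ => FCstar.ihomEquiv B.den C.den (f ρ))
      (fun ρ ρ' hρ => congrArg (FCstar.ihomEquiv B.den C.den) (h.supp ρ ρ' hρ)) fun x hx =>
        ?_).congr
      fun ρ => LinearEquiv.symm_apply_apply (FCstar.ihomEquiv B.den C.den) _
    rw [List.mem_toFinset] at hx
    refine Sem.lin_map hm (ht.inst 0 (.fvar x)) (Env.lift (X := (MTy.lolli B C).den) fun ρ =>
      (LinearMap.applyₗ (ρ x B)) ∘ₗ (FCstar.ihomEquiv B.den C.den).toLinearMap) h fun j _ F hF => ?_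
    cases hF with
    | lam L k hk hF =>
      refine (Sem.subst_inst hk hF (Sem.ax s x B) (List.perm_append_comm (l₁ := [_]))
        (List.nodup_cons.2 ⟨hx, h.nodup⟩)).congr fun ρ => ?_
      exact congrArg (fun l : B.den →ₗ[ℂ] C.den => l (ρ x B))
        (LinearEquiv.apply_symm_apply (FCstar.ihomEquiv B.den C.den) (k ρ)).symm

theorem commPair (hm : Lin (l.map fun i => (c i, par .pair (a i) (b i))) m)
    (ht : Lin (l.map fun i => (c i, a i)) t) (hu : Lin (l.map fun i => (c i, b i)) u) :
    Le m (par .pair t u) := by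
  intro s Γ A f h
  obtain ⟨i, hi⟩ := hm.exists_mem
  obtain ⟨F, hF⟩ := Sem.lin_inv hm h i hi
  cases hF with
  | @par _ _ _ _ B C _ _ _ _ φ ho h1 h2 =>
    cases ho
    refine Sem.par (.pair B C)
      (Sem.lin_map hm ht (Env.lift (X := (MTy.oplus B C).den) fun ρ => LinearMap.fst ℂ B.den C.den)
        h fun j _ F hF => ?_)
      (Sem.lin_map hm hu (Env.lift (X := (MTy.oplus B C).den) fun ρ => LinearMap.snd ℂ B.den C.den)
        h fun j _ F hF => ?_)
    all_goals
      cases hF with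
      | par ho h1 h2 => cases ho; assumption

theorem commUn (o : UnOp) (hm : Lin (l.map fun i => (c i, a i)) m)
    (ht : Lin (l.map fun i => (c i, un o (a i))) t) : Le (un o m) t := by
  intro s Γ A f h
  cases h with
  | un ho h => exact Sem.lin_map hm ht (Env.lift fun _ => _) h fun j _ F hF => .un ho hF

theorem commTens (n : Tm) (hm : Lin (l.map fun i => (c i, a i)) m)
    (ht : Lin (l.map fun i => (c i, Tm.elimTens (a i) n)) t) : Le (Tm.elimTens m n) t := by
  intro s Γ A f h
  cases h with
  | elimTens L k hA hp hd hk h hn =>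
    exact Sem.lin_map hm ht (Env.lift k) h fun j _ F hF => .elimTens L k hA hp hd hk hF hn

theorem commPlus (n o : Tm) (hm : Lin (l.map fun i => (c i, a i)) m)
    (ht : Lin (l.map fun i => (c i, Tm.elimPlus (a i) n o)) t) : Le (Tm.elimPlus m n o) t := by
  intro s Γ A f h
  cases h with
  | @elimPlus _ _ _ _ _ _ _ B C _ _ L k k' hp hd hk hk' h hn hn' =>
    exact Sem.lin_map hm ht (Env.lift (X := (MTy.oplus B C).den) fun ρ => (k ρ).coprod (k' ρ)) h
      fun j _ F hF => .elimPlus L k k' hp hd hk hk' hF hn hn'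

theorem commBox (a : ℂ) (v : Tm) :
    Le (box (un (.smul a) v)) (un (.smul (((‖a‖₊ ^ 2 : ℝ≥0) : ℝ) : ℂ)) (box v)) := by
  intro s Γ A f h
  cases h with
  | box P h =>
    obtain ⟨g, hg, rfl⟩ := h.smul_inv
    refine ((Sem.box (s := s) P hg).smul _).congr fun ρ => ?_
    have e : P.iso.symm ((a • g) ρ) = a • P.iso.symm (g ρ) := map_smul P.iso.symm a (g ρ)
    have e' : (((‖a‖₊ ^ 2 : ℝ≥0) : ℝ) : ℂ) = a * (starRingEnd ℂ) a := by
      rw [Complex.mul_conj, Complex.normSq_eq_norm_sq]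
      simp
    rw [e, ketbra_smul, ← e']
    rfl

theorem cast (v w : Tm) : Le (un .tau (bin .tens (box v) (box w))) (box (bin .tens v w)) := by
  intro s Γ A f h
  cases h with
  | un ho h =>
    cases h with
    | bin ho' hA hp hd hv hw =>
      cases hv with
      | box P hv =>
        cases hw with
        | box Q hw =>
          cases ho'
          cases ho
          obtain rfl := List.perm_nil.1 hp
          have := Sem.box (s := s) (.tens P Q) (Sem.bin (.tens P.emb Q.emb)
            (show Mode.pure.Ok P.emb from ⟨P, rfl⟩) (List.Perm.refl []) List.nodup_nil hv hw)
          exact this.congr fun ρ => (tauIso_ketbra _ _ _ _).symm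

theorem _root_.Multiset.sum_map_product_bilin {ι κ V W Z : Type*} [AddCommGroup V] [Module ℂ V]
    [AddCommGroup W] [Module ℂ W] [AddCommGroup Z] [Module ℂ Z] (β : V →ₗ[ℂ] W →ₗ[ℂ] Z)
    (l : Multiset ι) (k : Multiset κ) (c : ι → ℂ) (d : κ → ℂ) (F : ι → V) (G : κ → W) :
    ((l ×ˢ k).map fun z => (c z.1 * d z.2) • β (F z.1) (G z.2)).sum =
      β (l.map fun i => c i • F i).sum (k.map fun j => d j • G j).sum := by
  induction l using Multiset.induction_on with
  | empty => simp
  | cons i l ih =>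
    rw [Multiset.cons_product, Multiset.map_add, Multiset.sum_add, ih, Multiset.map_cons,
      Multiset.sum_cons, map_add, LinearMap.add_apply, map_multiset_sum (β (c i • F i)),
      Multiset.map_map, Multiset.map_map]
    simp [smul_smul]

/-- The application of a boxed function to a boxed argument. -/
theorem _root_.Sem.boxApp {s s' : Mode} {Γ Δ : MCtx} {v w : Tm} {P Q : PTy}
    {F : Env → (MTy.B (.lolli P Q)).den} {G : Env → (MTy.B P).den}
    (hv : Sem s Γ (box v) (.B (.lolli P Q)) F) (hw : Sem s' Δ (box w) (.B P) G) :
    Γ = [] ∧ Δ = [] ∧ Sem s [] (box (bin .app v w)) (.B Q) (fun ρ =>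
      BMap (FHilb.eval P.den Q.den) (tauIso (.ihom P.den Q.den) P.den (F ρ ⊗ₜ G ρ))) := by
  cases hv with
  | @box _ _ _ f hv =>
    cases hw with
    | @box _ _ _ g hw =>
      refine ⟨rfl, rfl, ?_⟩
      have := Sem.box (s := s) Q (Sem.bin (.app P.emb Q.emb)
        (show Mode.pure.Ok (PTy.lolli P Q).emb from ⟨_, rfl⟩) (List.Perm.refl []) List.nodup_nil hv
          hw)
      refine this.congr fun ρ => ?_
      have e : Q.iso.symm (FCstar.eval P.emb.den Q.emb.den (f ρ ⊗ₜ g ρ)) =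
          FHilb.eval P.den Q.den ((PTy.lolli P Q).iso.symm (f ρ) ⊗ₜ P.iso.symm (g ρ)) :=
        (LinearEquiv.symm_apply_eq _).2 (PTy.iso_eval (f ρ) (g ρ)).symm
      refine (congrArg (fun z => ketbra z z) e).trans ?_
      exact ((congrArg (BMap (FHilb.eval P.den Q.den)) (tauIso_ketbra _ _ _ _)).trans
        (BMap_ketbra _ _ _)).symm

theorem commApp {κ : Type} {k : Multiset κ} {d : κ → ℂ} {n : Tm} {b : κ → Tm}
    (hm : Lin (l.map fun i => (c i, box (a i))) m) (hn : Lin (k.map fun j => (d j, box (b j))) n)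
    (hu : Lin ((l ×ˢ k).map fun z => (c z.1 * d z.2, box (bin .app (a z.1) (b z.2)))) u) :
    Le (bin .app m n) u := by
  intro s Ω A f h
  obtain ⟨i, hi⟩ := hm.exists_mem
  obtain ⟨j, hj⟩ := hn.exists_mem
  cases h with
  | @bin _ Γ Δ _ _ _ _ _ _ f g _ φ ho hA hp hd h h' =>
    obtain ⟨F, hF⟩ := Sem.lin_inv hm h i hi
    obtain ⟨G, hG⟩ := Sem.lin_inv hn h' j hj
    cases ho with
    | app => cases hF
    | boxApp P Q =>
      obtain ⟨rfl, rfl, -⟩ := hF.boxApp hG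
      obtain rfl := List.perm_nil.1 hp
      obtain ⟨V, hV⟩ := Sem.exists_val s [] (.B (.lolli P Q))
      obtain ⟨W, hW⟩ := Sem.exists_val s [] (.B P)
      have h1 : ∀ i ∈ l, Sem s [] (box (a i)) _ (V (box (a i))) := fun i hi =>
        (Sem.lin_inv hm h i hi).elim fun F hF => hV _ _ hF
      have h2 : ∀ j ∈ k, Sem s [] (box (b j)) _ (W (box (b j))) := fun j hj =>
        (Sem.lin_inv hn h' j hj).elim fun F hF => hW _ _ hF
      let β := Env.lift₂ (X := (MTy.B (.lolli P Q)).den) (Y := (MTy.B P).den) (Z := (MTy.B Q).den)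
        (BMap (FHilb.eval P.den Q.den) ∘ₗ (tauIso (.ihom P.den Q.den) P.den).toLinearMap)
      have := Sem.lin hu (A := .B Q) (F := fun z => β (V (box (a z.1))) (W (box (b z.2))))
        fun z hz => ((h1 z.1 (Multiset.mem_product.1 hz).1).boxApp
          (h2 z.2 (Multiset.mem_product.1 hz).2)).2.2
      have e := Multiset.sum_map_product_bilin β l k c d (fun i => V (box (a i)))
        (fun j => W (box (b j)))
      beta_reduce at e
      rw [e, (Sem.lin hm h1).coherent h, (Sem.lin hn h2).coherent h']
        at this
      exact this

end Tm.Le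

/-! ### Soundness -/

namespace Tm.Le

variable {m m' : Tm}

theorem un (o : UnOp) (h : Le m m') : Le (Tm.un o m) (Tm.un o m') := by
  intro s Γ A f hm
  cases hm with
  | un ho hm => exact .un ho (h _ _ _ _ hm)

theorem parL (o : ParOp) (n : Tm) (h : Le m m') : Le (par o m n) (par o m' n) := by
  intro s Γ A f hm
  cases hm with
  | par ho hm hn => exact .par ho (h _ _ _ _ hm) hn

theorem parR (o : ParOp) (n : Tm) (h : Le m m') : Le (par o n m) (par o n m') := by
  intro s Γ A f hm
  cases hm with
  | par ho hn hm => exact .par ho hn (h _ _ _ _ hm)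

theorem binL (o : BinOp) (n : Tm) (h : Le m m') : Le (bin o m n) (bin o m' n) := by
  intro s Γ A f hm
  cases hm with
  | bin ho hA hp hd hm hn => exact .bin ho hA hp hd (h _ _ _ _ hm) hn

theorem binR (o : BinOp) (n : Tm) (h : Le m m') : Le (bin o n m) (bin o n m') := by
  intro s Γ A f hm
  cases hm with
  | bin ho hA hp hd hn hm => exact .bin ho hA hp hd hn (h _ _ _ _ hm)

theorem elimZero (h : Le m m') : Le (Tm.elimZero m) (Tm.elimZero m') := by
  intro s Γ A f hm
  cases hm with
  | elimZero A hp hd hm => exact .elimZero A hp hd (h _ _ _ _ hm)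

theorem elimWith (i : Bool) (n : Tm) (h : Le m m') :
    Le (Tm.elimWith i m n) (Tm.elimWith i m' n) := by
  intro s Γ A f hm
  cases hm with
  | elimWith L k ho hA hp hd hk hm hn => exact .elimWith L k ho hA hp hd hk (h _ _ _ _ hm) hn

theorem elimPlus (n o : Tm) (h : Le m m') : Le (Tm.elimPlus m n o) (Tm.elimPlus m' n o) := by
  intro s Γ A f hm
  cases hm with
  | elimPlus L k l hp hd hk hl hm hn ho =>
    exact .elimPlus L k l hp hd hk hl (h _ _ _ _ hm) hn ho

theorem elimTens (n : Tm) (h : Le m m') : Le (Tm.elimTens m n) (Tm.elimTens m' n) := by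
  intro s Γ A f hm
  cases hm with
  | elimTens L k hA hp hd hk hm hn => exact .elimTens L k hA hp hd hk (h _ _ _ _ hm) hn

theorem box (h : Le m m') : Le (Tm.box m) (Tm.box m') := by
  intro s Γ A f hm
  cases hm with
  | box P hm => exact .box P (h _ _ _ _ hm)

end Tm.Le

theorem PLin.emb_self {l : Multiset (ℂ × PTm)} {t : PTm} (h : PLin l t) :
    Tm.Lin (l.map fun q => (q.1, q.2.emb)) t.emb :=
  PLin.emb (l := l) (c := Prod.fst) (a := Prod.snd) (by rwa [Multiset.map_id'])

theorem MLin.emb_self {l : Multiset (ℝ≥0 × MTm)} {t : MTm} (h : MLin l t) :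
    Tm.Lin (l.map fun q => (((q.1 : ℝ) : ℂ), q.2.emb)) t.emb :=
  MLin.emb (l := l) (c := Prod.fst) (a := Prod.snd) (by rwa [Multiset.map_id'])

theorem PStep.le {m n : PTm} (h : PStep m n) : Tm.Le m.emb n.emb := by
  induction h with
  | one a m => exact .elimOne _ _
  | beta m _ => rw [PTm.emb_inst]; exact .beta _ _
  | with1 t _ _ => rw [PTm.emb_inst]; exact .with1 _ _ _
  | with2 t _ _ => rw [PTm.emb_inst]; exact .with2 _ _ _
  | tens m _ _ => rw [PTm.emb_inst2]; exact .tens _ _ _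
  | commTop a => exact .commTop a
  | commLam l _ hs ht => exact .commLam hs.emb ht.emb_self
  | commPair l _ _ hs ht hu => exact .commPair hs.emb ht.emb hu.emb
  | commTens l m _ _ hs ht => exact .commTens _ hs.emb_self ht.emb
  | addL n _ ih => exact ih.parL _ _
  | smul a _ ih => exact ih.un _
  | elimOne n _ ih => exact ih.binL _ _
  | appL n _ ih => exact ih.binL _ _
  | appR _ _ ih => exact ih.binR _ _
  | pairL n _ ih => exact ih.parL _ _
  | pairR _ _ ih => exact ih.parR _ _
  | elimWith1 n _ ih => exact ih.elimWith _ _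
  | elimWith2 n _ ih => exact ih.elimWith _ _
  | tensL n _ ih => exact ih.binL _ _
  | tensR _ _ ih => exact ih.binR _ _
  | elimTens n _ ih => exact ih.elimTens _

theorem MStep.le {m n : MTm} (h : MStep m n) : Tm.Le m.emb n.emb := by
  induction h with
  | one p m => exact .elimOne _ _
  | beta m _ => rw [MTm.emb_inst]; exact .beta _ _
  | plus1 m n _ => rw [MTm.emb_inst]; exact .plus1 _ _ _
  | plus2 m n _ => rw [MTm.emb_inst]; exact .plus2 _ _ _
  | tens m _ _ => rw [MTm.emb_inst2]; exact .tens _ _ _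
  | commLam l _ hs ht => exact .commLam hs.emb ht.emb_self
  | commPlus l n o _ _ hs ht => exact .commPlus _ _ hs.emb_self ht.emb
  | commTens l m _ _ hs ht => exact .commTens _ hs.emb_self ht.emb
  | commInl l _ _ hs ht => exact .commUn .inl hs.emb_self ht.emb
  | commInr l _ _ hs ht => exact .commUn .inr hs.emb_self ht.emb
  | cast _ _ => exact .cast _ _
  | commTau l _ _ hs ht => exact .commUn .tau hs.emb_self ht.emb
  | commB a _ _ => exact .commBox _ _
  | commApp l k _ _ _ _ hs ht hu =>
    have := hu.emb
    simp only [NNReal.coe_mul, Complex.ofReal_mul] at this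
    exact .commApp hs.emb ht.emb this
  | addL n _ ih => exact ih.parL _ _
  | smul a _ ih => exact ih.un _
  | elimZero _ ih => exact ih.elimZero
  | elimOne n _ ih => exact ih.binL _ _
  | appL n _ ih => exact ih.binL _ _
  | appR _ _ ih => exact ih.binR _ _
  | inl _ ih => exact ih.un _
  | inr _ ih => exact ih.un _
  | elimPlus n o _ ih => exact ih.elimPlus _ _
  | tensL n _ ih => exact ih.binL _ _
  | tensR _ _ ih => exact ih.binR _ _
  | elimTens n _ ih => exact ih.elimTens _
  | B h => exact h.le.box
  | tau _ ih => exact ih.un _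

/-- The backward direction uses that both terms are proof terms of the judgement, and coherence. -/
theorem PConv.sem_iff {Γ : PCtx} {P : PTy} {m n : PTm} (h : PConv Γ P m n)
    {f : Env → P.emb.den} :
    Sem .pure (PDer.embC Γ) m.emb P.emb f ↔ Sem .pure (PDer.embC Γ) n.emb P.emb f := by
  induction h with
  | rel m n h =>
    obtain ⟨hr, ⟨D⟩, -⟩ := h
    refine ⟨fun hm => hm.rw hr.emb, fun hn => ?_⟩
    rw [hn.coherent (D.sem.rw hr.emb)]
    exact D.sem
  | refl m => exact Iff.rfl
  | symm _ _ _ ih => exact ih.symm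
  | trans _ _ _ _ _ ih ih' => exact ih.trans ih'

theorem MConv.sem_iff {Γ : MCtx} {A : MTy} {m n : MTm} (h : MConv Γ A m n) {f : Env → A.den} :
    Sem .mixed Γ m.emb A f ↔ Sem .mixed Γ n.emb A f := by
  induction h with
  | rel m n h =>
    obtain ⟨hr, ⟨D⟩, -⟩ := h
    refine ⟨fun hm => hm.rw hr.emb, fun hn => ?_⟩
    rw [hn.coherent (D.sem.rw hr.emb)]
    exact D.sem
  | refl m => exact Iff.rfl
  | symm _ _ _ ih => exact ih.symm
  | trans _ _ _ _ _ ih ih' => exact ih.trans ih'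

theorem PHook.sem {Γ : PCtx} {P : PTy} {m n : PTm} (h : PHook Γ P m n) {f : Env → P.emb.den}
    (hm : Sem .pure (PDer.embC Γ) m.emb P.emb f) : Sem .pure (PDer.embC Γ) n.emb P.emb f := by
  cases h with
  | step h => exact h.le _ _ _ _ hm
  | val h _ => exact h.sem_iff.1 hm
  | alg _ h _ h' => exact h'.le _ _ _ _ (h.sem_iff.1 hm)

theorem MHook.sem {Γ : MCtx} {A : MTy} {m n : MTm} (h : MHook Γ A m n) {f : Env → A.den}
    (hm : Sem .mixed Γ m.emb A f) : Sem .mixed Γ n.emb A f := by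
  cases h with
  | step h => exact h.le _ _ _ _ hm
  | val h _ => exact h.sem_iff.1 hm
  | alg _ h _ h' => exact h'.le _ _ _ _ (h.sem_iff.1 hm)

theorem PDer.den_eq {Γ : PCtx} {P : PTy} {m n : PTm} (D : PDer Γ m P) (D' : PDer Γ n P)
    (h : Sem .pure (PDer.embC Γ) n.emb P.emb fun ρ => P.iso (D.den (PDer.pt ρ Γ))) :
    D.den = D'.den :=
  PDer.ext_pt D.nodup fun ρ => P.iso.injective (congrFun (h.coherent D'.sem) ρ)

theorem MDer.den_eq {Γ : MCtx} {A : MTy} {m n : MTm} (D : MDer Γ m A) (D' : MDer Γ n A)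
    (h : Sem .mixed Γ n.emb A fun ρ => D.den (MDer.pt ρ Γ)) : D.den = D'.den :=
  MDer.ext_pt D.nodup fun ρ => congrFun (h.coherent D'.sem) ρ

theorem pure_soundness {Γ : PCtx} {M N : PTm} {P : PTy} (D : PDer Γ M P)
    (h : Relation.ReflTransGen (PHook Γ P) M N) :
    Nonempty (PDer Γ N P) ∧ ∀ D' : PDer Γ N P, D.den = D'.den := by
  have hN : Sem .pure (PDer.embC Γ) N.emb P.emb fun ρ => P.iso (D.den (PDer.pt ρ Γ)) := by
    induction h with
    | refl => exact D.sem
    | tail _ h ih => exact h.sem ih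
  exact ⟨hN.pder rfl rfl rfl rfl, fun D' => D.den_eq D' hN⟩

theorem mixed_soundness {Γ : MCtx} {M N : MTm} {A : MTy} (D : MDer Γ M A)
    (h : Relation.ReflTransGen (MHook Γ A) M N) :
    Nonempty (MDer Γ N A) ∧ ∀ D' : MDer Γ N A, D.den = D'.den := by
  have hN : Sem .mixed Γ N.emb A fun ρ => D.den (MDer.pt ρ Γ) := by
    induction h with
    | refl => exact D.sem
    | tail _ h ih => exact h.sem ih
  exact ⟨hN.mder rfl, fun D' => D.den_eq D' hN⟩

end

theorem mainTheorem2 :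
    (∀ (Γ : PCtx) (M N : PTm) (P : PTy) (D : PDer Γ M P),
      Relation.ReflTransGen (PHook Γ P) M N →
        Nonempty (PDer Γ N P) ∧ ∀ D' : PDer Γ N P, D.den = D'.den) ∧
    (∀ (Γ : MCtx) (M N : MTm) (A : MTy) (D : MDer Γ M A),
      Relation.ReflTransGen (MHook Γ A) M N →
        Nonempty (MDer Γ N A) ∧ ∀ D' : MDer Γ N A, D.den = D'.den) ∧
    (∀ (Γ : MCtx) (M : MTm) (A : MTy) (D : MDer Γ M A), IsCP D.den) ∧
    BIsStrongMonoidal :=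
  ⟨fun _ _ _ _ D h => pure_soundness D h, fun _ _ _ _ D h => mixed_soundness D h,
    fun _ _ _ D => (MDer.isTensorPos_den D).isCP, bIsStrongMonoidal⟩
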